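/- Let $X$ be a proper CAT(0)-space with visual boundary $\partial X$, let $\Delta\subset\partial X\times\partial X$ be the diagonal, and let $G<\mathrm{Iso}(X)$ be a closed subgroup (for the compact open topology) with limit set $\Lambda\subset\partial X$ and left Haar measure $\mu$. Assume that $G$ is non-elementary, i.e. $\Lambda$ has at least three points and $G$ fixes no point of $\partial X$. A geodesic $\gamma:\mathbb R\to X$ is $B$-contracting if for every closed metric ball $K$ disjoint from $\gamma(\mathbb R)$ the shortest distance projection of $K$ into $\gamma(\mathbb R)$ has diameter at most $B$. An isometry $g$ is rank-one if its displacement function $x\mapsto d(x,gx)$ has a positive minimum and if for some $B'>0$ it has a $B'$-contracting axis, i.e. a $B'$-contracting geodesic which it translates by this minimum. For $B>0$ let $\mathcal A(B)\subset\partial X\times\partial X-\Delta$ be the set of pairs of points which are connected by a $B$-contracting geodesic, and let $T(B)$ be the set of triples $(a_1,a_2,a_3)$ of pairwise distinct points of $\Lambda$ with $(a_1,a_2),(a_2,a_3),(a_3,a_1)\in\mathcal A(B)$. Let $C_b(G\times G)$ be the space of continuous bounded real functions on $G\times G$ with the compact open topology. For $p\in(1,\infty)$, an $L^p(G\times G,\mu\times\mu)$-valued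 continuous bounded two-cocycle on $T(B)$ is a continuous map $\omega:T(B)\to L^p(G\times G,\mu\times\mu)$ with bounded image such that (i) for all $g\in G$ and $t\in T(B)$, $\omega(gt)(gh,gu)=\omega(t)(h,u)$ for almost every $(h,u)$; (ii) $\omega\circ\sigma=\mathrm{sgn}(\sigma)\,\omega$ for every permutation $\sigma$ of the three variables; (iii) $\omega(a_2,a_3,a_4)-\omega(a_1,a_3,a_4)+\omega(a_1,a_2,a_4)-\omega(a_1,a_2,a_3)=0$ for all pairwise distinct $a_1,\dots,a_4\in\Lambda$ with $(a_i,a_j)\in\mathcal A(B)$ for all $i\neq j$. **Theorem.** Let $x_0\in X$, let $B>0$ and let $(a,b,\xi)\in T(B)$ be such that $(a,b)$ is the pair of fixed points in $\partial X$ of a rank-one element of $G$. Then there is a continuous map $\alpha:\mathcal A(B)\to C_b(G\times G)$ with the following properties. 1. $\alpha(g\sigma,g\eta)(gh,gu)=\alpha(\sigma,\eta)(h,u)$ and $\alpha(\eta,\sigma)=-\alpha(\sigma,\eta)$ for all $(\sigma,\eta)\in\mathcal A(B)$ and $g,h,u\in G$. 2. For every $(\sigma,\eta)\in\mathcal A(B)$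 and all open neighborhoods $A_1$ of $\sigma$ and $A_2$ of $\eta$ in $X\cup\partial X$, the intersection of the support of $\alpha(\sigma,\eta)$ with $\{(g,h)\in G\times G\mid gx_0\in X-(A_1\cup A_2)\}$ is compact. 3. For every $p\in(1,\infty)$ the assignment $\omega(\sigma,\eta,\beta)=\alpha(\sigma,\eta)+\alpha(\eta,\beta)+\alpha(\beta,\sigma)$ is an $L^p(G\times G,\mu\times\mu)$-valued continuous bounded two-cocycle on $T(B)$. 4. $\omega(a,b,\xi)\neq 0$. 5. If $G$ does not act transitively on $\Lambda\times\Lambda-\Delta$ and if $(a_i,b_i)\in\mathcal A(B)$ $(i=1,\dots,k)$ are pairs of fixed points of rank-one elements of $G$ whose $G$-orbits are disjoint from the $G$-orbit of $(a,b)$, then $\alpha$ can be chosen, with properties 1-4, in such a way that its support, viewed as the support of a function on $\mathcal A(B)\times G\times G$, contains no point $(a_i,b_i,z)$ with $1\le i\le k$ and $z\in G\times G$. -/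

import Mathlib

open Set Filter Topology MeasureTheory
open scoped NNReal ENNReal

namespace RankOne

/-! ### Spaces of nonpositive curvature -/

/-- A CAT(0)-space: a geodesic metric space in which every geodesic triangle is at least as thin
as its comparison triangle in the Euclidean plane.  Here `p` lies on a side from `x` to `y`, `q`
on a side from `x` to `z`, and `p'`, `q'` are the comparison points of `p`, `q` in the comparison
triangle `x'`, `y'`, `z'`. -/
structure IsCAT0 (X : Type*) [MetricSpace X] : Prop where
  geodesic : ∀ x y : X, ∃ γ : ℝ → X, γ 0 = x ∧ γ (dist x y) = y ∧
    ∀ s ∈ Icc 0 (dist x y), ∀ t ∈ Icc 0 (dist x y), dist (γ s) (γ t) = |s - t|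
  comparison : ∀ (x y z p q : X) (x' y' z' p' q' : EuclideanSpace ℝ (Fin 2)),
    dist x' y' = dist x y → dist y' z' = dist y z → dist x' z' = dist x z →
    dist x p + dist p y = dist x y → dist x' p' = dist x p → dist p' y' = dist p y →
    dist x q + dist q z = dist x z → dist x' q' = dist x q → dist q' z' = dist q z →
    dist p q ≤ dist p' q'

/-! ### The visual boundary and the compactification -/

section Boundary

variable (X : Type*) [MetricSpace X]

/-- Geodesic rays in `X` (with arbitrary starting point), with the topology of uniform convergence
on compact sets. -/
abbrev GeodesicRay : Type _ := {c : C(ℝ≥0, X) // Isometry c}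

/-- Two rays are asymptotic if they stay at bounded distance. -/
instance asymptoticSetoid : Setoid (GeodesicRay X) where
  r c c' := ∃ C : ℝ, ∀ t, dist (c.1 t) (c'.1 t) ≤ C
  iseqv :=
    { refl := fun c => ⟨0, fun t => by simp⟩
      symm := fun {c c'} ⟨C, h⟩ => ⟨C, fun t => by rw [dist_comm]; exact h t⟩
      trans := fun {c c' c''} ⟨C, h⟩ ⟨C', h'⟩ =>
        ⟨C + C', fun t => (dist_triangle _ _ _).trans (add_le_add (h t) (h' t))⟩ }

/-- The visual boundary `∂X`: asymptote classes of geodesic rays.  Its topology is the quotient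
of the topology of uniform convergence on compact sets on the space of all rays.  (In a proper
CAT(0)-space every class has exactly one ray starting at a given point `x`, which depends
continuously on a ray of the class, so this is the usual topology on the rays from `x`.) -/
abbrev Boundary : Type _ := Quotient (asymptoticSetoid X)

/-- The set `X ∪ ∂X`. -/
inductive Bordification : Type _
  | point (x : X) : Bordification
  | ideal (ξ : Boundary X) : Bordification

/-- Generalized rays: geodesic rays, and geodesic segments `[0, T] → X` extended by a constant
map to `[T, ∞)`, with the topology of uniform convergence on compact sets. -/
abbrev GeneralizedRay : Type _ :=
  {c : C(ℝ≥0, X) // Isometry c ∨ ∃ T : ℝ≥0, ∀ s t, dist (c s) (c t) = dist (min s T) (min t T)}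

variable {X}

open Classical in
/-- The endpoint in `X ∪ ∂X` of a generalized ray. -/
noncomputable def GeneralizedRay.endpoint (c : GeneralizedRay X) : Bordification X :=
  if h : Isometry c.1 then .ideal (Quotient.mk _ ⟨c.1, h⟩)
  else .point (c.1 (Classical.choose (c.2.resolve_left h)))

/-- The cone topology on `X ∪ ∂X`: the quotient topology for the endpoint map on generalized rays.
(As for `∂X`, this is the topology of uniform convergence on compact sets of the generalized rays
which start at a fixed point.) -/
noncomputable instance : TopologicalSpace (Bordification X) :=
  TopologicalSpace.coinduced GeneralizedRay.endpoint inferInstance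

/-- The endpoint `γ(∞)` of a geodesic line. -/
def posEnd (γ : ℝ → X) (hγ : Isometry γ) : Boundary X :=
  Quotient.mk _ ⟨⟨fun t : ℝ≥0 => γ t, hγ.continuous.comp NNReal.continuous_coe⟩,
    hγ.comp isometry_subtype_coe⟩

/-- The endpoint `γ(-∞)` of a geodesic line. -/
def negEnd (γ : ℝ → X) (hγ : Isometry γ) : Boundary X :=
  posEnd (fun t => γ (-t)) (hγ.comp (IsometryEquiv.neg ℝ).isometry)

end Boundary

/-! ### Isometries -/

section Isometries

variable {X : Type*} [MetricSpace X]

/-- The compact open topology on the isometry group. -/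
instance : TopologicalSpace (X ≃ᵢ X) :=
  TopologicalSpace.induced (fun g => (⟨g, g.continuous⟩ : C(X, X))) inferInstance

/-- The image of a geodesic ray under an isometry. -/
def mapRay (g : X ≃ᵢ X) (c : GeodesicRay X) : GeodesicRay X :=
  ⟨⟨fun t => g (c.1 t), g.continuous.comp c.1.continuous⟩, g.isometry.comp c.2⟩

/-- The action of the isometry group on the visual boundary. -/
instance : MulAction (X ≃ᵢ X) (Boundary X) where
  smul g := Quotient.map (mapRay g) fun c c' ⟨C, h⟩ =>
    ⟨C, fun t => by simpa [mapRay, g.isometry.dist_eq] using h t⟩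
  one_smul ξ := Quotient.inductionOn ξ fun c => rfl
  mul_smul g h ξ := Quotient.inductionOn ξ fun c => rfl

/-- `g` is axial: its displacement function has a positive minimum. -/
def IsAxial (g : X ≃ᵢ X) : Prop :=
  ∃ τ : ℝ, 0 < τ ∧ IsLeast (range fun x => dist x (g x)) τ

/-- `γ` is an oriented axis for `g`: a geodesic line which `g` translates by the minimal
displacement of `g`. -/
def IsAxis (g : X ≃ᵢ X) (γ : ℝ → X) : Prop :=
  Isometry γ ∧ ∃ τ : ℝ, IsLeast (range fun x => dist x (g x)) τ ∧ ∀ t, g (γ t) = γ (t + τ)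

/-- A geodesic with image `S` is `B`-contracting: for every closed ball `K` disjoint from `S`, the
shortest distance projection of `K` into `S` has diameter at most `B`. -/
def IsContracting (B : ℝ) (S : Set X) : Prop :=
  ∀ (z : X) (r : ℝ), Disjoint (Metric.closedBall z r) S →
    ∀ x ∈ Metric.closedBall z r, ∀ y ∈ Metric.closedBall z r, ∀ p ∈ S, ∀ q ∈ S,
      dist x p = Metric.infDist x S → dist y q = Metric.infDist y S → dist p q ≤ B

/-- `g` is rank-one: it is axial and has an axis which is `B`-contracting for some `B > 0`. -/
def IsRankOne (g : X ≃ᵢ X) : Prop :=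
  IsAxial g ∧ ∃ B : ℝ, 0 < B ∧ ∃ γ : ℝ → X, IsAxis g γ ∧ IsContracting B (range γ)

/-- `𝒜(B)`: the pairs of distinct points in `∂X` which are connected by a `B`-contracting
geodesic. -/
def contractingPairs (X : Type*) [MetricSpace X] (B : ℝ) : Set (Boundary X × Boundary X) :=
  {a | a.1 ≠ a.2 ∧ ∃ (γ : ℝ → X) (hγ : Isometry γ),
    negEnd γ hγ = a.1 ∧ posEnd γ hγ = a.2 ∧ IsContracting B (range γ)}

variable (G : Subgroup (X ≃ᵢ X))

/-- The limit set of `G`: the accumulation points in `∂X` of an orbit of `G` on `X`.  (It does not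
depend on the orbit.) -/
def limitSet : Set (Boundary X) :=
  {ξ | ∃ x : X, AccPt (Bordification.ideal ξ)
    (𝓟 (range fun g : G => Bordification.point ((g : X ≃ᵢ X) x)))}

/-- `G` is non-elementary: its limit set contains at least three points, and `G` does not fix a
point in `∂X`. -/
def IsNonElementary : Prop :=
  3 ≤ (limitSet G).encard ∧ ¬ ∃ ξ : Boundary X, ∀ g : G, g • ξ = ξ

/-- `G` acts transitively on the complement of the diagonal in `Λ × Λ`. -/
def IsTransitiveOnPairs : Prop :=
  ∀ a ∈ limitSet G, ∀ b ∈ limitSet G, ∀ a' ∈ limitSet G, ∀ b' ∈ limitSet G,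
    a ≠ b → a' ≠ b' → ∃ g : G, g • a = a' ∧ g • b = b'

/-- `(a, b)` is the pair of fixed points in `∂X` of a rank-one element of `G`. -/
def IsRankOnePair (a b : Boundary X) : Prop :=
  a ≠ b ∧ ∃ g : X ≃ᵢ X, g ∈ G ∧ IsRankOne g ∧ {ξ : Boundary X | g • ξ = ξ} = {a, b}

/-- `T(B)`: triples of pairwise distinct points in the limit set whose consecutive pairs (indices
modulo three) are in `𝒜(B)`. -/
def contractingTriples (B : ℝ) : Set (Fin 3 → Boundary X) :=
  {t | (∀ i, t i ∈ limitSet G) ∧ Function.Injective t ∧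
    ∀ i, (t i, t (i + 1)) ∈ contractingPairs X B}

/-! ### Cocycles -/

variable [MeasurableSpace G] (μ : Measure G)

/-- `ω` is a continuous bounded two-cocycle for the action of `G` on `T(B)` with values in
`L^p(G × G, μ × μ)`; only the restriction of `ω` to `T(B)` matters.  The group `G` acts on
`L^p(G × G, μ × μ)` by left translation. -/
structure IsContinuousBoundedCocycle (B : ℝ) (p : ℝ≥0∞) [Fact (1 ≤ p)]
    (ω : (Fin 3 → Boundary X) → Lp ℝ p (μ.prod μ)) : Prop where
  continuousOn : ContinuousOn ω (contractingTriples G B)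
  bounded : ∃ C : ℝ, ∀ t ∈ contractingTriples G B, ‖ω t‖ ≤ C
  equivariant : ∀ g : G, ∀ t ∈ contractingTriples G B,
    ∀ᵐ z ∂(μ.prod μ), ω (g • t) (g * z.1, g * z.2) = ω t z
  antisymmetric : ∀ σ : Equiv.Perm (Fin 3), ∀ t ∈ contractingTriples G B,
    ω (t ∘ σ) = (Equiv.Perm.sign σ : ℤ) • ω t
  cocycle : ∀ a₁ a₂ a₃ a₄ : Boundary X, [a₁, a₂, a₃, a₄].Nodup →
    (∀ a ∈ [a₁, a₂, a₃, a₄], a ∈ limitSet G) →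
    (∀ a ∈ [a₁, a₂, a₃, a₄], ∀ b ∈ [a₁, a₂, a₃, a₄], a ≠ b → (a, b) ∈ contractingPairs X B) →
    ω ![a₂, a₃, a₄] - ω ![a₁, a₃, a₄] + ω ![a₁, a₂, a₄] - ω ![a₁, a₂, a₃] = 0

/-- The requirements on the map `α : 𝒜(B) → C_b(G × G)`; only the restriction of `α` to `𝒜(B)`
matters.  The space `C(G × G, ℝ)` carries the compact open topology. -/
structure IsAdmissibleMap (B : ℝ) (x₀ : X) (a b ξ : Boundary X)
    (α : Boundary X × Boundary X → C(G × G, ℝ)) : Prop where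
  continuousOn : ContinuousOn α (contractingPairs X B)
  bounded : ∀ c ∈ contractingPairs X B, ∃ C : ℝ, ∀ z, |α c z| ≤ C
  equivariant : ∀ c ∈ contractingPairs X B, ∀ g : G, ∀ z : G × G,
    α (g • c) (g * z.1, g * z.2) = α c z
  antisymmetric : ∀ c ∈ contractingPairs X B, α c.swap = -α c
  /-- controlled support -/
  support : ∀ c ∈ contractingPairs X B, ∀ A₁ A₂ : Set (Bordification X),
    IsOpen A₁ → Bordification.ideal c.1 ∈ A₁ → IsOpen A₂ → Bordification.ideal c.2 ∈ A₂ →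
    IsCompact (tsupport (α c) ∩
      {z : G × G | Bordification.point ((z.1 : X ≃ᵢ X) x₀) ∉ A₁ ∪ A₂})
  /-- For every `p ∈ (1, ∞)`, the coboundary of `α` is an `L^p`-valued cocycle which does not
  vanish at `(a, b, ξ)`. -/
  coboundary : ∀ (p : ℝ≥0∞) [Fact (1 ≤ p)], 1 < p → p < ∞ →
    ∃ ω : (Fin 3 → Boundary X) → Lp ℝ p (μ.prod μ),
      (∀ t ∈ contractingTriples G B, ω t =ᵐ[μ.prod μ]
        fun z => α (t 0, t 1) z + α (t 1, t 2) z + α (t 2, t 0) z) ∧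
      IsContinuousBoundedCocycle G μ B p ω ∧ ω ![a, b, ξ] ≠ 0

/-- The support of `α`, regarded as a function on `𝒜(B) × (G × G)`. -/
def pairSupport (B : ℝ) (α : Boundary X × Boundary X → C(G × G, ℝ)) :
    Set ((Boundary X × Boundary X) × (G × G)) :=
  closure {v | v.1 ∈ contractingPairs X B ∧ α v.1 v.2 ≠ 0}

end Isometries

end RankOne

open RankOne

/-!
Seen from `g x₀`, replace the two ends of a geodesic by the points at a fixed distance `r` from
`g x₀` on the rays from `g x₀` to these ends, and compare the resulting pair of points with the
translate by `g` of a fixed pair `(u, v)` of points at distance at least three. This gives an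
equivariant antisymmetric function `α`. If `g x₀` lies at distance `d` from a contracting geodesic,
then the rays from `g x₀` to its two ends are at distance `O(1 / d)` from each other at time `r`.
So `α(g, ·)` vanishes unless `g x₀` is close to the geodesic. On an ideal triangle, the term of the
coboundary which belongs to the farthest side is `O(1 / d)`, and since the rays to the two ends of
this side are so close, the other two terms cancel up to `O(1 / d)`, too. The part of the support
of the coboundary where the largest distance to a side is at most `d` has measure `O(d)`. Hence it
is in `L^p` for all `p > 1`, with tails which are uniform near a given triangle, and so depends
continuously on the triangle.

The cocycle equals one at the identity on a triple `t` if `u` and `v` are the points at large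
distance `r` from `x₀` on the rays to the ends of a side of `t`. If moreover no translate of the
pair `(aᵢ, bᵢ)` is the pair of ends of this side, in either order, then for large `r` none is even
close to it, because the orbit of the pair of ends of an axis is closed, and so `α` vanishes near
`(aᵢ, bᵢ)`. Such a side exists: otherwise all three sides are axes, and since two axes with a
common end whose other ends are joined by a contracting geodesic are translates of each other by an
element fixing the common end, there are rotations about the three corners. Their composition flips
the first side, so that `(aᵢ, bᵢ)` is in the orbit of `(a, b)` for some `i`.
-/

namespace RankOne

/-! ### Comparison geometry -/

section Comparison

theorem exists_euclidean_triangle {a b c : ℝ} (ha : 0 ≤ a) (hb : 0 ≤ b) (hc : 0 ≤ c)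
    (habc : a ≤ b + c) (hbac : b ≤ a + c) (hcab : c ≤ a + b) :
    ∃ x y z : EuclideanSpace ℝ (Fin 2), dist x y = a ∧ dist y z = b ∧ dist x z = c := by
  have dist_vec (s t u v : ℝ) :
      dist (!₂[s, t] : EuclideanSpace ℝ (Fin 2)) !₂[u, v] = √((s - u) ^ 2 + (t - v) ^ 2) := by
    simp [EuclideanSpace.dist_eq, Real.dist_eq]
  rcases ha.eq_or_lt with rfl | ha
  · obtain rfl : b = c := by linarith
    exact ⟨!₂[0, 0], !₂[0, 0], !₂[b, 0], by simp, by simp [dist_vec, Real.sqrt_sq hb],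
      by simp [dist_vec, Real.sqrt_sq hb]⟩
  -- `u` is the coordinate of the foot of the altitude from `z`, by the law of cosines.
  · set u := (a ^ 2 + c ^ 2 - b ^ 2) / (2 * a) with hu
    have hcosines : 2 * a * u = a ^ 2 + c ^ 2 - b ^ 2 := by rw [hu]; field_simp
    have haltitude : 0 ≤ c ^ 2 - u ^ 2 := by
      have hle : u ≤ c := by rw [hu, div_le_iff₀ (by positivity)]; nlinarith
      have hge : -c ≤ u := by rw [hu, le_div_iff₀ (by positivity)]; nlinarith
      nlinarith
    refine ⟨!₂[0, 0], !₂[a, 0], !₂[u, √(c ^ 2 - u ^ 2)], ?_, ?_, ?_⟩ <;>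
      rw [dist_vec, Real.sqrt_eq_iff_mul_self_eq (by positivity) (by positivity)]
    · ring
    · linarith [Real.sq_sqrt haltitude]
    · linarith [Real.sq_sqrt haltitude]

variable {X : Type*} [MetricSpace X]

theorem exists_comparison_triangle (x y z : X) :
    ∃ x' y' z' : EuclideanSpace ℝ (Fin 2),
      dist x' y' = dist x y ∧ dist y' z' = dist y z ∧ dist x' z' = dist x z :=
  exists_euclidean_triangle dist_nonneg dist_nonneg dist_nonneg
    (by linarith [dist_triangle x z y, dist_comm y z])
    (by linarith [dist_triangle y x z, dist_comm y x])
    (by linarith [dist_triangle x y z])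

/-- `p` lies on a geodesic from `x` to `y` and divides it in the ratio `t : 1 - t`. -/
structure DividesSegment (t : ℝ) (x y p : X) : Prop where
  dist_left : dist x p = t * dist x y
  dist_right : dist p y = (1 - t) * dist x y

namespace DividesSegment

theorem symm {t : ℝ} {x y p : X} (h : DividesSegment t x y p) : DividesSegment (1 - t) y x p where
  dist_left := by rw [dist_comm y p, dist_comm y x, h.dist_right]
  dist_right := by rw [dist_comm p x, dist_comm y x, h.dist_left]; ring

theorem refl (t : ℝ) (x : X) : DividesSegment t x x x := by constructor <;> simp

theorem lineMap {E : Type*} [NormedAddCommGroup E] [NormedSpace ℝ E] {t : ℝ} (h0 : 0 ≤ t)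
    (h1 : t ≤ 1) (x y : E) : DividesSegment t x y (AffineMap.lineMap x y t) where
  dist_left := by rw [dist_left_lineMap, Real.norm_of_nonneg h0]
  dist_right := by rw [dist_lineMap_right, Real.norm_of_nonneg (sub_nonneg.2 h1)]

theorem of_dist_add_dist {x y p : X} (h : dist x p + dist p y = dist x y) :
    DividesSegment (dist x p / dist x y) x y p := by
  rcases eq_or_ne (dist x y) 0 with h0 | h0
  · have hxp := dist_nonneg (x := x) (y := p)
    have hpy := dist_nonneg (x := p) (y := y)
    constructor <;> rw [h0] <;> linarith
  · constructor <;> field_simp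
    linarith

end DividesSegment

namespace IsCAT0

theorem dist_le_mul (hX : IsCAT0 X) {x y z p q : X} {t : ℝ} (h0 : 0 ≤ t) (h1 : t ≤ 1)
    (hp : DividesSegment t x y p) (hq : DividesSegment t x z q) : dist p q ≤ t * dist y z := by
  obtain ⟨x', y', z', hxy, hyz, hxz⟩ := exists_comparison_triangle x y z
  have hp' := DividesSegment.lineMap h0 h1 x' y'
  have hq' := DividesSegment.lineMap h0 h1 x' z'
  have hcomparison := hX.comparison x y z p q x' y' z' _ _ hxy hyz hxz
    (by rw [hp.1, hp.2]; ring) (by rw [hp'.1, hp.1, hxy]) (by rw [hp'.2, hp.2, hxy])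
    (by rw [hq.1, hq.2]; ring) (by rw [hq'.1, hq.1, hxz]) (by rw [hq'.2, hq.2, hxz])
  refine hcomparison.trans_eq ?_
  have hsmul : AffineMap.lineMap x' y' t - AffineMap.lineMap x' z' t = t • (y' - z') := by
    simp only [AffineMap.lineMap_apply, vsub_eq_sub, vadd_eq_add, smul_sub]
    abel
  rw [dist_eq_norm, hsmul, norm_smul, Real.norm_of_nonneg h0, ← dist_eq_norm, hyz]

end IsCAT0

/-- `e` parametrizes a geodesic from `x` to `y` by arc length; only its restriction to
`[0, dist x y]` matters. -/
structure IsGeodesicSegment (e : ℝ → X) (x y : X) : Prop where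
  left : e 0 = x
  right : e (dist x y) = y
  dist_eq : ∀ s ∈ Icc 0 (dist x y), ∀ t ∈ Icc 0 (dist x y), dist (e s) (e t) = |s - t|

namespace IsGeodesicSegment

variable {e : ℝ → X} {x y : X} {t : ℝ}

theorem dist_left (he : IsGeodesicSegment e x y) (ht : t ∈ Icc 0 (dist x y)) :
    dist x (e t) = t := by
  conv_lhs => rw [← he.left]
  rw [he.dist_eq 0 ⟨le_rfl, dist_nonneg⟩ t ht, zero_sub, abs_neg, abs_of_nonneg ht.1]

theorem dist_right (he : IsGeodesicSegment e x y) (ht : t ∈ Icc 0 (dist x y)) :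
    dist (e t) y = dist x y - t := by
  conv_lhs => rw [← he.right]
  rw [he.dist_eq t ht _ ⟨dist_nonneg, le_rfl⟩, abs_sub_comm, abs_of_nonneg (sub_nonneg.2 ht.2)]

theorem dividesSegment (he : IsGeodesicSegment e x y) (ht : t ∈ Icc 0 (dist x y)) :
    DividesSegment (t / dist x y) x y (e t) := by
  have hadd : dist x (e t) + dist (e t) y = dist x y := by
    rw [he.dist_left ht, he.dist_right ht, add_sub_cancel]
  simpa only [he.dist_left ht] using DividesSegment.of_dist_add_dist hadd

end IsGeodesicSegment

namespace IsCAT0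

theorem exists_isGeodesicSegment (hX : IsCAT0 X) (x y : X) :
    ∃ e : ℝ → X, IsGeodesicSegment e x y := by
  obtain ⟨e, e0, e1, he⟩ := hX.geodesic x y
  exact ⟨e, e0, e1, he⟩

theorem exists_dist_eq (hX : IsCAT0 X) {x y : X} {s : ℝ} (hs : s ∈ Icc 0 (dist x y)) :
    ∃ p, dist x p = s ∧ dist p y = dist x y - s := by
  obtain ⟨e, he⟩ := hX.exists_isGeodesicSegment x y
  exact ⟨e s, he.dist_left hs, he.dist_right hs⟩

/-- Convexity of the metric; compare both points with a point on the diagonal from `x` to `y'`. -/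
theorem dist_le_add_mul (hX : IsCAT0 X) {x x' y y' p p' : X} {t : ℝ} (h0 : 0 ≤ t) (h1 : t ≤ 1)
    (hp : DividesSegment t x y p) (hp' : DividesSegment t x' y' p') :
    dist p p' ≤ (1 - t) * dist x x' + t * dist y y' := by
  obtain ⟨q, hxq, hqy'⟩ := hX.exists_dist_eq (x := x) (y := y') (s := t * dist x y')
    ⟨by positivity, mul_le_of_le_one_left dist_nonneg h1⟩
  have hq : DividesSegment t x y' q := ⟨hxq, by rw [hqy']; ring⟩
  have hpq := hX.dist_le_mul h0 h1 hp hq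
  have hqp' := hX.dist_le_mul (sub_nonneg.2 h1) (sub_le_self 1 h0) hq.symm hp'.symm
  linarith [dist_triangle p q p']

end IsCAT0

end Comparison

/-! ### Geodesic rays -/

section Rays

variable {X : Type*} [MetricSpace X]

namespace GeodesicRay

theorem dist_eq (c : GeodesicRay X) (s t : ℝ≥0) : dist (c.1 s) (c.1 t) = |(s : ℝ) - t| := by
  rw [c.2.dist_eq, NNReal.dist_eq]

theorem dist_eq_sub (c : GeodesicRay X) {s t : ℝ≥0} (h : s ≤ t) :
    dist (c.1 s) (c.1 t) = t - s := by
  rw [c.dist_eq, abs_sub_comm, abs_of_nonneg (sub_nonneg.2 (NNReal.coe_le_coe.2 h))]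

theorem dist_zero (c : GeodesicRay X) (t : ℝ≥0) : dist (c.1 0) (c.1 t) = t := by
  rw [c.dist_eq_sub zero_le, NNReal.coe_zero, sub_zero]

theorem dividesSegment (c : GeodesicRay X) {s t : ℝ≥0} (h : s ≤ t) :
    DividesSegment (s / t : ℝ) (c.1 0) (c.1 t) (c.1 s) := by
  have hadd : dist (c.1 0) (c.1 s) + dist (c.1 s) (c.1 t) = dist (c.1 0) (c.1 t) := by
    rw [c.dist_zero, c.dist_eq_sub h, c.dist_zero, add_sub_cancel]
  simpa only [c.dist_zero] using DividesSegment.of_dist_add_dist hadd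

theorem abs_sub_dist_le (c : GeodesicRay X) (x : X) (t : ℝ≥0) :
    |(t : ℝ) - dist x (c.1 t)| ≤ dist x (c.1 0) := by
  have hle := dist_triangle x (c.1 0) (c.1 t)
  have hge := dist_triangle_left (c.1 0) (c.1 t) x
  rw [c.dist_zero] at hle hge
  exact abs_le.2 ⟨by linarith, by linarith⟩

theorem tendsto_dist_atTop (c : GeodesicRay X) (x : X) :
    Tendsto (fun t => dist x (c.1 t)) atTop atTop := by
  refine tendsto_atTop_mono (fun t => ?_)
    (tendsto_atTop_add_const_right _ (-dist x (c.1 0)) (NNReal.tendsto_coe_atTop.2 tendsto_id))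
  linarith [(abs_le.1 (c.abs_sub_dist_le x t)).2, id_eq t]

/-- The limit of longer and longer geodesic segments from `x`. -/
theorem exists_tendsto [ProperSpace X] {ι : Type*} (U : Ultrafilter ι) {e : ι → ℝ → X} {x : X}
    {y : ι → X} (he : ∀ i, IsGeodesicSegment (e i) x (y i))
    (hy : Tendsto (fun i => dist x (y i)) U atTop) :
    ∃ c : GeodesicRay X, c.1 0 = x ∧ ∀ s : ℝ≥0, Tendsto (fun i => e i s) U (𝓝 (c.1 s)) := by
  have hmem (s : ℝ≥0) : ∀ᶠ i in (U : Filter ι), (s : ℝ) ∈ Icc 0 (dist x (y i)) := by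
    filter_upwards [hy.eventually_ge_atTop (s : ℝ)] with i hi using ⟨s.2, hi⟩
  have hlim (s : ℝ≥0) : ∃ z, Tendsto (fun i => e i s) U (𝓝 z) := by
    have hball : ∀ᶠ i in (U : Filter ι), e i s ∈ Metric.closedBall x s := by
      filter_upwards [hmem s] with i hi
      rw [Metric.mem_closedBall, dist_comm, (he i).dist_left hi]
    obtain ⟨z, -, hz⟩ := (isCompact_closedBall x (s : ℝ)).ultrafilter_le_nhds
      (U.map fun i => e i s) (le_principal_iff.2 hball)
    exact ⟨z, hz⟩
  choose f hf using hlim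
  have hiso : Isometry f := Isometry.of_dist_eq fun s t => by
    refine tendsto_nhds_unique ((hf s).dist (hf t)) (tendsto_const_nhds.congr' ?_)
    filter_upwards [hmem s, hmem t] with i hs ht
    rw [(he i).dist_eq s hs t ht, NNReal.dist_eq]
  refine ⟨⟨⟨f, hiso.continuous⟩, hiso⟩, ?_, hf⟩
  refine tendsto_nhds_unique (hf 0) (tendsto_const_nhds.congr fun i => ?_)
  rw [NNReal.coe_zero, (he i).left]

end GeodesicRay

namespace IsCAT0

theorem mul_dist_le (hX : IsCAT0 X) {c c' : GeodesicRay X} (h : c.1 0 = c'.1 0)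
    {s t : ℝ≥0} (hst : s ≤ t) : t * dist (c.1 s) (c'.1 s) ≤ s * dist (c.1 t) (c'.1 t) := by
  have hle := hX.dist_le_mul (by positivity) (div_le_one_of_le₀ (NNReal.coe_le_coe.2 hst) t.2)
    (c.dividesSegment hst) (h ▸ c'.dividesSegment hst)
  rcases eq_or_ne t 0 with rfl | ht
  · simp [le_antisymm hst zero_le]
  have ht0 : (t : ℝ) ≠ 0 := NNReal.coe_ne_zero.2 ht
  calc t * dist (c.1 s) (c'.1 s) ≤ t * (s / t * dist (c.1 t) (c'.1 t)) := by gcongr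
    _ = s * dist (c.1 t) (c'.1 t) := by rw [← mul_assoc, mul_div_cancel₀ _ ht0]

theorem dist_le_of_asymptotic (hX : IsCAT0 X) {c c' : GeodesicRay X} (h : c ≈ c') (t : ℝ≥0) :
    dist (c.1 t) (c'.1 t) ≤ dist (c.1 0) (c'.1 0) := by
  obtain ⟨C, hC⟩ := h
  have hconvex : ∀ᶠ T : ℝ≥0 in atTop, dist (c.1 t) (c'.1 t) ≤
      (1 - t / T : ℝ) * dist (c.1 0) (c'.1 0) + t / T * C := by
    filter_upwards [eventually_ge_atTop t] with T hT
    refine (hX.dist_le_add_mul (by positivity)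
      (div_le_one_of_le₀ (NNReal.coe_le_coe.2 hT) T.2) (c.dividesSegment hT)
      (c'.dividesSegment hT)).trans ?_
    gcongr
    exact hC T
  have hratio : Tendsto (fun T : ℝ≥0 => (t / T : ℝ)) atTop (𝓝 0) :=
    tendsto_const_nhds.div_atTop (NNReal.tendsto_coe_atTop.2 tendsto_id)
  refine ge_of_tendsto ?_ hconvex
  simpa using (((tendsto_const_nhds (x := (1 : ℝ))).sub hratio).mul_const
    (dist (c.1 0) (c'.1 0))).add (hratio.mul_const C)

theorem eq_of_asymptotic (hX : IsCAT0 X) {c c' : GeodesicRay X} (h : c ≈ c')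
    (h0 : c.1 0 = c'.1 0) : c = c' := by
  ext t
  exact dist_le_zero.1 ((hX.dist_le_of_asymptotic h t).trans_eq (by rw [h0, dist_self]))

/-- Both points are close to the point of the ray which divides `[c 0, c n]` in the same ratio as
`e s` divides `[x, c n]`. -/
theorem dist_segment_ray_le (hX : IsCAT0 X) (c : GeodesicRay X) {e : ℝ → X} {x : X} {n s : ℝ≥0}
    (he : IsGeodesicSegment e x (c.1 n)) (hs : s ≤ dist x (c.1 n)) :
    dist (e s) (c.1 s) ≤ 2 * dist x (c.1 0) := by
  set L := dist x (c.1 n)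
  have hratio : (s / L : ℝ) ≤ 1 := div_le_one_of_le₀ hs dist_nonneg
  have hratio0 : 0 ≤ (s / L : ℝ) := div_nonneg s.2 dist_nonneg
  set r : ℝ≥0 := ⟨s / L * n, by positivity⟩
  have hr : DividesSegment (s / L : ℝ) (c.1 0) (c.1 n) (c.1 r) := by
    have hrn : r ≤ n := NNReal.coe_le_coe.1 (mul_le_of_le_one_left n.2 hratio)
    constructor
    · rw [c.dist_zero, c.dist_zero]; rfl
    · rw [c.dist_eq_sub hrn, c.dist_zero, sub_mul, one_mul]; rfl
  have hes : dist (e s) (c.1 r) ≤ dist x (c.1 0) := by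
    refine (hX.dist_le_add_mul hratio0 hratio (he.dividesSegment ⟨s.2, hs⟩) hr).trans ?_
    rw [dist_self, mul_zero, add_zero]
    exact mul_le_of_le_one_left dist_nonneg (by linarith)
  have hrs : dist (c.1 r) (c.1 s) ≤ dist x (c.1 0) := by
    have hsL : (s / L * L : ℝ) = s := div_mul_cancel_of_imp fun h => le_antisymm (h ▸ hs) s.2
    calc dist (c.1 r) (c.1 s) = |(s / L * n : ℝ) - s / L * L| := by rw [c.dist_eq, hsL]; rfl
      _ = s / L * |(n : ℝ) - L| := by rw [← mul_sub, abs_mul, abs_of_nonneg hratio0]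
      _ ≤ 1 * dist x (c.1 0) := by gcongr; exact c.abs_sub_dist_le x n
      _ = dist x (c.1 0) := one_mul _
  linarith [dist_triangle (e s) (c.1 r) (c.1 s)]

theorem exists_ray [ProperSpace X] (hX : IsCAT0 X) (x : X) (c : GeodesicRay X) :
    ∃ c' : GeodesicRay X, c'.1 0 = x ∧ c' ≈ c := by
  choose e he using fun n : ℝ≥0 => hX.exists_isGeodesicSegment x (c.1 n)
  let U : Ultrafilter ℝ≥0 := Ultrafilter.of atTop
  have hdist : Tendsto (fun n => dist x (c.1 n)) U atTop :=
    (c.tendsto_dist_atTop x).mono_left (Ultrafilter.of_le atTop)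
  obtain ⟨c', h0, hc'⟩ := GeodesicRay.exists_tendsto U he hdist
  refine ⟨c', h0, 2 * dist x (c.1 0), fun s => ?_⟩
  refine le_of_tendsto ((hc' s).dist tendsto_const_nhds) ?_
  filter_upwards [hdist.eventually_ge_atTop (s : ℝ)] with n hn
  exact hX.dist_segment_ray_le c (he n) hn

end IsCAT0

end Rays

/-! ### The ray from a point to a boundary point -/

section RayPoint

variable {X : Type*} [MetricSpace X]

open Classical in
/-- The point at distance `r` from `x` on the geodesic ray from `x` in the class `ξ`.  Such a ray
exists and is unique in a proper CAT(0)-space; the value is `x` where there is none. -/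
noncomputable def rayPoint (x : X) (r : ℝ≥0) (ξ : Boundary X) : X :=
  if h : ∃ c : GeodesicRay X, c.1 0 = x ∧ Quotient.mk _ c = ξ then (Classical.choose h).1 r else x

theorem smul_mk (g : X ≃ᵢ X) (c : GeodesicRay X) :
    g • (Quotient.mk _ c : Boundary X) = Quotient.mk _ (mapRay g c) := rfl

namespace IsCAT0

theorem rayPoint_mk (hX : IsCAT0 X) (c : GeodesicRay X) (r : ℝ≥0) :
    rayPoint (c.1 0) r (Quotient.mk _ c) = c.1 r := by
  have h : ∃ c' : GeodesicRay X, c'.1 0 = c.1 0 ∧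
    (Quotient.mk _ c' : Boundary X) = Quotient.mk _ c := ⟨c, rfl, rfl⟩
  obtain ⟨hzero, hmk⟩ := Classical.choose_spec h
  rw [rayPoint, dif_pos h, hX.eq_of_asymptotic (Quotient.exact hmk) hzero]

variable [ProperSpace X]

theorem exists_ray_rayPoint_eq (hX : IsCAT0 X) (x : X) (ξ : Boundary X) :
    ∃ c : GeodesicRay X, c.1 0 = x ∧ Quotient.mk _ c = ξ ∧ ∀ r, rayPoint x r ξ = c.1 r := by
  induction ξ using Quotient.inductionOn with | _ c =>
  obtain ⟨c', rfl, hc'⟩ := hX.exists_ray x c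
  exact ⟨c', rfl, Quotient.sound hc', fun r => Quotient.sound hc' ▸ hX.rayPoint_mk c' r⟩

theorem rayPoint_zero (hX : IsCAT0 X) (x : X) (ξ : Boundary X) : rayPoint x 0 ξ = x := by
  obtain ⟨c, h0, -, hc⟩ := hX.exists_ray_rayPoint_eq x ξ
  rw [hc, h0]

theorem dist_rayPoint (hX : IsCAT0 X) (x : X) (r : ℝ≥0) (ξ : Boundary X) :
    dist x (rayPoint x r ξ) = r := by
  obtain ⟨c, rfl, -, hc⟩ := hX.exists_ray_rayPoint_eq x ξ
  rw [hc, c.dist_zero]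

theorem dist_rayPoint_le (hX : IsCAT0 X) (x y : X) (r : ℝ≥0) (ξ : Boundary X) :
    dist (rayPoint x r ξ) (rayPoint y r ξ) ≤ dist x y := by
  obtain ⟨c, rfl, hcξ, hc⟩ := hX.exists_ray_rayPoint_eq x ξ
  obtain ⟨c', rfl, hcξ', hc'⟩ := hX.exists_ray_rayPoint_eq y ξ
  rw [hc, hc']
  exact hX.dist_le_of_asymptotic (Quotient.exact (hcξ.trans hcξ'.symm)) r

theorem dist_rayPoint_mk_le (hX : IsCAT0 X) (x : X) (c : GeodesicRay X) (r : ℝ≥0) :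
    dist (rayPoint x r (Quotient.mk _ c)) (c.1 r) ≤ dist x (c.1 0) :=
  hX.rayPoint_mk c r ▸ hX.dist_rayPoint_le _ _ _ _

theorem mul_dist_rayPoint_le (hX : IsCAT0 X) (x : X) (ξ η : Boundary X) {s t : ℝ≥0}
    (hst : s ≤ t) : t * dist (rayPoint x s ξ) (rayPoint x s η) ≤
      s * dist (rayPoint x t ξ) (rayPoint x t η) := by
  obtain ⟨c, h0, -, hc⟩ := hX.exists_ray_rayPoint_eq x ξ
  obtain ⟨c', h0', -, hc'⟩ := hX.exists_ray_rayPoint_eq x η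
  simp only [hc, hc']
  exact hX.mul_dist_le (h0.trans h0'.symm) hst

theorem monotone_dist_rayPoint (hX : IsCAT0 X) (x : X) (ξ η : Boundary X) :
    Monotone fun r => dist (rayPoint x r ξ) (rayPoint x r η) := by
  intro s t hst
  rcases eq_or_ne t 0 with rfl | ht
  · rw [le_antisymm hst zero_le]
  have ht0 : (0 : ℝ) < t := NNReal.coe_pos.2 (pos_iff_ne_zero.2 ht)
  refine le_of_mul_le_mul_left ((hX.mul_dist_rayPoint_le x ξ η hst).trans ?_) ht0
  gcongr

theorem eq_of_rayPoint_eq (hX : IsCAT0 X) (x : X) {ξ η : Boundary X}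
    (h : ∀ r, rayPoint x r ξ = rayPoint x r η) : ξ = η := by
  obtain ⟨c, -, rfl, hc⟩ := hX.exists_ray_rayPoint_eq x ξ
  obtain ⟨c', -, rfl, hc'⟩ := hX.exists_ray_rayPoint_eq x η
  congr 1
  ext r
  rw [← hc, ← hc', h]

theorem tendsto_dist_rayPoint (hX : IsCAT0 X) (x : X) {ξ η : Boundary X} (h : ξ ≠ η) :
    Tendsto (fun r => dist (rayPoint x r ξ) (rayPoint x r η)) atTop atTop := by
  obtain ⟨s, hs⟩ : ∃ s, rayPoint x s ξ ≠ rayPoint x s η := by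
    by_contra! heq
    exact h (hX.eq_of_rayPoint_eq x heq)
  have hs0 : (0 : ℝ) < s := by
    refine NNReal.coe_pos.2 (pos_iff_ne_zero.2 ?_)
    rintro rfl
    exact hs (by rw [hX.rayPoint_zero, hX.rayPoint_zero])
  have hlinear : ∀ᶠ r : ℝ≥0 in atTop,
      dist (rayPoint x s ξ) (rayPoint x s η) / s * r ≤ dist (rayPoint x r ξ) (rayPoint x r η) := by
    filter_upwards [eventually_ge_atTop s] with r hr
    rw [div_mul_eq_mul_div, div_le_iff₀ hs0]
    linarith [hX.mul_dist_rayPoint_le x ξ η hr]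
  exact tendsto_atTop_mono' _ hlinear
    ((NNReal.tendsto_coe_atTop.2 tendsto_id).const_mul_atTop (div_pos (dist_pos.2 hs) hs0))

theorem smul_rayPoint (hX : IsCAT0 X) (g : X ≃ᵢ X) (x : X) (r : ℝ≥0) (ξ : Boundary X) :
    rayPoint (g x) r (g • ξ) = g (rayPoint x r ξ) := by
  obtain ⟨c, rfl, rfl, hc⟩ := hX.exists_ray_rayPoint_eq x ξ
  rw [hc, smul_mk]
  exact hX.rayPoint_mk (mapRay g c) r

theorem mul_dist_rayPoint_mk_le (hX : IsCAT0 X) (x : X) (c c' : GeodesicRay X) {r T : ℝ≥0}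
    (hrT : r ≤ T) : T * dist (rayPoint x r (Quotient.mk _ c)) (rayPoint x r (Quotient.mk _ c')) ≤
      r * (dist x (c.1 0) + dist (c.1 T) (c'.1 T) + dist x (c'.1 0)) := by
  refine (hX.mul_dist_rayPoint_le x _ _ hrT).trans ?_
  gcongr
  refine (dist_triangle4 _ (c.1 T) (c'.1 T) _).trans ?_
  gcongr
  · exact hX.dist_rayPoint_mk_le x c T
  · exact dist_comm (c'.1 T) _ ▸ hX.dist_rayPoint_mk_le x c' T

theorem continuous_rayPoint (hX : IsCAT0 X) (x : X) (r : ℝ≥0) :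
    Continuous (rayPoint x r) := by
  have hquotient : IsQuotientMap (Quotient.mk (asymptoticSetoid X)) := isQuotientMap_quotient_mk'
  rw [hquotient.continuous_iff, continuous_iff_continuousAt]
  intro c
  rw [ContinuousAt, Metric.tendsto_nhds]
  intro ε hε
  obtain ⟨T, hT0, hrT, hTε⟩ : ∃ T : ℝ≥0, 0 < T ∧ r ≤ T ∧ r * (2 * dist x (c.1 0)) < T * ε :=
    ((eventually_gt_atTop 0).and ((eventually_ge_atTop r).and
      (((NNReal.tendsto_coe_atTop.2 tendsto_id).atTop_mul_const hε).eventually_gt_atTop _))).exists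
  have heval (s : ℝ≥0) : Continuous fun c' : GeodesicRay X => c'.1 s :=
    (continuous_eval_const s).comp continuous_subtype_val
  have hbound : Continuous fun c' : GeodesicRay X =>
      r * (dist x (c'.1 0) + dist (c'.1 T) (c.1 T) + dist x (c.1 0)) := by
    have := heval 0
    have := heval T
    fun_prop
  have hlt : r * (dist x (c.1 0) + dist (c.1 T) (c.1 T) + dist x (c.1 0)) < T * ε := by
    rwa [dist_self, add_zero, ← two_mul]
  filter_upwards [hbound.continuousAt.eventually_lt_const hlt] with c' hc'
  exact lt_of_mul_lt_mul_left ((hX.mul_dist_rayPoint_mk_le x c' c hrT).trans_lt hc') hT0.le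

end IsCAT0

end RayPoint

/-! ### Projections to contracting sets -/

section Contracting

theorem exists_mem_Ico_of_coarse_lipschitz {φ : ℝ → ℝ} {L M B δ : ℝ} (hδ : 0 < δ) (hL : 0 ≤ L)
    (hzero : φ 0 < M) (hend : M ≤ φ L)
    (hφ : ∀ s ∈ Icc 0 L, ∀ t ∈ Icc 0 L, |s - t| ≤ δ → φ t ≤ φ s + B) :
    ∃ t ∈ Icc 0 L, φ t ∈ Ico M (M + B) := by
  set A := {t ∈ Icc 0 L | M ≤ φ t}
  have hbdd : BddBelow A := ⟨0, fun t ht => ht.1.1⟩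
  obtain ⟨t, ⟨ht, hMt⟩, htA⟩ : ∃ t ∈ A, t < sInf A + δ :=
    exists_lt_of_csInf_lt ⟨L, ⟨hL, le_rfl⟩, hend⟩ (by linarith)
  obtain ⟨s, hs, hst, hsM⟩ : ∃ s ∈ Icc 0 L, |s - t| ≤ δ ∧ φ s < M := by
    rcases le_total t δ with h | h
    · exact ⟨0, ⟨le_rfl, hL⟩, by rwa [zero_sub, abs_neg, abs_of_nonneg ht.1], hzero⟩
    · have hsmem : t - δ ∈ Icc 0 L := ⟨by linarith, by linarith [ht.2]⟩
      refine ⟨t - δ, hsmem, by rw [sub_sub_cancel_left, abs_neg, abs_of_pos hδ], ?_⟩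
      by_contra! hM
      linarith [csInf_le hbdd (show t - δ ∈ A from ⟨hsmem, hM⟩)]
  exact ⟨t, ht, hMt, by linarith [hφ s hs t ht hst]⟩

variable {X : Type*} [MetricSpace X] {B : ℝ} {S : Set X} {x y p q : X}

/-- `p` is a point of `S` closest to `x`. -/
def IsFoot (S : Set X) (x p : X) : Prop := p ∈ S ∧ dist x p = Metric.infDist x S

theorem range_comp_neg {α : Type*} (γ : ℝ → α) : range (fun t => γ (-t)) = range γ :=
  (Equiv.neg ℝ).surjective.range_comp γ

theorem IsFoot.of_mem (hx : x ∈ S) (h : IsFoot S x p) : p = x := by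
  have := h.2
  rw [Metric.infDist_zero_of_mem hx, dist_eq_zero] at this
  exact this.symm

namespace IsContracting

theorem dist_le (hS : IsContracting B S) (h : dist x y < Metric.infDist x S) (hp : IsFoot S x p)
    (hq : IsFoot S y q) : dist p q ≤ B := by
  refine hS x (dist x y) ?_ x (Metric.mem_closedBall_self dist_nonneg) y
    (by rw [Metric.mem_closedBall, dist_comm]) p hp.1 q hq.1 hp.2 hq.2
  exact Metric.disjoint_closedBall_of_lt_infDist h

theorem dist_le_max (hS : IsContracting B S) (hp : IsFoot S x p) (hq : IsFoot S y q) :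
    dist p q ≤ max B (4 * dist x y) := by
  rcases lt_or_ge (dist x y) (Metric.infDist x S) with h | h
  · exact (hS.dist_le h hp hq).trans (le_max_left _ _)
  · have hpq := dist_triangle4 p x y q
    have hinf : Metric.infDist y S ≤ Metric.infDist x S + dist y x :=
      Metric.infDist_le_infDist_add_dist
    rw [dist_comm p x, hp.2, hq.2] at hpq
    rw [dist_comm y x] at hinf
    exact le_max_of_le_right (by linarith)

end IsContracting

variable [ProperSpace X]

theorem exists_isFoot (hc : IsClosed S) (hne : S.Nonempty) (x : X) : ∃ p, IsFoot S x p := by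
  obtain ⟨p, hp, h⟩ := hc.exists_infDist_eq_dist hne x
  exact ⟨p, hp, h.symm⟩

theorem IsContracting.exists_foot_dist_mem_Ico (hS : IsContracting B S) (hc : IsClosed S)
    (hB : 0 < B) (hp : IsFoot S x p) (hy : y ∈ S) (hpy : 5 * B ≤ dist p y) {e : ℝ → X}
    (he : IsGeodesicSegment e x y) :
    ∃ t ∈ Icc 0 (dist x y), ∃ q, IsFoot S (e t) q ∧ dist p q ∈ Ico (5 * B) (5 * B + B) := by
  choose f hf using exists_isFoot hc ⟨y, hy⟩
  have hzero : dist p (f (e 0)) < 5 * B := by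
    have := hS.dist_le_max hp (hf x)
    rw [dist_self, mul_zero, max_eq_left hB.le] at this
    rw [he.left]
    linarith
  have hend : 5 * B ≤ dist p (f (e (dist x y))) := by rwa [he.right, (hf y).of_mem hy]
  obtain ⟨t, ht, hφ⟩ := exists_mem_Ico_of_coarse_lipschitz (φ := fun t => dist p (f (e t)))
    (B := B) (δ := B / 4) (by positivity) dist_nonneg hzero hend fun s hs t ht hst => by
      have hstep : dist (f (e s)) (f (e t)) ≤ B := (hS.dist_le_max (hf _) (hf _)).trans
        (max_le le_rfl (by rw [he.dist_eq s hs t ht]; linarith))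
      linarith [dist_triangle p (f (e s)) (f (e t))]
  exact ⟨t, ht, f (e t), hf _, hφ⟩

namespace IsCAT0

theorem infDist_add_infDist_le (hX : IsCAT0 X) (hc : IsClosed S) (hS : IsContracting B S)
    (hB : 0 ≤ B) (hp : IsFoot S x p) (hq : IsFoot S y q) (h : 2 * B < dist p q) :
    Metric.infDist x S + Metric.infDist y S ≤ dist x y := by
  by_contra! hlt
  rcases lt_or_ge (dist x y) (Metric.infDist x S) with hx | hx
  · linarith [hS.dist_le hx hp hq]
  rcases lt_or_ge (dist x y) (Metric.infDist y S) with hy | hy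
  · rw [dist_comm] at hy
    linarith [hS.dist_le hy hq hp, dist_comm p q]
  obtain ⟨w, hxw, hwy⟩ := hX.exists_dist_eq (x := x) (y := y)
    (s := (dist x y - Metric.infDist y S + Metric.infDist x S) / 2)
    ⟨by linarith [Metric.infDist_nonneg (x := x) (s := S)],
      by linarith [Metric.infDist_nonneg (x := y) (s := S)]⟩
  obtain ⟨z, hz⟩ := exists_isFoot hc ⟨p, hp.1⟩ w
  have hpz : dist p z ≤ B := hS.dist_le (by linarith) hp hz
  have hqz : dist q z ≤ B := hS.dist_le (by rw [dist_comm]; linarith) hq hz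
  linarith [dist_triangle_right p q z]

theorem dist_foot_le_two_mul (hX : IsCAT0 X) (hc : IsClosed S) (hS : IsContracting B S)
    (hB : 0 < B) (hp : IsFoot S x p) (hq : IsFoot S y q) (hxy : dist x y ≤ Metric.infDist x S) :
    dist p q ≤ 2 * B := by
  rcases eq_or_ne x y with rfl | hne
  · have := hS.dist_le_max hp hq
    rw [dist_self, mul_zero, max_eq_left hB.le] at this
    linarith
  have hmin : 0 < min (dist x y) (B / 4) := lt_min (dist_pos.2 hne) (by positivity)
  obtain ⟨w, hxw, hwy⟩ := hX.exists_dist_eq (x := x) (y := y)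
    (s := dist x y - min (dist x y) (B / 4)) ⟨by simp, by linarith⟩
  obtain ⟨z, hz⟩ := exists_isFoot hc ⟨p, hp.1⟩ w
  have hpz : dist p z ≤ B := hS.dist_le (by linarith) hp hz
  have hzq : dist z q ≤ B := (hS.dist_le_max hz hq).trans
    (max_le le_rfl (by linarith [min_le_right (dist x y) (B / 4)]))
  linarith [dist_triangle p z q]

theorem dist_segment_foot_le (hX : IsCAT0 X) (hc : IsClosed S) (hS : IsContracting B S)
    (hB : 0 < B) (hp : IsFoot S x p) (hy : y ∈ S) (hpy : 5 * B ≤ dist p y) {e : ℝ → X}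
    (he : IsGeodesicSegment e x y) : dist (e (Metric.infDist x S)) p ≤ 8 * B := by
  set d := Metric.infDist x S
  have hdmem : d ∈ Icc 0 (dist x y) := ⟨Metric.infDist_nonneg, Metric.infDist_le_dist_of_mem hy⟩
  obtain ⟨t, ht, q, hq, hpq⟩ := hS.exists_foot_dist_mem_Ico hc hB hp hy hpy he
  have hdt : d ≤ t := by
    by_contra! hlt
    linarith [hS.dist_le (by rwa [he.dist_left ht]) hp hq, hpq.1]
  obtain ⟨z, hz⟩ := exists_isFoot hc ⟨p, hp.1⟩ (e d)
  have hpz : dist p z ≤ 2 * B :=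
    hX.dist_foot_le_two_mul hc hS hB hp hz (he.dist_left hdmem).le
  have hinf : Metric.infDist (e d) S + Metric.infDist (e t) S ≤ t - d := by
    have := hX.infDist_add_infDist_le hc hS hB.le hz hq
      (by linarith [dist_triangle p z q, hpq.1])
    rwa [he.dist_eq d hdmem t ht, abs_sub_comm, abs_of_nonneg (sub_nonneg.2 hdt)] at this
  have hxt := dist_triangle4 x p q (e t)
  rw [he.dist_left ht, hp.2, dist_comm q, hq.2] at hxt
  have hdp := dist_triangle (e d) z p
  rw [hz.2, dist_comm z] at hdp
  linarith [hpq.2]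

theorem mul_dist_segment_rayPoint_le (hX : IsCAT0 X) (c : GeodesicRay X) {n s : ℝ≥0}
    (hxp : dist x p = s) (hpc : dist p (c.1 n) = dist x (c.1 n) - s) :
    dist x (c.1 n) * dist p (rayPoint x s (Quotient.mk _ c)) ≤ s * (2 * dist x (c.1 0)) := by
  set L : ℝ≥0 := ⟨dist x (c.1 n), dist_nonneg⟩
  have hL : (L : ℝ) = dist x (c.1 n) := rfl
  have hsL : s ≤ L := NNReal.coe_le_coe.1 (by linarith [dist_nonneg (x := p) (y := c.1 n)])
  rcases eq_zero_or_pos L with h0 | h0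
  · rw [← hL, h0, NNReal.coe_zero, zero_mul]; positivity
  have hLpos : (0 : ℝ) < L := h0
  obtain ⟨c', rfl, -, hray⟩ := hX.exists_ray_rayPoint_eq x (Quotient.mk _ c)
  have hend : dist (c.1 n) (c'.1 L) ≤ 2 * dist (c'.1 0) (c.1 0) := by
    have hnL : dist (c'.1 n) (c'.1 L) ≤ dist (c'.1 0) (c.1 0) := by
      rw [c'.dist_eq]
      exact c.abs_sub_dist_le (c'.1 0) n
    have := hX.dist_rayPoint_mk_le (c'.1 0) c n
    rw [hray] at this
    linarith [dist_triangle_left (c.1 n) (c'.1 L) (c'.1 n)]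
  have hsegment : DividesSegment (s / L : ℝ) (c'.1 0) (c.1 n) p := by
    have := DividesSegment.of_dist_add_dist (x := c'.1 0) (y := c.1 n) (p := p) (by linarith)
    rwa [hxp] at this
  have hdist := hX.dist_le_mul (by positivity) (by rw [div_le_one hLpos]; exact hsL) hsegment
    (c'.dividesSegment hsL)
  rw [div_mul_eq_mul_div, le_div_iff₀ hLpos, mul_comm _ (L : ℝ)] at hdist
  rw [hray]
  exact hdist.trans (by gcongr)

end IsCAT0

end Contracting

/-! ### Busemann functions -/

section Busemann

variable {X : Type*} [MetricSpace X]

/-- The Busemann function of a ray `c`, normalized to vanish at `c 0`.  As `t ↦ d(x, c t) - t` is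
nonincreasing, the infimum is its limit as `t → ∞`. -/
noncomputable def busemann (c : GeodesicRay X) (x : X) : ℝ := ⨅ t : ℝ≥0, (dist x (c.1 t) - t)

theorem bddBelow_dist_sub (c : GeodesicRay X) (x : X) :
    BddBelow (range fun t : ℝ≥0 => dist x (c.1 t) - t) := by
  refine ⟨-dist x (c.1 0), ?_⟩
  rintro _ ⟨t, rfl⟩
  linarith [(abs_le.1 (c.abs_sub_dist_le x t)).2]

theorem busemann_le (c : GeodesicRay X) (x : X) (t : ℝ≥0) :
    busemann c x ≤ dist x (c.1 t) - t := ciInf_le (bddBelow_dist_sub c x) t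

theorem tendsto_busemann (c : GeodesicRay X) (x : X) :
    Tendsto (fun t : ℝ≥0 => dist x (c.1 t) - t) atTop (𝓝 (busemann c x)) := by
  refine tendsto_atTop_ciInf (fun s t hst => ?_) (bddBelow_dist_sub c x)
  have := dist_triangle x (c.1 s) (c.1 t)
  rw [c.dist_eq_sub hst] at this
  linarith

theorem abs_busemann_sub_le (c : GeodesicRay X) (x y : X) :
    |busemann c x - busemann c y| ≤ dist x y := by
  refine le_of_tendsto ((tendsto_busemann c x).sub (tendsto_busemann c y)).abs
    (Eventually.of_forall fun t => ?_)
  rw [sub_sub_sub_cancel_right]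
  exact abs_dist_sub_le x y (c.1 t)

namespace IsCAT0

theorem busemann_le_add_mul (hX : IsCAT0 X) (c : GeodesicRay X) {x y p : X} {l : ℝ} (h0 : 0 ≤ l)
    (h1 : l ≤ 1) (hp : DividesSegment l x y p) :
    busemann c p ≤ (1 - l) * busemann c x + l * busemann c y := by
  refine le_of_tendsto_of_tendsto' (tendsto_busemann c p) (((tendsto_busemann c x).const_mul
    (1 - l)).add ((tendsto_busemann c y).const_mul l)) fun t => ?_
  linarith [hX.dist_le_add_mul h0 h1 hp (DividesSegment.refl l (c.1 t))]

/-- Along `c'` the Busemann function is 1-Lipschitz and convex, and it is at most `D - t` at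
`c' t`: this forces slope `-1`. -/
theorem busemann_of_asymptotic (hX : IsCAT0 X) {c c' : GeodesicRay X} (h : c' ≈ c) (s : ℝ≥0) :
    busemann c (c'.1 s) = busemann c (c'.1 0) - s := by
  refine le_antisymm ?_ ?_
  · set D := dist (c'.1 0) (c.1 0)
    set b := busemann c (c'.1 0)
    have hlim : Tendsto (fun t : ℝ≥0 => b - s + s * (D - b) / t) atTop (𝓝 (b - s + 0)) :=
      tendsto_const_nhds.add
        (Tendsto.div_atTop tendsto_const_nhds (NNReal.tendsto_coe_atTop.2 tendsto_id))
    rw [add_zero] at hlim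
    refine ge_of_tendsto hlim ?_
    filter_upwards [eventually_ge_atTop s, eventually_gt_atTop 0] with t hst ht
    have ht0 : (0 : ℝ) < t := ht
    have hend : busemann c (c'.1 t) ≤ D - t :=
      (busemann_le c _ t).trans (sub_le_sub_right (hX.dist_le_of_asymptotic h t) _)
    calc busemann c (c'.1 s) ≤ (1 - s / t) * b + s / t * busemann c (c'.1 t) :=
          hX.busemann_le_add_mul c (by positivity) (by rw [div_le_one ht0]; exact hst)
            (c'.dividesSegment hst)
      _ ≤ (1 - s / t) * b + s / t * (D - t) := by gcongr
      _ = b - s + s * (D - b) / t := by field_simp; ring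
  · have := (abs_le.1 (abs_busemann_sub_le c (c'.1 0) (c'.1 s))).2
    rw [c'.dist_zero] at this
    linarith

end IsCAT0

end Busemann

/-! ### Geodesic lines -/

section Lines

variable {X : Type*} [MetricSpace X]

/-- `γ` is a geodesic line from `ξ` to `η`. -/
structure Joins (γ : ℝ → X) (ξ η : Boundary X) : Prop where
  isometry : Isometry γ
  neg : negEnd γ isometry = ξ
  pos : posEnd γ isometry = η

/-- The ray `t ↦ γ (s + t)`. -/
def lineRay (γ : ℝ → X) (hγ : Isometry γ) (s : ℝ) : GeodesicRay X :=
  ⟨⟨fun t : ℝ≥0 => γ (s + t), hγ.continuous.comp (by fun_prop)⟩,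
    hγ.comp ((IsometryEquiv.addLeft s).isometry.comp isometry_subtype_coe)⟩

theorem lineRay_zero {γ : ℝ → X} (hγ : Isometry γ) (s : ℝ) : (lineRay γ hγ s).1 0 = γ s :=
  congrArg γ (add_zero s)

theorem mk_lineRay {γ : ℝ → X} (hγ : Isometry γ) (s : ℝ) :
    (Quotient.mk _ (lineRay γ hγ s) : Boundary X) = posEnd γ hγ := by
  refine Quotient.sound ⟨|s|, fun t => le_of_eq ?_⟩
  change dist (γ (s + t)) (γ t) = |s|
  rw [hγ.dist_eq, Real.dist_eq, add_sub_cancel_right]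

variable {γ : ℝ → X} {ξ η : Boundary X}

namespace Joins

theorem symm (h : Joins γ ξ η) : Joins (fun t => γ (-t)) η ξ := by
  rcases h with ⟨hγ, rfl, rfl⟩
  refine ⟨hγ.comp (IsometryEquiv.neg ℝ).isometry, ?_, rfl⟩
  simp only [negEnd, neg_neg]

theorem smul (h : Joins γ ξ η) (g : X ≃ᵢ X) : Joins (fun t => g (γ t)) (g • ξ) (g • η) := by
  rcases h with ⟨hγ, rfl, rfl⟩
  exact ⟨g.isometry.comp hγ, rfl, rfl⟩

theorem isClosed_range (h : Joins γ ξ η) : IsClosed (range γ) :=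
  h.isometry.isClosedEmbedding.isClosed_range

theorem mk_lineRay (h : Joins γ ξ η) (s : ℝ) : Quotient.mk _ (lineRay γ h.isometry s) = η := by
  rw [RankOne.mk_lineRay, h.pos]

theorem rayPoint (hX : IsCAT0 X) (h : Joins γ ξ η) (s : ℝ) (r : ℝ≥0) :
    rayPoint (γ s) r η = γ (s + r) := by
  rw [← h.mk_lineRay s, ← lineRay_zero h.isometry s, hX.rayPoint_mk]
  rfl

theorem busemann_sub (hX : IsCAT0 X) {c : GeodesicRay X} (h : Joins γ ξ (Quotient.mk _ c))
    (s t : ℝ) : busemann c (γ s) - busemann c (γ t) = t - s := by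
  wlog hst : s ≤ t generalizing s t
  · linarith [this t s (le_of_not_ge hst)]
  have := hX.busemann_of_asymptotic (Quotient.exact (h.mk_lineRay s)) ⟨t - s, sub_nonneg.2 hst⟩
  rw [lineRay_zero] at this
  change busemann c (γ (s + (t - s))) = busemann c (γ s) - (t - s) at this
  rw [add_sub_cancel] at this
  linarith

theorem busemann_sub_of_neg (hX : IsCAT0 X) {c : GeodesicRay X}
    (h : Joins γ (Quotient.mk _ c) η) (s t : ℝ) :
    busemann c (γ s) - busemann c (γ t) = s - t := by
  have := h.symm.busemann_sub hX (-s) (-t)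
  rw [neg_neg, neg_neg] at this
  linarith

end Joins

theorem IsContracting.smul {B : ℝ} {S : Set X} (h : IsContracting B S) (g : X ≃ᵢ X) :
    IsContracting B (g '' S) := by
  have hinf (x : X) : Metric.infDist x (g '' S) = Metric.infDist (g.symm x) S := by
    conv_lhs => rw [← g.apply_symm_apply x]
    exact Metric.infDist_image g.isometry
  have hdist (x y : X) : dist x (g y) = dist (g.symm x) y := by
    conv_lhs => rw [← g.apply_symm_apply x]
    exact g.isometry.dist_eq _ _
  rintro z r hd x hx y hy _ ⟨p, hp, rfl⟩ _ ⟨q, hq, rfl⟩ hxp hyq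
  rw [hdist, hinf] at hxp hyq
  rw [g.isometry.dist_eq]
  have hball {w : X} (hw : w ∈ Metric.closedBall z r) :
      g.symm w ∈ Metric.closedBall (g.symm z) r := by
    rwa [Metric.mem_closedBall, g.symm.isometry.dist_eq]
  refine h (g.symm z) r ?_ (g.symm x) (hball hx) (g.symm y) (hball hy) p hp q hq hxp hyq
  rwa [← disjoint_image_iff g.injective, g.image_closedBall, g.apply_symm_apply]

theorem mem_contractingPairs {B : ℝ} {c : Boundary X × Boundary X} :
    c ∈ contractingPairs X B ↔
      c.1 ≠ c.2 ∧ ∃ γ, Joins γ c.1 c.2 ∧ IsContracting B (range γ) :=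
  ⟨fun ⟨hne, γ, hγ, hneg, hpos, hB⟩ => ⟨hne, γ, ⟨hγ, hneg, hpos⟩, hB⟩,
    fun ⟨hne, γ, h, hB⟩ => ⟨hne, γ, h.isometry, h.neg, h.pos, hB⟩⟩

theorem swap_mem_contractingPairs {B : ℝ} {c : Boundary X × Boundary X}
    (h : c ∈ contractingPairs X B) : c.swap ∈ contractingPairs X B := by
  rw [mem_contractingPairs] at h ⊢
  obtain ⟨hne, γ, hγ, hB⟩ := h
  exact ⟨hne.symm, _, hγ.symm, by rwa [range_comp_neg]⟩

theorem smul_mem_contractingPairs {B : ℝ} {c : Boundary X × Boundary X}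
    (h : c ∈ contractingPairs X B) (g : X ≃ᵢ X) : g • c ∈ contractingPairs X B := by
  rw [mem_contractingPairs] at h ⊢
  obtain ⟨hne, γ, hγ, hB⟩ := h
  exact ⟨fun h' => hne (smul_left_cancel g h'), _, hγ.smul g, range_comp g γ ▸ hB.smul g⟩

variable [ProperSpace X]

namespace Joins

theorem exists_dist_eq (h : Joins γ ξ η) (x : X) :
    ∃ s, dist x (γ s) = Metric.infDist x (range γ) := by
  obtain ⟨p, ⟨s, rfl⟩, hs⟩ := exists_isFoot h.isClosed_range (range_nonempty γ) x
  exact ⟨s, hs⟩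

theorem dist_rayPoint_foot_le (hX : IsCAT0 X) {B : ℝ} (hB : 0 < B) (h : Joins γ ξ η)
    (hγ : IsContracting B (range γ)) {x p : X} (hp : IsFoot (range γ) x p) :
    dist (RankOne.rayPoint x (Metric.infNndist x (range γ)) η) p ≤ 8 * B := by
  obtain ⟨s, rfl⟩ := hp.1
  set d := Metric.infNndist x (range γ)
  have hd : (d : ℝ) = Metric.infDist x (range γ) := Metric.coe_infNndist
  set c := lineRay γ h.isometry s
  have hc0 : c.1 0 = γ s := lineRay_zero h.isometry s
  have hlim : Tendsto (fun n => d * (2 * dist x (c.1 0)) / dist x (c.1 n) + 8 * B) atTop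
      (𝓝 (0 + 8 * B)) :=
    (Tendsto.div_atTop tendsto_const_nhds (c.tendsto_dist_atTop x)).add tendsto_const_nhds
  rw [zero_add] at hlim
  refine ge_of_tendsto hlim ?_
  filter_upwards [(c.tendsto_dist_atTop x).eventually_gt_atTop 0,
    (NNReal.tendsto_coe_atTop.2 tendsto_id).eventually_ge_atTop (5 * B)] with n hn hBn
  have hdn : (d : ℝ) ∈ Icc 0 (dist x (c.1 n)) :=
    ⟨d.2, hd ▸ Metric.infDist_le_dist_of_mem ⟨s + n, rfl⟩⟩
  obtain ⟨e, he⟩ := hX.exists_isGeodesicSegment x (c.1 n)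
  have hfoot : dist (e d) (γ s) ≤ 8 * B := by
    rw [hd]
    refine hX.dist_segment_foot_le h.isClosed_range hγ hB hp (y := c.1 n) ⟨s + n, rfl⟩ ?_ he
    rwa [← hc0, c.dist_zero]
  have hray : dist (e d) (RankOne.rayPoint x d η) ≤ d * (2 * dist x (c.1 0)) / dist x (c.1 n) := by
    rw [le_div_iff₀' hn, ← h.mk_lineRay s]
    exact hX.mul_dist_segment_rayPoint_le c (he.dist_left hdn) (he.dist_right hdn)
  linarith [dist_triangle_left (RankOne.rayPoint x d η) (γ s) (e d)]

/-- If `x` is far from a contracting line, both rays from `x` to its ends run along the segment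
from `x` to its foot until they come close to the line. -/
theorem infDist_mul_dist_le (hX : IsCAT0 X) {B : ℝ} (hB : 0 < B) (h : Joins γ ξ η)
    (hγ : IsContracting B (range γ)) (x : X) (r : ℝ≥0) :
    Metric.infDist x (range γ) * dist (RankOne.rayPoint x r ξ) (RankOne.rayPoint x r η) ≤
      r * max (16 * B) (2 * r) := by
  obtain ⟨p, hp⟩ := exists_isFoot h.isClosed_range (range_nonempty γ) x
  have hpos := h.dist_rayPoint_foot_le hX hB hγ hp
  have hneg := h.symm.dist_rayPoint_foot_le hX hB (p := p) (by rwa [range_comp_neg])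
    (by rwa [range_comp_neg])
  rw [range_comp_neg] at hneg
  rw [← Metric.coe_infNndist]
  set d := Metric.infNndist x (range γ)
  rcases le_total r d with hr | hr
  · refine (hX.mul_dist_rayPoint_le x ξ η hr).trans ?_
    gcongr
    refine le_max_of_le_left ?_
    linarith [dist_triangle_right (RankOne.rayPoint x d ξ) (RankOne.rayPoint x d η) p]
  · refine mul_le_mul (NNReal.coe_le_coe.2 hr) (le_max_of_le_right ?_) dist_nonneg r.2
    have := dist_triangle_left (RankOne.rayPoint x r ξ) (RankOne.rayPoint x r η) x
    rw [hX.dist_rayPoint, hX.dist_rayPoint] at this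
    linarith

theorem infDist_le_of_one_le_dist_rayPoint (hX : IsCAT0 X) {B : ℝ} (hB : 0 < B)
    (h : Joins γ ξ η) (hγ : IsContracting B (range γ)) {x : X} {r : ℝ≥0}
    (hr : 1 ≤ dist (RankOne.rayPoint x r ξ) (RankOne.rayPoint x r η)) :
    Metric.infDist x (range γ) ≤ r * max (16 * B) (2 * r) :=
  (le_mul_of_one_le_right Metric.infDist_nonneg hr).trans (h.infDist_mul_dist_le hX hB hγ x r)

theorem exists_abs_busemann_sub_sub_le (hX : IsCAT0 X) {c c' : GeodesicRay X}
    (h : Joins γ (Quotient.mk _ c) (Quotient.mk _ c')) {m : ℝ} {x y : X}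
    (hx : Metric.infDist x (range γ) ≤ m) (hy : Metric.infDist y (range γ) ≤ m) :
    ∃ u, |busemann c x - busemann c y - u| ≤ 2 * m ∧
      |busemann c' x - busemann c' y + u| ≤ 2 * m ∧ dist x y ≤ |u| + 2 * m := by
  obtain ⟨s, hs⟩ := h.exists_dist_eq x
  obtain ⟨t, ht⟩ := h.exists_dist_eq y
  rw [← hs] at hx
  rw [← ht] at hy
  have hnear (c₁ : GeodesicRay X) : |busemann c₁ x - busemann c₁ y -
      (busemann c₁ (γ s) - busemann c₁ (γ t))| ≤ 2 * m := by
    have hxs := abs_le.1 ((abs_busemann_sub_le c₁ x (γ s)).trans hx)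
    have hyt := abs_le.1 ((abs_busemann_sub_le c₁ y (γ t)).trans hy)
    exact abs_le.2 ⟨by linarith, by linarith⟩
  refine ⟨s - t, h.busemann_sub_of_neg hX s t ▸ hnear c, ?_, ?_⟩
  · have := hnear c'
    rwa [h.busemann_sub hX, ← neg_sub s t, sub_neg_eq_add] at this
  · have := dist_triangle4 x (γ s) (γ t) y
    rw [h.isometry.dist_eq, Real.dist_eq, dist_comm (γ t)] at this
    linarith

end Joins

/-- The Busemann functions of the three corners determine the position of a point near all three
sides. -/
theorem IsCAT0.dist_le_of_infDist_le (hX : IsCAT0 X) {γ₁ γ₂ γ₃ : ℝ → X} {σ η β : Boundary X}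
    (h₁ : Joins γ₁ σ η) (h₂ : Joins γ₂ η β) (h₃ : Joins γ₃ β σ) {m : ℝ} {x y : X}
    (x₁ : Metric.infDist x (range γ₁) ≤ m) (x₂ : Metric.infDist x (range γ₂) ≤ m)
    (x₃ : Metric.infDist x (range γ₃) ≤ m) (y₁ : Metric.infDist y (range γ₁) ≤ m)
    (y₂ : Metric.infDist y (range γ₂) ≤ m) (y₃ : Metric.infDist y (range γ₃) ≤ m) :
    dist x y ≤ 8 * m := by
  induction σ using Quotient.inductionOn with | _ cσ =>
  induction η using Quotient.inductionOn with | _ cη =>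
  induction β using Quotient.inductionOn with | _ cβ =>
  obtain ⟨u₁, hσ, hη, hdist⟩ := h₁.exists_abs_busemann_sub_sub_le hX x₁ y₁
  obtain ⟨u₂, hη', hβ, -⟩ := h₂.exists_abs_busemann_sub_sub_le hX x₂ y₂
  obtain ⟨u₃, hβ', hσ', -⟩ := h₃.exists_abs_busemann_sub_sub_le hX x₃ y₃
  rw [abs_le] at hσ hσ' hη hη' hβ hβ'
  have hu₁ : |u₁| ≤ 6 * m := abs_le.2 ⟨by linarith, by linarith⟩
  linarith

end Lines

/-! ### Groups of isometries -/

section IsometryGroup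

variable {X : Type*} [MetricSpace X]

theorem tendsto_isometryEquiv_iff {ι : Type*} {l : Filter ι} {F : ι → X ≃ᵢ X} {g : X ≃ᵢ X} :
    Tendsto F l (𝓝 g) ↔ ∀ x, Tendsto (fun i => F i x) l (𝓝 (g x)) := by
  have hind : IsInducing (fun g : X ≃ᵢ X => (⟨g, g.continuous⟩ : C(X, X))) := ⟨rfl⟩
  rw [hind.tendsto_nhds_iff]
  refine ⟨fun h x => ((continuous_eval_const (F := C(X, X)) x).tendsto _).comp h, fun h => ?_⟩
  refine ContinuousMap.tendsto_of_tendstoLocallyUniformly (Metric.tendstoLocallyUniformly_iff.2 ?_)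
  intro ε hε x
  refine ⟨Metric.ball x (ε / 3), Metric.ball_mem_nhds _ (by positivity), ?_⟩
  filter_upwards [Metric.tendsto_nhds.1 (h x) (ε / 3) (by positivity)] with i hi y hy
  rw [Metric.mem_ball] at hy
  have hsum := dist_triangle4 (g y) (g x) (F i x) (F i y)
  rw [g.isometry.dist_eq, (F i).isometry.dist_eq, dist_comm (g x), dist_comm x] at hsum
  change dist (g y) (F i y) < ε
  linarith

theorem continuous_isometryEquiv_apply : Continuous fun q : (X ≃ᵢ X) × X => q.1 q.2 := by
  rw [continuous_iff_continuousAt]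
  rintro ⟨g, x⟩
  rw [ContinuousAt, tendsto_iff_dist_tendsto_zero]
  have hfst : Tendsto (fun q : (X ≃ᵢ X) × X => q.1 x) (𝓝 (g, x)) (𝓝 (g x)) :=
    tendsto_isometryEquiv_iff.1 continuousAt_fst x
  have hsnd : Tendsto (fun q : (X ≃ᵢ X) × X => q.2) (𝓝 (g, x)) (𝓝 x) := continuousAt_snd
  rw [tendsto_iff_dist_tendsto_zero] at hfst hsnd
  have hsum := hsnd.add hfst
  rw [add_zero] at hsum
  refine squeeze_zero (fun _ => dist_nonneg) (fun q => ?_) hsum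
  exact (dist_triangle _ (q.1 x) _).trans_eq (by rw [q.1.isometry.dist_eq])

instance : ContinuousMul (X ≃ᵢ X) where
  continuous_mul := by
    rw [continuous_iff_continuousAt]
    refine fun q => tendsto_isometryEquiv_iff.2 fun x => ?_
    have heval : Continuous fun q : (X ≃ᵢ X) × (X ≃ᵢ X) => q.1 (q.2 x) :=
      continuous_isometryEquiv_apply.comp (continuous_fst.prodMk
        (continuous_isometryEquiv_apply.comp (continuous_snd.prodMk continuous_const)))
    exact heval.tendsto q

variable {G : Subgroup (X ≃ᵢ X)}

instance : ContinuousMul G := inferInstanceAs (ContinuousMul G.toSubmonoid)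

theorem continuous_subgroup_apply : Continuous fun q : G × X => (q.1 : X ≃ᵢ X) q.2 :=
  continuous_isometryEquiv_apply.comp
    ((continuous_subtype_val.comp continuous_fst).prodMk continuous_snd)

@[fun_prop]
theorem continuous_subgroup_apply_const (x : X) : Continuous fun g : G => (g : X ≃ᵢ X) x :=
  continuous_subgroup_apply.comp (continuous_id.prodMk continuous_const)

/-- Translating by an element of the left hand set moves that set into the right hand one. -/
theorem measure_setOf_dist_le_le [MeasurableSpace G] [BorelSpace G] (μ : Measure G)
    [μ.IsMulLeftInvariant] (x y : X) (R : ℝ) :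
    μ {g : G | dist ((g : X ≃ᵢ X) x) y ≤ R} ≤ μ {g : G | dist ((g : X ≃ᵢ X) x) x ≤ 2 * R} := by
  rcases eq_empty_or_nonempty {g : G | dist ((g : X ≃ᵢ X) x) y ≤ R} with hempty | ⟨g₀, h₀⟩
  · rw [hempty, measure_empty]
    exact zero_le
  rw [← measure_preimage_mul μ g₀⁻¹ {g : G | dist ((g : X ≃ᵢ X) x) x ≤ 2 * R}]
  refine measure_mono fun g (hg : dist ((g : X ≃ᵢ X) x) y ≤ R) => ?_
  change dist ((g₀ : X ≃ᵢ X)⁻¹ ((g : X ≃ᵢ X) x)) x ≤ 2 * R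
  rw [← (g₀ : X ≃ᵢ X).isometry.dist_eq, IsometryEquiv.apply_inv_self]
  have h₀' : dist ((g₀ : X ≃ᵢ X) x) y ≤ R := h₀
  linarith [dist_triangle_right ((g : X ≃ᵢ X) x) ((g₀ : X ≃ᵢ X) x) y]

variable [ProperSpace X]

instance : SecondCountableTopology (X ≃ᵢ X) :=
  IsInducing.secondCountableTopology
    (f := fun g : X ≃ᵢ X => (⟨g, g.continuous⟩ : C(X, X))) ⟨rfl⟩

instance : SecondCountableTopology G :=
  IsInducing.secondCountableTopology (f := ((↑) : G → X ≃ᵢ X)) ⟨rfl⟩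

theorem exists_tendsto_of_dist_le {ι : Type*} (U : Ultrafilter ι) {f : ι → X} {y : X} {R : ℝ}
    (h : ∀ᶠ i in (U : Filter ι), dist (f i) y ≤ R) : ∃ z, Tendsto f U (𝓝 z) := by
  obtain ⟨z, -, hz⟩ := (isCompact_closedBall y R).ultrafilter_le_nhds (U.map f)
    (le_principal_iff.2 h)
  exact ⟨z, hz⟩

theorem exists_tendsto_of_ultrafilter {ι : Type*} (U : Ultrafilter ι) {F : ι → X ≃ᵢ X} {x y : X}
    {R : ℝ} (h : ∀ᶠ i in (U : Filter ι), dist (F i x) y ≤ R) : ∃ g, Tendsto F U (𝓝 g) := by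
  have hF (w : X) : ∃ z, Tendsto (fun i => F i w) U (𝓝 z) := by
    refine exists_tendsto_of_dist_le U (y := y) (R := dist w x + R) ?_
    filter_upwards [h] with i hi
    have := dist_triangle (F i w) (F i x) y
    rw [(F i).isometry.dist_eq] at this
    linarith
  have hsymm (w : X) : ∃ z, Tendsto (fun i => (F i).symm w) U (𝓝 z) := by
    refine exists_tendsto_of_dist_le U (y := x) (R := dist w y + R) ?_
    filter_upwards [h] with i hi
    rw [← (F i).isometry.dist_eq, (F i).apply_symm_apply]
    linarith [dist_triangle_right w (F i x) y]
  choose f hf using hF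
  choose k hk using hsymm
  have hisometry : Isometry f := Isometry.of_dist_eq fun a b =>
    tendsto_nhds_unique ((hf a).dist (hf b)) (by simp [(F _).isometry.dist_eq])
  have hfk (w : X) : f (k w) = w := by
    rw [← dist_eq_zero]
    refine tendsto_nhds_unique ((hf (k w)).dist tendsto_const_nhds) ?_
    refine ((tendsto_iff_dist_tendsto_zero.1 (hk w)).congr fun i => ?_)
    rw [dist_comm, ← (F i).isometry.dist_eq, (F i).apply_symm_apply]
  exact ⟨⟨⟨f, k, fun w => hisometry.injective (hfk _), hfk⟩, hisometry⟩,
    tendsto_isometryEquiv_iff.2 hf⟩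

theorem exists_tendsto_subgroup (hG : IsClosed (G : Set (X ≃ᵢ X))) {ι : Type*} (U : Ultrafilter ι)
    {F : ι → G} {x y : X} {R : ℝ}
    (h : ∀ᶠ i in (U : Filter ι), dist ((F i : X ≃ᵢ X) x) y ≤ R) : ∃ g, Tendsto F U (𝓝 g) := by
  obtain ⟨g, hg⟩ := exists_tendsto_of_ultrafilter U h
  exact ⟨⟨g, hG.mem_of_tendsto hg (Eventually.of_forall fun i => (F i).2)⟩,
    tendsto_subtype_rng.2 hg⟩

theorem isCompact_setOf_dist_le (hG : IsClosed (G : Set (X ≃ᵢ X))) (x y : X) (R : ℝ) :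
    IsCompact {g : G | dist ((g : X ≃ᵢ X) x) y ≤ R} := by
  rw [isCompact_iff_ultrafilter_le_nhds]
  intro U hU
  rw [le_principal_iff] at hU
  obtain ⟨g, hg⟩ := exists_tendsto_subgroup hG U (F := id) hU
  have hclosed : IsClosed {g : G | dist ((g : X ≃ᵢ X) x) y ≤ R} :=
    isClosed_le (by fun_prop) continuous_const
  exact ⟨g, hclosed.mem_of_tendsto hg hU, hg⟩

theorem weaklyLocallyCompactSpace_subgroup (hG : IsClosed (G : Set (X ≃ᵢ X))) (x : X) :
    WeaklyLocallyCompactSpace G where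
  exists_compact_mem_nhds g := by
    refine ⟨_, isCompact_setOf_dist_le hG x ((g : X ≃ᵢ X) x) 1, ?_⟩
    have hopen : IsOpen {h : G | dist ((h : X ≃ᵢ X) x) ((g : X ≃ᵢ X) x) < 1} :=
      isOpen_lt (by fun_prop) continuous_const
    exact mem_of_superset (hopen.mem_nhds (by simp)) (ofPred_subset_ofPred.2 fun h => le_of_lt)

end IsometryGroup

/-! ### The cocycle on points -/

section PairFun

variable {X : Type*} [MetricSpace X]

/-- A `1`-Lipschitz bump function around `u`, supported in the unit ball. -/
def bump (u y : X) : ℝ := max 0 (1 - dist y u)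

theorem bump_nonneg (u y : X) : 0 ≤ bump u y := le_max_left _ _

theorem bump_le_one (u y : X) : bump u y ≤ 1 :=
  max_le zero_le_one (sub_le_self _ dist_nonneg)

theorem bump_self (u : X) : bump u u = 1 := by simp [bump]

theorem bump_eq_zero {u y : X} (h : 1 ≤ dist y u) : bump u y = 0 :=
  max_eq_left (sub_nonpos.2 h)

theorem dist_lt_of_bump_ne_zero {u y : X} (h : bump u y ≠ 0) : dist y u < 1 :=
  lt_of_not_ge fun hle => h (bump_eq_zero hle)

theorem abs_bump_sub_le (u y z : X) : |bump u y - bump u z| ≤ dist y z := by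
  refine (abs_max_sub_max_le_max 0 (1 - dist y u) 0 (1 - dist z u)).trans (max_le (by simp) ?_)
  rw [sub_sub_sub_cancel_left, abs_sub_comm]
  exact abs_dist_sub_le y z u

theorem bump_map {f : X → X} (hf : Isometry f) (u y : X) : bump (f u) (f y) = bump u y := by
  rw [bump, bump, hf.dist_eq]

theorem continuous_bump : Continuous fun q : X × X => bump q.1 q.2 := by
  unfold bump
  fun_prop

/-- An antisymmetric function of `(y, z)`, concentrated near `(u, v)` and `(v, u)`. -/
def pairFun (u v y z : X) : ℝ := bump u y * bump v z - bump u z * bump v y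

theorem pairFun_swap (u v y z : X) : pairFun u v z y = -pairFun u v y z := by
  unfold pairFun
  ring

theorem pairFun_map {f : X → X} (hf : Isometry f) (u v y z : X) :
    pairFun (f u) (f v) (f y) (f z) = pairFun u v y z := by
  simp only [pairFun, bump_map hf]

theorem abs_pairFun_le_one (u v y z : X) : |pairFun u v y z| ≤ 1 :=
  abs_sub_le_of_nonneg_of_le (mul_nonneg (bump_nonneg u y) (bump_nonneg v z))
    (mul_le_one₀ (bump_le_one u y) (bump_nonneg v z) (bump_le_one v z))
    (mul_nonneg (bump_nonneg u z) (bump_nonneg v y))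
    (mul_le_one₀ (bump_le_one u z) (bump_nonneg v y) (bump_le_one v y))

theorem abs_pairFun_sub_le (u v w y z : X) :
    |pairFun u v w y - pairFun u v w z| ≤ 2 * dist y z := by
  have hmul (p q : X) : |bump p w * (bump q y - bump q z)| ≤ dist y z := by
    rw [abs_mul, abs_of_nonneg (bump_nonneg p w)]
    exact (mul_le_of_le_one_left (abs_nonneg _) (bump_le_one p w)).trans (abs_bump_sub_le q y z)
  calc |pairFun u v w y - pairFun u v w z|
      = |bump u w * (bump v y - bump v z) - bump v w * (bump u y - bump u z)| := by
        unfold pairFun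
        ring_nf
    _ ≤ dist y z + dist y z := (abs_sub _ _).trans (add_le_add (hmul u v) (hmul v u))
    _ = 2 * dist y z := (two_mul _).symm

theorem abs_pairFun_le (u v y z : X) : |pairFun u v y z| ≤ 2 * dist y z := by
  have hself : pairFun u v y y = 0 := sub_self _
  have h := abs_pairFun_sub_le u v y z y
  rwa [hself, sub_zero, dist_comm] at h

theorem abs_pairFun_sum_le (u v y z w : X) :
    |pairFun u v y z + pairFun u v z w + pairFun u v w y| ≤ 4 * dist y z := by
  rw [pairFun_swap u v w z, add_assoc, neg_add_eq_sub]
  refine (abs_add_le _ _).trans ?_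
  linarith [abs_pairFun_le u v y z, abs_pairFun_sub_le u v w y z]

theorem dist_lt_of_pairFun_ne_zero {u v y z : X} (h : pairFun u v y z ≠ 0) :
    (dist y u < 1 ∧ dist z v < 1) ∨ (dist z u < 1 ∧ dist y v < 1) := by
  by_cases h₁ : bump u y * bump v z = 0
  · have h₂ : bump u z * bump v y ≠ 0 := fun h₂ => h (by rw [pairFun, h₁, h₂, sub_zero])
    exact .inr ⟨dist_lt_of_bump_ne_zero (left_ne_zero_of_mul h₂),
      dist_lt_of_bump_ne_zero (right_ne_zero_of_mul h₂)⟩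
  · exact .inl ⟨dist_lt_of_bump_ne_zero (left_ne_zero_of_mul h₁),
      dist_lt_of_bump_ne_zero (right_ne_zero_of_mul h₁)⟩

theorem one_le_dist_of_pairFun_ne_zero {u v y z : X} (huv : 3 ≤ dist u v)
    (h : pairFun u v y z ≠ 0) : 1 ≤ dist y z := by
  rcases dist_lt_of_pairFun_ne_zero h with ⟨hy, hz⟩ | ⟨hz, hy⟩
  · linarith [dist_triangle4_left y z u v]
  · linarith [dist_triangle4_left z y u v, dist_comm y z]

theorem pairFun_self {u v : X} (h : 1 ≤ dist u v) : pairFun u v u v = 1 := by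
  rw [pairFun, bump_self, bump_self, bump_eq_zero (by rwa [dist_comm]), zero_mul, mul_one,
    sub_zero]

theorem pairFun_eq_zero_left {u v w : X} (y : X) (hu : 1 ≤ dist w u) (hv : 1 ≤ dist w v) :
    pairFun u v w y = 0 := by
  rw [pairFun, bump_eq_zero hu, bump_eq_zero hv, zero_mul, mul_zero, sub_zero]

theorem pairFun_eq_zero_right {u v w : X} (y : X) (hu : 1 ≤ dist w u) (hv : 1 ≤ dist w v) :
    pairFun u v y w = 0 := by
  rw [pairFun_swap, pairFun_eq_zero_left y hu hv, neg_zero]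

end PairFun

/-! ### The cochain -/

section Cochain

variable {X : Type*} [MetricSpace X]

variable (G : Subgroup (X ≃ᵢ X)) (x₀ : X) (r : ℝ≥0) (u v : X)

/-- The value of the cochain at a pair of boundary points, seen from `g x₀`: the pair is replaced
by the points at distance `r` from `g x₀` on the rays from `g x₀`, to be compared with the
translates of `u` and `v`. -/
noncomputable def pairKernel (c : Boundary X × Boundary X) (g : G) : ℝ :=
  pairFun ((g : X ≃ᵢ X) u) ((g : X ≃ᵢ X) v) (rayPoint ((g : X ≃ᵢ X) x₀) r c.1)
    (rayPoint ((g : X ≃ᵢ X) x₀) r c.2)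

/-- The coboundary of `pairKernel`. -/
noncomputable def tripleKernel (t : Fin 3 → Boundary X) (g : G) : ℝ :=
  ∑ i, pairKernel G x₀ r u v (t i, t (i + 1)) g

variable {G x₀ r u v}

theorem pairKernel_swap (c : Boundary X × Boundary X) (g : G) :
    pairKernel G x₀ r u v c.swap g = -pairKernel G x₀ r u v c g :=
  pairFun_swap _ _ _ _

theorem abs_pairKernel_le_one (c : Boundary X × Boundary X) (g : G) :
    |pairKernel G x₀ r u v c g| ≤ 1 :=
  abs_pairFun_le_one _ _ _ _

theorem abs_tripleKernel_le (t : Fin 3 → Boundary X) (g : G) (i : Fin 3) :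
    |tripleKernel G x₀ r u v t g| ≤ 4 * dist (rayPoint ((g : X ≃ᵢ X) x₀) r (t i))
      (rayPoint ((g : X ≃ᵢ X) x₀) r (t (i + 1))) := by
  rw [tripleKernel, ← Equiv.sum_comp (Equiv.addLeft i), Fin.sum_univ_three]
  convert abs_pairFun_sum_le ((g : X ≃ᵢ X) u) ((g : X ≃ᵢ X) v)
    (rayPoint ((g : X ≃ᵢ X) x₀) r (t i)) (rayPoint ((g : X ≃ᵢ X) x₀) r (t (i + 1)))
    (rayPoint ((g : X ≃ᵢ X) x₀) r (t (i + 2))) using 2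
  fin_cases i <;> rfl

theorem abs_tripleKernel_le_three (t : Fin 3 → Boundary X) (g : G) :
    |tripleKernel G x₀ r u v t g| ≤ 3 :=
  calc |tripleKernel G x₀ r u v t g|
      ≤ ∑ i, |pairKernel G x₀ r u v (t i, t (i + 1)) g| := Finset.abs_sum_le_sum_abs _ _
    _ ≤ ∑ _ : Fin 3, 1 := Finset.sum_le_sum fun _ _ => abs_pairKernel_le_one _ _
    _ = 3 := by simp

theorem exists_pairKernel_ne_zero {t : Fin 3 → Boundary X} {g : G}
    (h : tripleKernel G x₀ r u v t g ≠ 0) :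
    ∃ i, pairKernel G x₀ r u v (t i, t (i + 1)) g ≠ 0 :=
  let ⟨i, _, hi⟩ := Finset.exists_ne_zero_of_sum_ne_zero h
  ⟨i, hi⟩

theorem tripleKernel_comp_swap {i j : Fin 3} (hij : i ≠ j) (t : Fin 3 → Boundary X) (g : G) :
    tripleKernel G x₀ r u v (t ∘ Equiv.swap i j) g = -tripleKernel G x₀ r u v t g := by
  simp only [tripleKernel, Fin.sum_univ_three, Function.comp_apply]
  have hneg (ξ η : Boundary X) :
      pairKernel G x₀ r u v (ξ, η) g = -pairKernel G x₀ r u v (η, ξ) g := pairKernel_swap (η, ξ) g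
  have h₀ := hneg (t 1) (t 0)
  have h₁ := hneg (t 2) (t 1)
  have h₂ := hneg (t 0) (t 2)
  fin_cases i <;> fin_cases j <;> first | exact absurd rfl hij | skip
  all_goals
    simp [Equiv.swap_apply_def, h₀, h₁, h₂]
    try ring

theorem tripleKernel_comp (σ : Equiv.Perm (Fin 3)) (t : Fin 3 → Boundary X) (g : G) :
    tripleKernel G x₀ r u v (t ∘ σ) g =
      (Equiv.Perm.sign σ : ℤ) * tripleKernel G x₀ r u v t g := by
  induction σ using Equiv.Perm.swap_induction_on generalizing t with
  | one => simp
  | swap_mul τ i j hij ih =>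
    rw [Equiv.Perm.coe_mul, ← Function.comp_assoc, ih, tripleKernel_comp_swap hij,
      Equiv.Perm.sign_mul, Equiv.Perm.sign_swap hij]
    simp

theorem continuous_bump_subgroup (x : X) :
    Continuous fun z : G × G => bump ((z.1 : X ≃ᵢ X) x) ((z.2 : X ≃ᵢ X) x) :=
  continuous_bump.comp (((continuous_subgroup_apply_const x).comp continuous_fst).prodMk
    ((continuous_subgroup_apply_const x).comp continuous_snd))

variable [ProperSpace X]

theorem IsCAT0.pairKernel_smul (hX : IsCAT0 X) (c : Boundary X × Boundary X) (g h : G) :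
    pairKernel G x₀ r u v (g • c) (g * h) = pairKernel G x₀ r u v c h := by
  have hmul (y : X) : ((g * h : G) : X ≃ᵢ X) y = (g : X ≃ᵢ X) ((h : X ≃ᵢ X) y) := rfl
  have hfst : (g • c).1 = (g : X ≃ᵢ X) • c.1 := rfl
  have hsnd : (g • c).2 = (g : X ≃ᵢ X) • c.2 := rfl
  simp only [pairKernel, hmul, hfst, hsnd, hX.smul_rayPoint, pairFun_map (g : X ≃ᵢ X).isometry]

theorem IsCAT0.continuous_rayPoint_prod (hX : IsCAT0 X) (r : ℝ≥0) :
    Continuous fun q : X × Boundary X => rayPoint q.1 r q.2 :=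
  continuous_prod_of_continuous_lipschitzWith _ 1 (fun x => hX.continuous_rayPoint x r)
    fun ξ => LipschitzWith.of_dist_le_mul fun x y => by
      simpa only [NNReal.coe_one, one_mul] using hX.dist_rayPoint_le x y r ξ

theorem IsCAT0.continuous_rayPoint_subgroup (hX : IsCAT0 X) {Y : Type*} [TopologicalSpace Y]
    {f : Y → G} {k : Y → Boundary X} (hf : Continuous f) (hk : Continuous k) :
    Continuous fun y => rayPoint ((f y : X ≃ᵢ X) x₀) r (k y) :=
  (hX.continuous_rayPoint_prod r).comp
    (((continuous_subgroup_apply_const x₀).comp hf).prodMk hk)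

theorem IsCAT0.continuous_pairKernel (hX : IsCAT0 X) :
    Continuous fun q : (Boundary X × Boundary X) × G => pairKernel G x₀ r u v q.1 q.2 := by
  have hbump (w : X) {k : (Boundary X × Boundary X) × G → Boundary X} (hk : Continuous k) :
      Continuous fun q : (Boundary X × Boundary X) × G =>
        bump ((q.2 : X ≃ᵢ X) w) (rayPoint ((q.2 : X ≃ᵢ X) x₀) r (k q)) :=
    continuous_bump.comp (((continuous_subgroup_apply_const w).comp continuous_snd).prodMk
      (hX.continuous_rayPoint_subgroup continuous_snd hk))
  have hfst : Continuous fun q : (Boundary X × Boundary X) × G => q.1.1 := by fun_prop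
  have hsnd : Continuous fun q : (Boundary X × Boundary X) × G => q.1.2 := by fun_prop
  exact ((hbump u hfst).mul (hbump v hsnd)).sub ((hbump u hsnd).mul (hbump v hfst))

theorem IsCAT0.continuous_tripleKernel (hX : IsCAT0 X) :
    Continuous fun q : (Fin 3 → Boundary X) × G => tripleKernel G x₀ r u v q.1 q.2 :=
  continuous_finsetSum _ fun i _ => hX.continuous_pairKernel.comp
    (f := fun q : (Fin 3 → Boundary X) × G => ((q.1 i, q.1 (i + 1)), q.2)) (by fun_prop)

theorem IsCAT0.continuous_tripleKernel_right (hX : IsCAT0 X) (t : Fin 3 → Boundary X) :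
    Continuous (tripleKernel G x₀ r u v t) :=
  Continuous.uncurry_left t hX.continuous_tripleKernel

variable (G x₀ r u v)

/-- The cochain `α`, as a function on `G × G`: the kernel `pairKernel`, spread out over the second
factor by a bump function. -/
noncomputable def cochain (hX : IsCAT0 X) (c : Boundary X × Boundary X) : C(G × G, ℝ) where
  toFun z := bump ((z.1 : X ≃ᵢ X) x₀) ((z.2 : X ≃ᵢ X) x₀) * pairKernel G x₀ r u v c z.1
  continuous_toFun := (continuous_bump_subgroup x₀).mul
    (hX.continuous_pairKernel.comp (continuous_const.prodMk continuous_fst))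

variable {G x₀ r u v}

theorem cochain_apply (hX : IsCAT0 X) (c : Boundary X × Boundary X) (z : G × G) :
    cochain G x₀ r u v hX c z =
      bump ((z.1 : X ≃ᵢ X) x₀) ((z.2 : X ≃ᵢ X) x₀) * pairKernel G x₀ r u v c z.1 := rfl

theorem continuous_cochain (hX : IsCAT0 X) : Continuous (cochain G x₀ r u v hX) :=
  ContinuousMap.continuous_of_continuous_uncurry _ <|
    ((continuous_bump_subgroup x₀).comp continuous_snd).mul (hX.continuous_pairKernel.comp
      (continuous_fst.prodMk (continuous_fst.comp continuous_snd)))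

theorem abs_cochain_le_one (hX : IsCAT0 X) (c : Boundary X × Boundary X) (z : G × G) :
    |cochain G x₀ r u v hX c z| ≤ 1 := by
  rw [cochain_apply, abs_mul, abs_of_nonneg (bump_nonneg _ _)]
  exact mul_le_one₀ (bump_le_one _ _) (abs_nonneg _) (abs_pairKernel_le_one _ _)

theorem cochain_smul (hX : IsCAT0 X) (c : Boundary X × Boundary X) (g : G) (z : G × G) :
    cochain G x₀ r u v hX (g • c) (g * z.1, g * z.2) = cochain G x₀ r u v hX c z := by
  have hmul (h : G) : ((g * h : G) : X ≃ᵢ X) x₀ = (g : X ≃ᵢ X) ((h : X ≃ᵢ X) x₀) := rfl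
  simp only [cochain_apply, hX.pairKernel_smul, hmul, bump_map (g : X ≃ᵢ X).isometry]

theorem cochain_swap (hX : IsCAT0 X) (c : Boundary X × Boundary X) :
    cochain G x₀ r u v hX c.swap = -cochain G x₀ r u v hX c := by
  ext z
  rw [ContinuousMap.neg_apply, cochain_apply, cochain_apply, pairKernel_swap, mul_neg]

end Cochain

/-! ### Integrability of the coboundary -/

section DyadicTail

/-- The bound of `setLIntegral_rpow_le_dyadicTail` for the `p`-th power integral over `{2 ^ K ≤ w}`
of a function which is dominated by `C / w`, when the measure of the part of its support where
`w ≤ 2 ^ (n + 1)` is at most `N * 2 ^ n`. -/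
noncomputable def dyadicTail (C N : ℝ≥0∞) (p : ℝ) (K : ℕ) : ℝ≥0∞ :=
  ∑' k, C ^ p * N * (2⁻¹ ^ p * 2) ^ (k + K)

variable {C N : ℝ≥0∞} {p : ℝ}

theorem tsum_dyadicTail_ne_top (hC : C ≠ ∞) (hN : N ≠ ∞) (hp : 1 < p) :
    ∑' k : ℕ, C ^ p * N * (2⁻¹ ^ p * 2) ^ k ≠ ∞ := by
  have hratio : (2⁻¹ : ℝ≥0∞) ^ p * 2 < 1 := by
    have hpow := ENNReal.rpow_lt_rpow_of_exponent_gt (x := 2⁻¹) (by simp) (by simp) hp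
    rw [ENNReal.rpow_one] at hpow
    exact (ENNReal.mul_lt_mul_left (by simp) (by simp) hpow).trans_eq
      (ENNReal.inv_mul_cancel (by simp) (by simp))
  rw [ENNReal.tsum_mul_left, ENNReal.tsum_geometric]
  exact ENNReal.mul_ne_top (ENNReal.mul_ne_top
    (ENNReal.rpow_ne_top_of_nonneg (zero_le_one.trans hp.le) hC) hN)
    (ENNReal.inv_ne_top.2 (tsub_pos_of_lt hratio).ne')

theorem dyadicTail_zero_ne_top (hC : C ≠ ∞) (hN : N ≠ ∞) (hp : 1 < p) :
    dyadicTail C N p 0 ≠ ∞ :=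
  tsum_dyadicTail_ne_top hC hN hp

theorem tendsto_dyadicTail (hC : C ≠ ∞) (hN : N ≠ ∞) (hp : 1 < p) :
    Tendsto (dyadicTail C N p) atTop (𝓝 0) :=
  ENNReal.tendsto_sum_nat_add _ (tsum_dyadicTail_ne_top hC hN hp)

variable {α : Type*} {f : α → ℝ≥0∞} {w : α → ℝ}

theorem rpow_le_tsum_indicator (hp : 0 < p) (hfw : ∀ x, f x * ENNReal.ofReal (w x) ≤ C) {K : ℕ}
    {x : α} (hx : 2 ^ K ≤ w x) :
    f x ^ p ≤ ∑' k, {y | f y ≠ 0 ∧ w y ≤ 2 ^ (k + K + 1)}.indicator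
      (fun _ => (C * 2⁻¹ ^ (k + K)) ^ p) x := by
  rcases eq_or_ne (f x) 0 with hfx | hfx
  · rw [hfx, ENNReal.zero_rpow_of_pos hp]
    exact zero_le
  obtain ⟨n, hn, hn'⟩ := exists_nat_pow_near (one_le_pow₀ one_le_two |>.trans hx) one_lt_two
  have hKn : K ≤ n :=
    Nat.lt_succ_iff.1 ((pow_lt_pow_iff_right₀ one_lt_two).1 (hx.trans_lt hn'))
  obtain ⟨k, rfl⟩ := Nat.exists_eq_add_of_le' hKn
  refine le_trans ?_ (ENNReal.le_tsum k)
  have hmem : x ∈ {y | f y ≠ 0 ∧ w y ≤ 2 ^ (k + K + 1)} := ⟨hfx, hn'.le⟩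
  rw [indicator_of_mem hmem]
  refine ENNReal.rpow_le_rpow ?_ hp.le
  rw [← ENNReal.inv_pow, ← div_eq_mul_inv]
  refine ENNReal.le_div_iff_mul_le (.inl (by simp)) (.inl (by simp)) |>.2 (le_trans ?_ (hfw x))
  gcongr
  exact (ENNReal.ofReal_pow zero_le_two _ |>.trans (by simp)).symm.trans_le
    (ENNReal.ofReal_le_ofReal hn)

theorem setLIntegral_rpow_le_dyadicTail [MeasurableSpace α] {μ : Measure α} (hf : Measurable f)
    (hw : Measurable w) (hp : 0 < p) (hfw : ∀ x, f x * ENNReal.ofReal (w x) ≤ C)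
    (hμ : ∀ n : ℕ, μ {x | f x ≠ 0 ∧ w x ≤ 2 ^ (n + 1)} ≤ N * 2 ^ n) (K : ℕ) :
    ∫⁻ x in {x | 2 ^ K ≤ w x}, f x ^ p ∂μ ≤ dyadicTail C N p K := by
  have hmeas (n : ℕ) : MeasurableSet {x | f x ≠ 0 ∧ w x ≤ 2 ^ (n + 1)} :=
    (hf (measurableSet_singleton 0)).compl.inter (measurableSet_le hw measurable_const)
  calc ∫⁻ x in {x | 2 ^ K ≤ w x}, f x ^ p ∂μ
      ≤ ∫⁻ x in {x | 2 ^ K ≤ w x}, ∑' k, {x | f x ≠ 0 ∧ w x ≤ 2 ^ (k + K + 1)}.indicator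
          (fun _ => (C * 2⁻¹ ^ (k + K)) ^ p) x ∂μ :=
        setLIntegral_mono' (measurableSet_le measurable_const hw)
          fun _ => rpow_le_tsum_indicator hp hfw
    _ ≤ ∫⁻ x, ∑' k, {x | f x ≠ 0 ∧ w x ≤ 2 ^ (k + K + 1)}.indicator
          (fun _ => (C * 2⁻¹ ^ (k + K)) ^ p) x ∂μ := setLIntegral_le_lintegral _ _
    _ = ∑' k, (C * 2⁻¹ ^ (k + K)) ^ p * μ {x | f x ≠ 0 ∧ w x ≤ 2 ^ (k + K + 1)} := by
        rw [lintegral_tsum fun k => (measurable_const.indicator (hmeas _)).aemeasurable]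
        exact tsum_congr fun k => lintegral_indicator_const (hmeas _) _
    _ ≤ ∑' k, (C * 2⁻¹ ^ (k + K)) ^ p * (N * 2 ^ (k + K)) := by
        gcongr
        exact hμ _
    _ = dyadicTail C N p K := by
        refine tsum_congr fun k => ?_
        rw [ENNReal.mul_rpow_of_nonneg _ _ hp.le, mul_pow, ← ENNReal.rpow_natCast 2⁻¹,
          ← ENNReal.rpow_mul, mul_comm (_ : ℝ) p, ENNReal.rpow_mul, ENNReal.rpow_natCast]
        ring

end DyadicTail

section Integrability

variable {X : Type*} [MetricSpace X] {B : ℝ} {t : Fin 3 → Boundary X} {γ : Fin 3 → ℝ → X}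

/-- The lines `γ i` are the sides of an ideal triangle with vertices `t i` and `B`-contracting
sides. -/
def IsContractingTriangle (B : ℝ) (t : Fin 3 → Boundary X) (γ : Fin 3 → ℝ → X) : Prop :=
  ∀ i, Joins (γ i) (t i) (t (i + 1)) ∧ IsContracting B (range (γ i))

/-- The triples of boundary points any two of which are joined by a contracting line: the set `T(B)`
without the requirement that the points are in the limit set. -/
def joinedTriples (X : Type*) [MetricSpace X] (B : ℝ) : Set (Fin 3 → Boundary X) :=
  {t | ∀ i, (t i, t (i + 1)) ∈ contractingPairs X B}

theorem mem_contractingPairs_of_mem_joinedTriples (h : t ∈ joinedTriples X B) {i j : Fin 3}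
    (hij : i ≠ j) : (t i, t j) ∈ contractingPairs X B := by
  have hnext : j = i + 1 ∨ i = j + 1 := by
    revert i j
    decide
  rcases hnext with rfl | rfl
  · exact h i
  · exact swap_mem_contractingPairs (h j)

theorem exists_isContractingTriangle (h : t ∈ joinedTriples X B) :
    ∃ γ, IsContractingTriangle B t γ := by
  choose γ hγ using fun i => (mem_contractingPairs.1 (h i)).2
  exact ⟨γ, hγ⟩

/-- The largest distance of a point to the three sides of a triangle. -/
noncomputable def maxSideDist (γ : Fin 3 → ℝ → X) (x : X) : ℝ :=
  Finset.univ.sup' Finset.univ_nonempty fun i => Metric.infDist x (range (γ i))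

theorem maxSideDist_le_iff {x : X} {m : ℝ} :
    maxSideDist γ x ≤ m ↔ ∀ i, Metric.infDist x (range (γ i)) ≤ m := by
  simp [maxSideDist]

theorem exists_maxSideDist_eq (γ : Fin 3 → ℝ → X) (x : X) :
    ∃ i, maxSideDist γ x = Metric.infDist x (range (γ i)) :=
  let ⟨i, _, hi⟩ := Finset.exists_mem_eq_sup' Finset.univ_nonempty
    fun i => Metric.infDist x (range (γ i))
  ⟨i, hi⟩

theorem maxSideDist_nonneg (γ : Fin 3 → ℝ → X) (x : X) : 0 ≤ maxSideDist γ x := by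
  obtain ⟨i, hi⟩ := exists_maxSideDist_eq γ x
  exact hi ▸ Metric.infDist_nonneg

theorem continuous_maxSideDist (γ : Fin 3 → ℝ → X) : Continuous (maxSideDist γ) :=
  Continuous.finset_sup'_apply _ fun i _ => Metric.continuous_infDist_pt (range (γ i))

variable {G : Subgroup (X ≃ᵢ X)}

/-- Cover the line by the unit intervals with integer endpoints, counted from a point near the
orbit of `x` under `S`. -/
theorem measure_le_of_dist_line_le [MeasurableSpace G] [BorelSpace G] (μ : Measure G)
    [μ.IsMulLeftInvariant] {γ : ℝ → X} (hγ : Isometry γ) {S : Set G} {x : X} {D R : ℕ}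
    (hD : ∀ g ∈ S, ∀ h ∈ S, dist ((g : X ≃ᵢ X) x) ((h : X ≃ᵢ X) x) ≤ D)
    (hR : ∀ g ∈ S, ∃ s, dist ((g : X ≃ᵢ X) x) (γ s) ≤ R) :
    μ S ≤ (2 * (D + 2 * R) + 1 : ℕ) * μ {g : G | dist ((g : X ≃ᵢ X) x) x ≤ 2 * (R + 1)} := by
  rcases S.eq_empty_or_nonempty with rfl | ⟨g₀, hg₀⟩
  · simp
  obtain ⟨s₀, hs₀⟩ := hR g₀ hg₀
  have hcover : S ⊆ ⋃ k ∈ Finset.Icc (-(D + 2 * R : ℤ)) (D + 2 * R),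
      {g : G | dist ((g : X ≃ᵢ X) x) (γ (s₀ + k)) ≤ R + 1} := by
    intro g hg
    obtain ⟨s, hs⟩ := hR g hg
    have habs : |s - s₀| ≤ D + 2 * R := by
      rw [← Real.dist_eq, ← hγ.dist_eq]
      linarith [dist_triangle4_left ((g : X ≃ᵢ X) x) ((g₀ : X ≃ᵢ X) x) (γ s) (γ s₀), hD g hg g₀ hg₀]
    have hlow : (((-(D + 2 * R) : ℤ)) : ℝ) ≤ s - s₀ := by
      push_cast
      exact (abs_le.1 habs).1
    have hup : (⌊s - s₀⌋ : ℝ) ≤ ((D + 2 * R : ℤ) : ℝ) := by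
      push_cast
      exact (Int.floor_le _).trans (abs_le.1 habs).2
    refine mem_biUnion (x := ⌊s - s₀⌋) (Finset.mem_coe.2 (Finset.mem_Icc.2
      ⟨Int.le_floor.2 hlow, Int.cast_le.1 hup⟩)) ?_
    have hstep : dist (γ s) (γ (s₀ + ⌊s - s₀⌋)) ≤ 1 := by
      rw [hγ.dist_eq, Real.dist_eq, ← sub_sub]
      exact abs_le.2 ⟨by linarith [Int.floor_le (s - s₀)],
        by linarith [Int.lt_floor_add_one (s - s₀)]⟩
    exact (dist_triangle _ (γ s) _).trans (add_le_add hs hstep)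
  calc μ S ≤ ∑ k ∈ Finset.Icc (-(D + 2 * R : ℤ)) (D + 2 * R),
        μ {g : G | dist ((g : X ≃ᵢ X) x) (γ (s₀ + k)) ≤ R + 1} :=
        (measure_mono hcover).trans (measure_biUnion_finset_le _ _)
    _ ≤ ∑ _ ∈ Finset.Icc (-(D + 2 * R : ℤ)) (D + 2 * R),
        μ {g : G | dist ((g : X ≃ᵢ X) x) x ≤ 2 * (R + 1)} :=
        Finset.sum_le_sum fun k _ => measure_setOf_dist_le_le μ x _ _
    _ = (2 * (D + 2 * R) + 1 : ℕ) * μ {g : G | dist ((g : X ≃ᵢ X) x) x ≤ 2 * (R + 1)} := by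
        rw [Finset.sum_const, nsmul_eq_mul, Int.card_Icc]
        congr 2
        lia

variable [ProperSpace X]

theorem IsContractingTriangle.dist_le (hX : IsCAT0 X) (h : IsContractingTriangle B t γ) {m : ℝ}
    {x y : X} (hx : maxSideDist γ x ≤ m) (hy : maxSideDist γ y ≤ m) : dist x y ≤ 8 * m := by
  rw [maxSideDist_le_iff] at hx hy
  exact hX.dist_le_of_infDist_le (h 0).1 (h 1).1 (h 2).1 (hx 0) (hx 1) (hx 2) (hy 0) (hy 1) (hy 2)

theorem IsCAT0.eventually_maxSideDist_le (hX : IsCAT0 X) (hB : 0 < B) (x : X)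
    {t₀ : Fin 3 → Boundary X} (h : ∀ i, t₀ i ≠ t₀ (i + 1)) :
    ∃ m : ℝ, ∀ᶠ t in 𝓝 t₀, ∀ γ, IsContractingTriangle B t γ → maxSideDist γ x ≤ m := by
  obtain ⟨s, hs⟩ : ∃ s, ∀ i, 1 < dist (rayPoint x s (t₀ i)) (rayPoint x s (t₀ (i + 1))) :=
    (eventually_all.2 fun i => (hX.tendsto_dist_rayPoint x (h i)).eventually_gt_atTop 1).exists
  have hcont (i : Fin 3) : Continuous fun t : Fin 3 → Boundary X => rayPoint x s (t i) :=
    (hX.continuous_rayPoint x s).comp (continuous_apply i)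
  have hnear : ∀ᶠ t in 𝓝 t₀, ∀ i, 1 < dist (rayPoint x s (t i)) (rayPoint x s (t (i + 1))) :=
    eventually_all.2 fun i =>
      (((hcont i).dist (hcont (i + 1))).tendsto t₀).eventually (lt_mem_nhds (hs i))
  refine ⟨s * max (16 * B) (2 * s), ?_⟩
  filter_upwards [hnear] with t ht γ hγ
  exact maxSideDist_le_iff.2 fun i =>
    (hγ i).1.infDist_le_of_one_le_dist_rayPoint hX hB (hγ i).2 (ht i).le

variable {x₀ : X} {r : ℝ≥0} {u v : X}

theorem infDist_le_of_pairKernel_ne_zero (hX : IsCAT0 X) (hB : 0 < B) (huv : 3 ≤ dist u v)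
    {γ : ℝ → X} {c : Boundary X × Boundary X} (h : Joins γ c.1 c.2)
    (hγ : IsContracting B (range γ)) {g : G} (hg : pairKernel G x₀ r u v c g ≠ 0) :
    Metric.infDist ((g : X ≃ᵢ X) x₀) (range γ) ≤ r * max (16 * B) (2 * r) :=
  h.infDist_le_of_one_le_dist_rayPoint hX hB hγ
    (one_le_dist_of_pairFun_ne_zero (by rwa [(g : X ≃ᵢ X).isometry.dist_eq]) hg)

theorem abs_tripleKernel_mul_le (hX : IsCAT0 X) (hB : 0 < B) (h : IsContractingTriangle B t γ)
    (g : G) : |tripleKernel G x₀ r u v t g| * (1 + maxSideDist γ ((g : X ≃ᵢ X) x₀)) ≤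
      3 + 4 * (r * max (16 * B) (2 * r)) := by
  obtain ⟨i, hi⟩ := exists_maxSideDist_eq γ ((g : X ≃ᵢ X) x₀)
  rw [hi, mul_add, mul_one]
  refine add_le_add (abs_tripleKernel_le_three t g) ?_
  have hside := (h i).1.infDist_mul_dist_le hX hB (h i).2 ((g : X ≃ᵢ X) x₀) r
  have hmul := mul_le_mul_of_nonneg_right
    (abs_tripleKernel_le (x₀ := x₀) (r := r) (u := u) (v := v) t g i)
    (Metric.infDist_nonneg (x := (g : X ≃ᵢ X) x₀) (s := range (γ i)))
  linarith

variable [MeasurableSpace G] [BorelSpace G] (μ : Measure G) [μ.IsMulLeftInvariant]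

theorem measure_setOf_tripleKernel_ne_zero_le (hX : IsCAT0 X) (hB : 0 < B) (huv : 3 ≤ dist u v)
    (h : IsContractingTriangle B t γ) {R : ℕ} (hR : r * max (16 * B) (2 * r) ≤ R) (m : ℕ) :
    μ {g : G | tripleKernel G x₀ r u v t g ≠ 0 ∧ maxSideDist γ ((g : X ≃ᵢ X) x₀) ≤ m} ≤
      3 * ((2 * (8 * m + 2 * R) + 1 : ℕ) *
        μ {g : G | dist ((g : X ≃ᵢ X) x₀) x₀ ≤ 2 * (R + 1)}) := by
  have hsub : {g : G | tripleKernel G x₀ r u v t g ≠ 0 ∧ maxSideDist γ ((g : X ≃ᵢ X) x₀) ≤ m} ⊆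
      ⋃ i, {g : G | maxSideDist γ ((g : X ≃ᵢ X) x₀) ≤ m ∧
        Metric.infDist ((g : X ≃ᵢ X) x₀) (range (γ i)) ≤ R} := by
    rintro g ⟨hg, hm⟩
    obtain ⟨i, hi⟩ := exists_pairKernel_ne_zero hg
    exact mem_iUnion.2 ⟨i, hm,
      (infDist_le_of_pairKernel_ne_zero hX hB huv (h i).1 (h i).2 hi).trans hR⟩
  refine (measure_mono hsub).trans ((measure_iUnion_fintype_le _ _).trans ?_)
  have hside (i : Fin 3) : μ {g : G | maxSideDist γ ((g : X ≃ᵢ X) x₀) ≤ m ∧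
      Metric.infDist ((g : X ≃ᵢ X) x₀) (range (γ i)) ≤ R} ≤ (2 * (8 * m + 2 * R) + 1 : ℕ) *
        μ {g : G | dist ((g : X ≃ᵢ X) x₀) x₀ ≤ 2 * (R + 1)} := by
    refine measure_le_of_dist_line_le μ (h i).1.isometry (fun g hg k hk => ?_) fun g hg => ?_
    · exact_mod_cast h.dist_le hX hg.1 hk.1
    · obtain ⟨s, hs⟩ := (h i).1.exists_dist_eq ((g : X ≃ᵢ X) x₀)
      exact ⟨s, hs.trans_le hg.2⟩
  exact (Finset.sum_le_card_nsmul _ _ _ fun i _ => hside i).trans_eq (by simp)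

theorem measure_setOf_tripleKernel_ne_zero_le_two_pow (hX : IsCAT0 X) (hB : 0 < B)
    (huv : 3 ≤ dist u v) (h : IsContractingTriangle B t γ) {R : ℕ}
    (hR : r * max (16 * B) (2 * r) ≤ R) (n : ℕ) :
    μ {g : G | tripleKernel G x₀ r u v t g ≠ 0 ∧
        1 + maxSideDist γ ((g : X ≃ᵢ X) x₀) ≤ 2 ^ (n + 1)} ≤
      3 * ((33 + 4 * R : ℕ) * μ {g : G | dist ((g : X ≃ᵢ X) x₀) x₀ ≤ 2 * (R + 1)}) * 2 ^ n := by
  have hcard : 2 * (8 * 2 ^ (n + 1) + 2 * R) + 1 ≤ (33 + 4 * R) * 2 ^ n := by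
    have hpow : 1 ≤ 2 ^ n := Nat.one_le_two_pow
    rw [pow_succ]
    nlinarith
  calc μ {g : G | tripleKernel G x₀ r u v t g ≠ 0 ∧
        1 + maxSideDist γ ((g : X ≃ᵢ X) x₀) ≤ 2 ^ (n + 1)}
      ≤ μ {g : G | tripleKernel G x₀ r u v t g ≠ 0 ∧
        maxSideDist γ ((g : X ≃ᵢ X) x₀) ≤ (2 ^ (n + 1) : ℕ)} := by
        refine measure_mono fun g hg => ⟨hg.1, ?_⟩
        push_cast
        linarith [hg.2]
    _ ≤ 3 * ((2 * (8 * 2 ^ (n + 1) + 2 * R) + 1 : ℕ) *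
        μ {g : G | dist ((g : X ≃ᵢ X) x₀) x₀ ≤ 2 * (R + 1)}) :=
        measure_setOf_tripleKernel_ne_zero_le μ hX hB huv h hR _
    _ ≤ 3 * (((33 + 4 * R) * 2 ^ n : ℕ) *
        μ {g : G | dist ((g : X ≃ᵢ X) x₀) x₀ ≤ 2 * (R + 1)}) := by gcongr
    _ = 3 * ((33 + 4 * R : ℕ) * μ {g : G | dist ((g : X ≃ᵢ X) x₀) x₀ ≤ 2 * (R + 1)}) * 2 ^ n := by
        push_cast
        ring

theorem exists_tail_bound [IsFiniteMeasureOnCompacts μ] (hX : IsCAT0 X)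
    (hG : IsClosed (G : Set (X ≃ᵢ X))) (hB : 0 < B) (huv : 3 ≤ dist u v) {p : ℝ} (hp : 1 < p) :
    ∃ τ : ℕ → ℝ≥0∞, τ 0 ≠ ∞ ∧ Tendsto τ atTop (𝓝 0) ∧
      ∀ t γ, IsContractingTriangle B t γ → ∀ K : ℕ,
        ∫⁻ g in {g : G | 2 ^ K ≤ 1 + maxSideDist γ ((g : X ≃ᵢ X) x₀)},
          ‖tripleKernel G x₀ r u v t g‖ₑ ^ p ∂μ ≤ τ K := by
  obtain ⟨R, hR⟩ := exists_nat_ge (r * max (16 * B) (2 * r))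
  have hN : 3 * (((33 + 4 * R : ℕ) : ℝ≥0∞) *
      μ {g : G | dist ((g : X ≃ᵢ X) x₀) x₀ ≤ 2 * (R + 1)}) ≠ ∞ :=
    ENNReal.mul_ne_top (by simp) (ENNReal.mul_ne_top (ENNReal.natCast_ne_top _)
      (isCompact_setOf_dist_le hG x₀ x₀ _).measure_ne_top)
  refine ⟨_, dyadicTail_zero_ne_top (C := ENNReal.ofReal (3 + 4 * (r * max (16 * B) (2 * r))))
    ENNReal.ofReal_ne_top hN hp, tendsto_dyadicTail ENNReal.ofReal_ne_top hN hp, ?_⟩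
  intro t γ h
  refine setLIntegral_rpow_le_dyadicTail (hX.continuous_tripleKernel_right t).measurable.enorm
    (continuous_const.add ((continuous_maxSideDist γ).comp
      (continuous_subgroup_apply_const x₀))).measurable
    (zero_lt_one.trans hp) (fun g => ?_) fun n => ?_
  · rw [Real.enorm_eq_ofReal_abs, ← ENNReal.ofReal_mul (abs_nonneg _)]
    exact ENNReal.ofReal_le_ofReal (abs_tripleKernel_mul_le hX hB h g)
  · simpa only [enorm_ne_zero] using
      measure_setOf_tripleKernel_ne_zero_le_two_pow μ hX hB huv h hR n

end Integrability

section ConvergenceInMean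

variable {α E ι : Type*} [MeasurableSpace α] [NormedAddCommGroup E] {μ : Measure α} {p : ℝ}
  {l : Filter ι} {F : ι → α → E} {f : α → E}

theorem lintegral_enorm_sub_rpow_le (hp : 1 ≤ p) {f g : α → E} (hf : AEStronglyMeasurable f μ) :
    ∫⁻ x, ‖f x - g x‖ₑ ^ p ∂μ ≤
      2 ^ (p - 1) * (∫⁻ x, ‖f x‖ₑ ^ p ∂μ + ∫⁻ x, ‖g x‖ₑ ^ p ∂μ) :=
  calc ∫⁻ x, ‖f x - g x‖ₑ ^ p ∂μ
      ≤ ∫⁻ x, 2 ^ (p - 1) * (‖f x‖ₑ ^ p + ‖g x‖ₑ ^ p) ∂μ :=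
        lintegral_mono fun _ =>
          (ENNReal.rpow_le_rpow enorm_sub_le (zero_le_one.trans hp)).trans
            (ENNReal.rpow_add_le_mul_rpow_add_rpow _ _ hp)
    _ = 2 ^ (p - 1) * (∫⁻ x, ‖f x‖ₑ ^ p ∂μ + ∫⁻ x, ‖g x‖ₑ ^ p ∂μ) := by
        rw [lintegral_const_mul' _ _ (ENNReal.rpow_ne_top_of_nonneg (sub_nonneg.2 hp) (by simp)),
          lintegral_add_left' (hf.enorm.pow_const p)]

theorem tendsto_setLIntegral_enorm_sub_rpow (hp : 0 < p) {Q : Set α} (hQ : MeasurableSet Q)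
    (hμQ : μ Q ≠ ∞) (hF : TendstoUniformlyOn F f l Q) :
    Tendsto (fun i => ∫⁻ x in Q, ‖F i x - f x‖ₑ ^ p ∂μ) l (𝓝 0) := by
  have hlim : Tendsto (fun δ : ℝ≥0∞ => δ ^ p * μ Q) (𝓝 0) (𝓝 0) := by
    have hpow := (ENNReal.continuous_rpow_const (y := p)).tendsto 0
    rw [ENNReal.zero_rpow_of_pos hp] at hpow
    simpa only [zero_mul] using ENNReal.Tendsto.mul_const hpow (.inr hμQ)
  rw [ENNReal.tendsto_nhds_zero]
  intro ε hε
  obtain ⟨δ, hδ, hδε⟩ := ENNReal.nhds_zero_basis_Iic.mem_iff.1 (hlim (Iic_mem_nhds hε))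
  filter_upwards [EMetric.tendstoUniformlyOn_iff.1 hF δ hδ] with i hi
  calc ∫⁻ x in Q, ‖F i x - f x‖ₑ ^ p ∂μ ≤ ∫⁻ _ in Q, δ ^ p ∂μ :=
        setLIntegral_mono' hQ fun x hx => by
          rw [← edist_eq_enorm_sub, edist_comm]
          exact ENNReal.rpow_le_rpow (hi x hx).le hp.le
    _ = δ ^ p * μ Q := setLIntegral_const _ _
    _ ≤ ε := hδε (mem_Iic.2 le_rfl)

/-- A criterion of Vitali type: uniform tightness makes up for the infinite measure. -/
theorem tendsto_lintegral_enorm_sub_rpow (hp : 1 ≤ p) (hF : ∀ i, AEStronglyMeasurable (F i) μ)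
    (h : ∀ ε : ℝ≥0∞, 0 < ε → ∃ Q, MeasurableSet Q ∧ μ Q ≠ ∞ ∧ TendstoUniformlyOn F f l Q ∧
      (∀ᶠ i in l, ∫⁻ x in Qᶜ, ‖F i x‖ₑ ^ p ∂μ ≤ ε) ∧ ∫⁻ x in Qᶜ, ‖f x‖ₑ ^ p ∂μ ≤ ε) :
    Tendsto (fun i => ∫⁻ x, ‖F i x - f x‖ₑ ^ p ∂μ) l (𝓝 0) := by
  have hlim : Tendsto (fun ε : ℝ≥0∞ => 2 ^ (p - 1) * (ε + ε)) (𝓝 0) (𝓝 0) := by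
    have hadd : Tendsto (fun ε : ℝ≥0∞ => ε + ε) (𝓝 0) (𝓝 (0 + 0)) := tendsto_id.add tendsto_id
    simpa only [add_zero, mul_zero] using ENNReal.Tendsto.const_mul (a := 2 ^ (p - 1)) hadd
      (.inr (ENNReal.rpow_ne_top_of_nonneg (sub_nonneg.2 hp) (by simp)))
  rw [ENNReal.tendsto_nhds_zero]
  intro ε hε
  obtain ⟨δ, hδ, hδε⟩ := ENNReal.nhds_zero_basis_Iic.mem_iff.1
    (hlim (Iic_mem_nhds (ENNReal.half_pos hε.ne')))
  obtain ⟨Q, hQ, hμQ, hunif, htail, htail'⟩ := h δ hδ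
  have hcore := tendsto_setLIntegral_enorm_sub_rpow (zero_lt_one.trans_le hp) hQ hμQ hunif
  filter_upwards [ENNReal.tendsto_nhds_zero.1 hcore _ (ENNReal.half_pos hε.ne'), htail]
    with i hi hti
  calc ∫⁻ x, ‖F i x - f x‖ₑ ^ p ∂μ
      = ∫⁻ x in Q, ‖F i x - f x‖ₑ ^ p ∂μ + ∫⁻ x in Qᶜ, ‖F i x - f x‖ₑ ^ p ∂μ :=
        (lintegral_add_compl _ hQ).symm
    _ ≤ ε / 2 + 2 ^ (p - 1) * (δ + δ) := by
        gcongr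
        refine (lintegral_enorm_sub_rpow_le hp (hF i).restrict).trans ?_
        gcongr
    _ ≤ ε / 2 + ε / 2 := by
        gcongr
        exact hδε (mem_Iic.2 le_rfl)
    _ = ε := ENNReal.add_halves ε

end ConvergenceInMean

/-! ### The cocycle -/

section Cocycle

variable {X : Type*} [MetricSpace X]

theorem vec_mem_joinedTriples {B : ℝ} {a b c : Boundary X} (hab : (a, b) ∈ contractingPairs X B)
    (hbc : (b, c) ∈ contractingPairs X B) (hca : (c, a) ∈ contractingPairs X B) :
    ![a, b, c] ∈ joinedTriples X B := by
  intro i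
  fin_cases i
  exacts [hab, hbc, hca]

variable {G : Subgroup (X ≃ᵢ X)}

/-- The coboundary of `cochain`, as a function on `G × G`. -/
noncomputable def coboundaryFun (G : Subgroup (X ≃ᵢ X)) (x₀ : X) (r : ℝ≥0) (u v : X)
    (t : Fin 3 → Boundary X) (z : G × G) : ℝ :=
  bump ((z.1 : X ≃ᵢ X) x₀) ((z.2 : X ≃ᵢ X) x₀) * tripleKernel G x₀ r u v t z.1

variable {x₀ : X} {r : ℝ≥0} {u v : X}

theorem coboundaryFun_comp (σ : Equiv.Perm (Fin 3)) (t : Fin 3 → Boundary X) :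
    coboundaryFun G x₀ r u v (t ∘ σ) =
      ((Equiv.Perm.sign σ : ℤ) : ℝ) • coboundaryFun G x₀ r u v t := by
  ext z
  simp only [coboundaryFun, tripleKernel_comp, Pi.smul_apply, smul_eq_mul]
  ring

theorem coboundaryFun_cocycle (a₁ a₂ a₃ a₄ : Boundary X) :
    coboundaryFun G x₀ r u v ![a₂, a₃, a₄] - coboundaryFun G x₀ r u v ![a₁, a₃, a₄] +
      coboundaryFun G x₀ r u v ![a₁, a₂, a₄] - coboundaryFun G x₀ r u v ![a₁, a₂, a₃] = 0 := by
  ext z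
  have h₄₂ : pairKernel G x₀ r u v (a₄, a₂) z.1 = -pairKernel G x₀ r u v (a₂, a₄) z.1 :=
    pairKernel_swap (a₂, a₄) z.1
  have h₃₁ : pairKernel G x₀ r u v (a₃, a₁) z.1 = -pairKernel G x₀ r u v (a₁, a₃) z.1 :=
    pairKernel_swap (a₁, a₃) z.1
  simp only [Pi.sub_apply, Pi.add_apply, Pi.zero_apply, coboundaryFun, tripleKernel,
    Fin.sum_univ_three, Fin.reduceAdd, Matrix.cons_val, h₄₂, h₃₁]
  ring

theorem IsCAT0.coboundaryFun_smul [ProperSpace X] (hX : IsCAT0 X) (t : Fin 3 → Boundary X)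
    (g : G) (z : G × G) :
    coboundaryFun G x₀ r u v (g • t) (g * z.1, g * z.2) = coboundaryFun G x₀ r u v t z := by
  have hmul (h : G) : ((g * h : G) : X ≃ᵢ X) x₀ = (g : X ≃ᵢ X) ((h : X ≃ᵢ X) x₀) := rfl
  have hkernel : tripleKernel G x₀ r u v (g • t) (g * z.1) = tripleKernel G x₀ r u v t z.1 :=
    Finset.sum_congr rfl fun i _ => hX.pairKernel_smul (t i, t (i + 1)) g z.1
  simp only [coboundaryFun, hkernel, hmul, bump_map (g : X ≃ᵢ X).isometry]

theorem coboundaryFun_eq [ProperSpace X] (hX : IsCAT0 X) (t : Fin 3 → Boundary X) (z : G × G) :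
    coboundaryFun G x₀ r u v t z = cochain G x₀ r u v hX (t 0, t 1) z +
      cochain G x₀ r u v hX (t 1, t 2) z + cochain G x₀ r u v hX (t 2, t 0) z := by
  simp only [coboundaryFun, cochain_apply, tripleKernel, Fin.sum_univ_three, Fin.reduceAdd]
  ring

theorem IsCAT0.continuous_coboundaryFun [ProperSpace X] (hX : IsCAT0 X) (t : Fin 3 → Boundary X) :
    Continuous (coboundaryFun G x₀ r u v t) :=
  (continuous_bump_subgroup x₀).mul ((hX.continuous_tripleKernel_right t).comp continuous_fst)

variable [MeasurableSpace G] {μ : Measure G} {p : ℝ≥0∞} {t : Fin 3 → Boundary X}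

variable (G x₀ r u v μ)

open Classical in
/-- The class of `coboundaryFun` in `L^p(G × G, μ × μ)`, with the junk value `0` at those triples
for which `coboundaryFun` is not in `L^p`. -/
noncomputable def lpCocycle (p : ℝ≥0∞) (t : Fin 3 → Boundary X) : Lp ℝ p (μ.prod μ) :=
  if h : MemLp (coboundaryFun G x₀ r u v t) p (μ.prod μ) then h.toLp else 0

variable {G x₀ r u v μ}

theorem lpCocycle_eq_toLp (h : MemLp (coboundaryFun G x₀ r u v t) p (μ.prod μ)) :
    lpCocycle G x₀ r u v μ p t = h.toLp :=
  dif_pos h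

theorem coeFn_lpCocycle (h : MemLp (coboundaryFun G x₀ r u v t) p (μ.prod μ)) :
    lpCocycle G x₀ r u v μ p t =ᵐ[μ.prod μ] coboundaryFun G x₀ r u v t := by
  rw [lpCocycle_eq_toLp h]
  exact h.coeFn_toLp

theorem lpCocycle_comp (σ : Equiv.Perm (Fin 3))
    (h : MemLp (coboundaryFun G x₀ r u v t) p (μ.prod μ)) :
    lpCocycle G x₀ r u v μ p (t ∘ σ) =
      (Equiv.Perm.sign σ : ℤ) • lpCocycle G x₀ r u v μ p t := by
  have hσ : MemLp (coboundaryFun G x₀ r u v (t ∘ σ)) p (μ.prod μ) :=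
    coboundaryFun_comp σ t ▸ h.const_smul _
  rw [lpCocycle_eq_toLp h, lpCocycle_eq_toLp hσ, ← Int.cast_smul_eq_zsmul ℝ,
    ← MemLp.toLp_const_smul]
  exact MemLp.toLp_congr _ _ (.of_eq (coboundaryFun_comp σ t))

theorem lpCocycle_cocycle {a₁ a₂ a₃ a₄ : Boundary X}
    (h₁ : MemLp (coboundaryFun G x₀ r u v ![a₂, a₃, a₄]) p (μ.prod μ))
    (h₂ : MemLp (coboundaryFun G x₀ r u v ![a₁, a₃, a₄]) p (μ.prod μ))
    (h₃ : MemLp (coboundaryFun G x₀ r u v ![a₁, a₂, a₄]) p (μ.prod μ))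
    (h₄ : MemLp (coboundaryFun G x₀ r u v ![a₁, a₂, a₃]) p (μ.prod μ)) :
    lpCocycle G x₀ r u v μ p ![a₂, a₃, a₄] - lpCocycle G x₀ r u v μ p ![a₁, a₃, a₄] +
      lpCocycle G x₀ r u v μ p ![a₁, a₂, a₄] - lpCocycle G x₀ r u v μ p ![a₁, a₂, a₃] = 0 := by
  rw [lpCocycle_eq_toLp h₁, lpCocycle_eq_toLp h₂, lpCocycle_eq_toLp h₃, lpCocycle_eq_toLp h₄,
    ← MemLp.toLp_sub, ← MemLp.toLp_add, ← MemLp.toLp_sub]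
  simp only [coboundaryFun_cocycle, MemLp.toLp_zero]

variable [ProperSpace X]

theorem lpCocycle_ne_zero [μ.IsOpenPosMeasure] [SFinite μ] (hX : IsCAT0 X)
    (h : MemLp (coboundaryFun G x₀ r u v t) p (μ.prod μ)) (h1 : tripleKernel G x₀ r u v t 1 ≠ 0) :
    lpCocycle G x₀ r u v μ p t ≠ 0 := by
  intro h0
  have hae : coboundaryFun G x₀ r u v t =ᵐ[μ.prod μ] fun _ => 0 :=
    (coeFn_lpCocycle h).symm.trans (h0 ▸ Lp.coeFn_zero ℝ p (μ.prod μ))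
  have hval := congrFun
    (((hX.continuous_coboundaryFun t).ae_eq_iff_eq (μ.prod μ) continuous_const).1 hae) (1, 1)
  rw [coboundaryFun, bump_self, one_mul] at hval
  exact h1 hval

variable (μ)

theorem sigmaFinite_of_isClosed [IsFiniteMeasureOnCompacts μ] (hG : IsClosed (G : Set (X ≃ᵢ X)))
    (x₀ : X) : SigmaFinite μ := by
  have := weaklyLocallyCompactSpace_subgroup hG x₀
  infer_instance

variable [BorelSpace G]

theorem lintegral_bump_ne_top [IsFiniteMeasureOnCompacts μ] (hG : IsClosed (G : Set (X ≃ᵢ X)))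
    {p : ℝ} (hp : 0 < p) : ∫⁻ h : G, ‖bump x₀ ((h : X ≃ᵢ X) x₀)‖ₑ ^ p ∂μ ≠ ∞ := by
  have hQ : IsCompact {g : G | dist ((g : X ≃ᵢ X) x₀) x₀ ≤ 1} :=
    isCompact_setOf_dist_le hG x₀ x₀ 1
  refine ne_top_of_le_ne_top (hQ.measure_ne_top (μ := μ)) ?_
  rw [← lintegral_indicator_one (isClosed_le (by fun_prop) continuous_const).measurableSet]
  refine lintegral_mono fun g => ?_
  by_cases hg : dist ((g : X ≃ᵢ X) x₀) x₀ ≤ 1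
  · rw [indicator_of_mem (by exact hg), Pi.one_apply, Real.enorm_eq_ofReal (bump_nonneg _ _)]
    exact ENNReal.rpow_le_one (ENNReal.ofReal_le_one.2 (bump_le_one _ _)) hp.le
  · rw [bump_eq_zero (not_le.1 hg).le, enorm_zero, ENNReal.zero_rpow_of_pos hp]
    exact zero_le

theorem tendsto_lintegral_tripleKernel_sub [μ.IsMulLeftInvariant] [IsFiniteMeasureOnCompacts μ]
    (hX : IsCAT0 X) (hG : IsClosed (G : Set (X ≃ᵢ X))) {B : ℝ} (hB : 0 < B) (huv : 3 ≤ dist u v)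
    {p : ℝ} (hp : 1 < p) {t₀ : Fin 3 → Boundary X} (ht₀ : t₀ ∈ joinedTriples X B) :
    Tendsto
      (fun t => ∫⁻ g, ‖tripleKernel G x₀ r u v t g - tripleKernel G x₀ r u v t₀ g‖ₑ ^ p ∂μ)
      (𝓝[joinedTriples X B] t₀) (𝓝 0) := by
  obtain ⟨τ, -, hτ₀, hτ⟩ := exists_tail_bound (x₀ := x₀) (r := r) μ hX hG hB huv hp
  obtain ⟨m, hm⟩ := hX.eventually_maxSideDist_le hB x₀ (t₀ := t₀) fun i => (ht₀ i).1
  refine tendsto_lintegral_enorm_sub_rpow hp.le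
    (fun t => (hX.continuous_tripleKernel_right t).aestronglyMeasurable) fun ε hε => ?_
  obtain ⟨K, hmK, hτK⟩ : ∃ K : ℕ, m ≤ 2 ^ K ∧ τ K ≤ ε :=
    (((tendsto_pow_atTop_atTop_of_one_lt one_lt_two).eventually_ge_atTop m).and
      (ENNReal.tendsto_nhds_zero.1 hτ₀ ε hε)).exists
  have hQ : IsCompact {g : G | dist ((g : X ≃ᵢ X) x₀) x₀ ≤ 8 * 2 ^ K} :=
    isCompact_setOf_dist_le hG x₀ x₀ _
  have htail (t) (ht : t ∈ joinedTriples X B)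
      (hmt : ∀ γ, IsContractingTriangle B t γ → maxSideDist γ x₀ ≤ m) :
      ∫⁻ g in {g : G | dist ((g : X ≃ᵢ X) x₀) x₀ ≤ 8 * 2 ^ K}ᶜ,
        ‖tripleKernel G x₀ r u v t g‖ₑ ^ p ∂μ ≤ ε := by
    obtain ⟨γ, hγ⟩ := exists_isContractingTriangle ht
    refine (lintegral_mono_set fun g hg => ?_).trans ((hτ t γ hγ K).trans hτK)
    by_contra hn
    have hlt : 1 + maxSideDist γ ((g : X ≃ᵢ X) x₀) < 2 ^ K := not_le.1 hn
    exact hg (hγ.dist_le hX (by linarith) ((hmt γ hγ).trans hmK))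
  refine ⟨_, (isClosed_le (by fun_prop) continuous_const).measurableSet,
    hQ.measure_ne_top, ?_, ?_, htail t₀ ht₀ hm.self_of_nhds⟩
  · let Φ : C((Fin 3 → Boundary X) × G, ℝ) :=
      ⟨_, hX.continuous_tripleKernel (x₀ := x₀) (r := r) (u := u) (v := v)⟩
    have hcurry := (Φ.curry.continuous.tendsto t₀).mono_left
      (nhdsWithin_le_nhds (s := joinedTriples X B))
    exact ContinuousMap.tendsto_iff_forall_isCompact_tendstoUniformlyOn.1 hcurry _ hQ
  · filter_upwards [self_mem_nhdsWithin, mem_nhdsWithin_of_mem_nhds hm] using htail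

theorem lintegral_bump_mul [μ.IsMulLeftInvariant] [SigmaFinite μ] {f : G → ℝ} (hf : Continuous f)
    {p : ℝ} (hp : 0 ≤ p) :
    ∫⁻ z : G × G, ‖bump ((z.1 : X ≃ᵢ X) x₀) ((z.2 : X ≃ᵢ X) x₀) * f z.1‖ₑ ^ p ∂(μ.prod μ) =
      (∫⁻ h : G, ‖bump x₀ ((h : X ≃ᵢ X) x₀)‖ₑ ^ p ∂μ) * ∫⁻ g, ‖f g‖ₑ ^ p ∂μ := by
  have hcont : Continuous fun z : G × G =>
      bump ((z.1 : X ≃ᵢ X) x₀) ((z.2 : X ≃ᵢ X) x₀) * f z.1 :=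
    (continuous_bump_subgroup x₀).mul (hf.comp continuous_fst)
  rw [lintegral_prod _ (hcont.measurable.enorm.pow_const p).aemeasurable,
    ← lintegral_const_mul _ (hf.measurable.enorm.pow_const p)]
  refine lintegral_congr fun g => ?_
  have hmeas : Measurable fun h : G => ‖bump ((g : X ≃ᵢ X) x₀) ((h : X ≃ᵢ X) x₀)‖ₑ ^ p :=
    ((continuous_bump_subgroup x₀).comp (Continuous.prodMk_right g)).measurable.enorm.pow_const p
  have hbump (h : G) :
      bump ((g : X ≃ᵢ X) x₀) (((g * h : G) : X ≃ᵢ X) x₀) = bump x₀ ((h : X ≃ᵢ X) x₀) :=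
    bump_map (g : X ≃ᵢ X).isometry _ _
  simp only [enorm_mul, ENNReal.mul_rpow_of_nonneg _ _ hp]
  rw [lintegral_mul_const _ hmeas, ← lintegral_mul_left_eq_self _ g]
  simp only [hbump]

theorem eLpNorm_bump_mul [μ.IsMulLeftInvariant] [SigmaFinite μ] {f : G → ℝ} (hf : Continuous f)
    (h0 : p ≠ 0) (htop : p ≠ ∞) :
    eLpNorm (fun z : G × G => bump ((z.1 : X ≃ᵢ X) x₀) ((z.2 : X ≃ᵢ X) x₀) * f z.1) p
        (μ.prod μ) =
      ((∫⁻ h : G, ‖bump x₀ ((h : X ≃ᵢ X) x₀)‖ₑ ^ p.toReal ∂μ) *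
        ∫⁻ g, ‖f g‖ₑ ^ p.toReal ∂μ) ^ (1 / p.toReal) := by
  rw [eLpNorm_eq_lintegral_rpow_enorm_toReal h0 htop,
    lintegral_bump_mul μ hf ENNReal.toReal_nonneg]

variable {μ}

theorem exists_eLpNorm_coboundaryFun_le [μ.IsMulLeftInvariant] [IsFiniteMeasureOnCompacts μ]
    [SigmaFinite μ] (hX : IsCAT0 X) (hG : IsClosed (G : Set (X ≃ᵢ X))) {B : ℝ} (hB : 0 < B)
    (huv : 3 ≤ dist u v) (hp : 1 < p) (hp' : p < ∞) :
    ∃ D : ℝ≥0∞, D ≠ ∞ ∧ ∀ t ∈ joinedTriples X B,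
      eLpNorm (coboundaryFun G x₀ r u v t) p (μ.prod μ) ≤ D := by
  have hp_toReal : 1 < p.toReal := by
    simpa using (ENNReal.toReal_lt_toReal ENNReal.one_ne_top hp'.ne).2 hp
  obtain ⟨τ, hτ₀, -, hτ⟩ := exists_tail_bound (x₀ := x₀) (r := r) μ hX hG hB huv hp_toReal
  refine ⟨_, ENNReal.rpow_ne_top_of_nonneg (y := 1 / p.toReal) (by positivity)
    (ENNReal.mul_ne_top (lintegral_bump_ne_top (x₀ := x₀) μ hG (zero_lt_one.trans hp_toReal)) hτ₀),
    fun t ht => ?_⟩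
  obtain ⟨γ, hγ⟩ := exists_isContractingTriangle ht
  have huniv : {g : G | 2 ^ 0 ≤ 1 + maxSideDist γ ((g : X ≃ᵢ X) x₀)} = univ :=
    eq_univ_of_forall fun g => by simpa using maxSideDist_nonneg γ ((g : X ≃ᵢ X) x₀)
  have hτγ := hτ t γ hγ 0
  rw [huniv, setLIntegral_univ] at hτγ
  refine (eLpNorm_bump_mul μ (hX.continuous_tripleKernel_right t) (zero_lt_one.trans hp).ne'
    hp'.ne).trans_le (ENNReal.rpow_le_rpow ?_ (by positivity))
  gcongr

theorem memLp_coboundaryFun [μ.IsMulLeftInvariant] [IsFiniteMeasureOnCompacts μ]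
    [SigmaFinite μ] (hX : IsCAT0 X) (hG : IsClosed (G : Set (X ≃ᵢ X))) {B : ℝ} (hB : 0 < B)
    (huv : 3 ≤ dist u v) (hp : 1 < p) (hp' : p < ∞)
    (ht : t ∈ joinedTriples X B) : MemLp (coboundaryFun G x₀ r u v t) p (μ.prod μ) :=
  let ⟨_, hD, hle⟩ := exists_eLpNorm_coboundaryFun_le hX hG hB huv hp hp'
  ⟨(hX.continuous_coboundaryFun t).aestronglyMeasurable, (hle t ht).trans_lt hD.lt_top⟩

theorem lpCocycle_smul [μ.IsMulLeftInvariant] [SFinite μ] (hX : IsCAT0 X) (g : G)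
    (h : MemLp (coboundaryFun G x₀ r u v t) p (μ.prod μ))
    (hg : MemLp (coboundaryFun G x₀ r u v (g • t)) p (μ.prod μ)) :
    ∀ᵐ z ∂(μ.prod μ), lpCocycle G x₀ r u v μ p (g • t) (g * z.1, g * z.2) =
      lpCocycle G x₀ r u v μ p t z := by
  have hmul := (measurePreserving_mul_left μ g).prod (measurePreserving_mul_left μ g)
  filter_upwards [hmul.quasiMeasurePreserving.ae (coeFn_lpCocycle hg), coeFn_lpCocycle h]
    with z hgz hz
  exact hgz.trans ((hX.coboundaryFun_smul t g z).trans hz.symm)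

theorem continuousOn_lpCocycle [Fact (1 ≤ p)] [μ.IsMulLeftInvariant] [IsFiniteMeasureOnCompacts μ]
    [SigmaFinite μ] (hX : IsCAT0 X) (hG : IsClosed (G : Set (X ≃ᵢ X))) {B : ℝ} (hB : 0 < B)
    (huv : 3 ≤ dist u v) (hp : 1 < p) (hp' : p < ∞) :
    ContinuousOn (lpCocycle G x₀ r u v μ p) (joinedTriples X B) := by
  intro t₀ ht₀
  have hp_toReal : 1 < p.toReal := by
    simpa using (ENNReal.toReal_lt_toReal ENNReal.one_ne_top hp'.ne).2 hp
  have hlim : Tendsto (fun t => ((∫⁻ h : G, ‖bump x₀ ((h : X ≃ᵢ X) x₀)‖ₑ ^ p.toReal ∂μ) *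
      ∫⁻ g, ‖tripleKernel G x₀ r u v t g - tripleKernel G x₀ r u v t₀ g‖ₑ ^ p.toReal ∂μ) ^
        (1 / p.toReal)) (𝓝[joinedTriples X B] t₀) (𝓝 0) := by
    have hmul := ENNReal.Tendsto.const_mul
      (tendsto_lintegral_tripleKernel_sub (x₀ := x₀) (r := r) μ hX hG hB huv hp_toReal ht₀)
      (.inr (lintegral_bump_ne_top (x₀ := x₀) μ hG (zero_lt_one.trans hp_toReal)))
    simpa only [mul_zero, ENNReal.zero_rpow_of_pos (one_div_pos.2 (zero_lt_one.trans hp_toReal))]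
      using hmul.ennrpow_const (1 / p.toReal)
  rw [ContinuousWithinAt, tendsto_iff_edist_tendsto_0]
  refine hlim.congr' ?_
  filter_upwards [self_mem_nhdsWithin] with t ht
  rw [lpCocycle_eq_toLp (memLp_coboundaryFun hX hG hB huv hp hp' ht),
    lpCocycle_eq_toLp (memLp_coboundaryFun hX hG hB huv hp hp' ht₀), Lp.edist_toLp_toLp,
    ← eLpNorm_bump_mul μ (f := fun g => tripleKernel G x₀ r u v t g - tripleKernel G x₀ r u v t₀ g)
      ((hX.continuous_tripleKernel_right t).sub (hX.continuous_tripleKernel_right t₀))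
      (zero_lt_one.trans hp).ne' hp'.ne]
  simp only [mul_sub]
  rfl

theorem isContinuousBoundedCocycle_lpCocycle [Fact (1 ≤ p)] [μ.IsMulLeftInvariant]
    [IsFiniteMeasureOnCompacts μ] [SigmaFinite μ] (hX : IsCAT0 X)
    (hG : IsClosed (G : Set (X ≃ᵢ X))) {B : ℝ} (hB : 0 < B) (huv : 3 ≤ dist u v) (hp : 1 < p)
    (hp' : p < ∞) : IsContinuousBoundedCocycle G μ B p (lpCocycle G x₀ r u v μ p) := by
  have hmem {t : Fin 3 → Boundary X} (ht : t ∈ joinedTriples X B) :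
      MemLp (coboundaryFun G x₀ r u v t) p (μ.prod μ) :=
    memLp_coboundaryFun hX hG hB huv hp hp' ht
  refine ⟨(continuousOn_lpCocycle hX hG hB huv hp hp').mono fun t ht => ht.2.2, ?_, ?_, ?_, ?_⟩
  · obtain ⟨D, hD, hle⟩ :=
      exists_eLpNorm_coboundaryFun_le (μ := μ) (x₀ := x₀) (r := r) hX hG hB huv hp hp'
    refine ⟨D.toReal, fun t ht => ?_⟩
    rw [lpCocycle_eq_toLp (hmem ht.2.2), Lp.norm_toLp]
    exact ENNReal.toReal_mono hD (hle t ht.2.2)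
  · exact fun g t ht => lpCocycle_smul hX g (hmem ht.2.2)
      (hmem fun i => smul_mem_contractingPairs (ht.2.2 i) (g : X ≃ᵢ X))
  · exact fun σ t ht => lpCocycle_comp σ (hmem ht.2.2)
  · intro a₁ a₂ a₃ a₄ hnd _ hpair
    simp only [List.nodup_cons, List.mem_cons, List.not_mem_nil, or_false, not_or] at hnd
    simp only [List.mem_cons, List.not_mem_nil, or_false, forall_eq_or_imp, forall_eq] at hpair
    apply lpCocycle_cocycle <;> refine hmem (vec_mem_joinedTriples ?_ ?_ ?_) <;> grind

end Cocycle

/-! ### The support of the cochain -/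

section Support

variable {X : Type*} [MetricSpace X]

theorem endpoint_eq_point {c : GeneralizedRay X} {T : ℝ≥0}
    (h : ∀ s t, dist (c.1 s) (c.1 t) = dist (min s T) (min t T)) :
    c.endpoint = .point (c.1 T) := by
  have hc : ¬ Isometry c.1 := fun hc => by
    have hdist := hc.dist_eq T (T + 1)
    rw [h, min_self, min_eq_right le_self_add, dist_self, NNReal.dist_eq] at hdist
    simp at hdist
  rw [GeneralizedRay.endpoint, dif_neg hc]
  have h' := Classical.choose_spec (c.2.resolve_left hc)
  set T' := Classical.choose (c.2.resolve_left hc)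
  congr 1
  rw [← dist_eq_zero]
  rcases le_total T T' with hle | hle
  · rw [h, min_self, min_eq_right hle, dist_self]
  · rw [h', min_self, min_eq_right hle, dist_self]

theorem endpoint_eq_ideal (c : GeodesicRay X) :
    GeneralizedRay.endpoint ⟨c.1, Or.inl c.2⟩ = .ideal (Quotient.mk _ c) := by
  rw [GeneralizedRay.endpoint, dif_pos c.2]

theorem continuous_endpoint : Continuous (GeneralizedRay.endpoint (X := X)) :=
  continuous_coinduced_rng

theorem continuous_point : Continuous (Bordification.point : X → Bordification X) := by
  have hconst (x : X) (s t : ℝ≥0) : dist (ContinuousMap.const ℝ≥0 x s)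
      (ContinuousMap.const ℝ≥0 x t) = dist (min s 0) (min t 0) := by simp
  have hcont : Continuous fun x : X =>
      (⟨ContinuousMap.const ℝ≥0 x, Or.inr ⟨0, hconst x⟩⟩ : GeneralizedRay X) :=
    ContinuousMap.continuous_const'.subtype_mk _
  exact (continuous_endpoint.comp hcont).congr fun x => endpoint_eq_point (T := 0) (hconst x)

theorem IsGeodesicSegment.exists_generalizedRay {e : ℝ → X} {x y : X}
    (he : IsGeodesicSegment e x y) : ∃ c : GeneralizedRay X,
      c.endpoint = .point y ∧ ∀ t : ℝ≥0, t ≤ dist x y → c.1 t = e t := by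
  lift dist x y to ℝ≥0 using dist_nonneg with T hT
  have hmem (t : ℝ≥0) : ((min t T : ℝ≥0) : ℝ) ∈ Icc 0 (dist x y) :=
    ⟨NNReal.coe_nonneg _, hT ▸ NNReal.coe_le_coe.2 (min_le_right t T)⟩
  have hdist (s t : ℝ≥0) :
      dist (e (min s T : ℝ≥0)) (e (min t T : ℝ≥0)) = dist (min s T) (min t T) := by
    rw [he.dist_eq _ (hmem s) _ (hmem t), NNReal.dist_eq]
  have hcont : Continuous fun t : ℝ≥0 => e (min t T : ℝ≥0) := by
    refine Metric.continuous_iff'.2 fun s ε hε => ?_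
    have hmin : Continuous fun t : ℝ≥0 => min t T := by fun_prop
    simpa only [hdist] using Metric.continuous_iff'.1 hmin s ε hε
  refine ⟨⟨⟨_, hcont⟩, Or.inr ⟨T, hdist⟩⟩, ?_, fun t ht => ?_⟩
  · rw [endpoint_eq_point (T := T) hdist, ContinuousMap.coe_mk, min_self, hT, he.right]
  · rw [ContinuousMap.coe_mk, min_eq_left (NNReal.coe_le_coe.1 ht)]

namespace IsCAT0

theorem dist_segment_ray_le_div_mul (hX : IsCAT0 X) (c : GeodesicRay X) {e : ℝ → X} {y : X}
    {R : ℝ} {s t : ℝ≥0} (he : IsGeodesicSegment e (c.1 0) y) (hy : dist y (c.1 s) ≤ R)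
    (ht : t ≤ dist (c.1 0) y) :
    dist (e t) (c.1 t) ≤ t / dist (c.1 0) y * (2 * R) := by
  have hleft := he.dividesSegment ⟨t.2, ht⟩
  have hlen := abs_dist_sub_le y (c.1 s) (c.1 0)
  rw [dist_comm y (c.1 0), dist_comm (c.1 s), c.dist_zero] at hlen
  lift dist (c.1 0) y to ℝ≥0 using dist_nonneg with L
  have hright : dist y (c.1 L) ≤ 2 * R := by
    have hsL : dist (c.1 s) (c.1 L) ≤ dist y (c.1 s) := by rwa [c.dist_eq, abs_sub_comm]
    linarith [dist_triangle y (c.1 s) (c.1 L)]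
  calc dist (e t) (c.1 t) ≤ t / L * dist y (c.1 L) :=
        hX.dist_le_mul (by positivity) (div_le_one_of_le₀ ht L.2) hleft
          (c.dividesSegment (NNReal.coe_le_coe.1 ht))
    _ ≤ t / L * (2 * R) := by gcongr

theorem tendsto_generalizedRay (hX : IsCAT0 X) (c : GeodesicRay X) {ι : Type*} {l : Filter ι}
    {y : ι → X} {s : ι → ℝ≥0} {R : ℝ} {e : ι → ℝ → X} {e' : ι → GeneralizedRay X}
    (he : ∀ i, IsGeodesicSegment (e i) (c.1 0) (y i))
    (he' : ∀ i, ∀ t : ℝ≥0, t ≤ dist (c.1 0) (y i) → (e' i).1 t = e i t)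
    (hs : Tendsto s l atTop) (hy : ∀ i, dist (y i) (c.1 (s i)) ≤ R) :
    Tendsto e' l (𝓝 ⟨c.1, Or.inl c.2⟩) := by
  have hlen : Tendsto (fun i => dist (c.1 0) (y i)) l atTop := by
    refine tendsto_atTop_mono (fun i => ?_)
      (tendsto_atTop_add_const_right l (-R) (NNReal.tendsto_coe_atTop.2 hs))
    have htri := dist_triangle (c.1 0) (y i) (c.1 (s i))
    rw [c.dist_zero] at htri
    linarith [hy i]
  rw [tendsto_subtype_rng, ContinuousMap.tendsto_iff_tendstoLocallyUniformly,
    Metric.tendstoLocallyUniformly_iff]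
  intro ε hε q
  refine ⟨Iio (q + 1), Iio_mem_nhds (by simp), ?_⟩
  have hsmall : Tendsto (fun i => (q + 1 : ℝ) / dist (c.1 0) (y i) * (2 * R)) l (𝓝 0) := by
    simpa using (hlen.const_div_atTop (q + 1 : ℝ)).mul_const (2 * R)
  filter_upwards [hsmall.eventually_lt_const hε, hlen.eventually_ge_atTop (q + 1 : ℝ)]
    with i hi hqi t ht
  have htq : (t : ℝ) ≤ q + 1 := by exact_mod_cast (mem_Iio.1 ht).le
  have hR : 0 ≤ R := dist_nonneg.trans (hy i)
  rw [dist_comm, he' i t (htq.trans hqi)]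
  refine (hX.dist_segment_ray_le_div_mul c (he i) (hy i) (htq.trans hqi)).trans_lt
    (lt_of_le_of_lt ?_ hi)
  gcongr

theorem tendsto_point (hX : IsCAT0 X) (c : GeodesicRay X) {ι : Type*} {l : Filter ι}
    {y : ι → X} {s : ι → ℝ≥0} {R : ℝ} (hs : Tendsto s l atTop)
    (hy : ∀ i, dist (y i) (c.1 (s i)) ≤ R) :
    Tendsto (fun i => Bordification.point (y i)) l (𝓝 (.ideal (Quotient.mk _ c))) := by
  choose e he using fun i => hX.exists_isGeodesicSegment (c.1 0) (y i)
  choose e' hpoint he' using fun i => (he i).exists_generalizedRay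
  have hlim := (continuous_endpoint.tendsto _).comp
    (hX.tendsto_generalizedRay c he he' hs hy)
  rw [endpoint_eq_ideal] at hlim
  simpa only [Function.comp_def, hpoint] using hlim

end IsCAT0

namespace Joins

variable {γ : ℝ → X} {ξ η : Boundary X}

theorem exists_forall_point_mem (hX : IsCAT0 X) (h : Joins γ ξ η) (R : ℝ)
    {A : Set (Bordification X)} (hA : IsOpen A) (hη : Bordification.ideal η ∈ A) :
    ∃ T : ℝ, ∀ s, T ≤ s → ∀ y, dist y (γ s) ≤ R → Bordification.point y ∈ A := by
  by_contra! hfar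
  choose s hs y hy hyA using fun n : ℕ => hfar n
  have hs0 (n : ℕ) : 0 ≤ s n := (Nat.cast_nonneg n).trans (hs n)
  have hatTop : Tendsto (fun n => (⟨s n, hs0 n⟩ : ℝ≥0)) atTop atTop :=
    NNReal.tendsto_coe_atTop.1 (tendsto_atTop_mono hs tendsto_natCast_atTop_atTop)
  have hlim := hX.tendsto_point (lineRay γ h.isometry 0) (y := y) (R := R) hatTop fun n => by
    change dist (y n) (γ (0 + s n)) ≤ R
    rw [zero_add]
    exact hy n
  rw [h.mk_lineRay 0] at hlim
  obtain ⟨n, hn⟩ := (hlim.eventually (hA.mem_nhds hη)).exists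
  exact hyA n hn

variable [ProperSpace X]

theorem exists_dist_le (hX : IsCAT0 X) (h : Joins γ ξ η) (R : ℝ) (x : X)
    {A₁ A₂ : Set (Bordification X)} (hA₁ : IsOpen A₁) (hξ : Bordification.ideal ξ ∈ A₁)
    (hA₂ : IsOpen A₂) (hη : Bordification.ideal η ∈ A₂) :
    ∃ ρ : ℝ, ∀ y, Metric.infDist y (range γ) ≤ R → Bordification.point y ∉ A₁ ∪ A₂ →
      dist y x ≤ ρ := by
  obtain ⟨T₁, hT₁⟩ := h.symm.exists_forall_point_mem hX R hA₁ hξ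
  obtain ⟨T₂, hT₂⟩ := h.exists_forall_point_mem hX R hA₂ hη
  refine ⟨R + max T₁ T₂ + dist (γ 0) x, fun y hy hyA => ?_⟩
  obtain ⟨s, hs⟩ := h.exists_dist_eq y
  rw [← hs] at hy
  have hsT₂ : s < T₂ := not_le.1 fun hle => hyA (Or.inr (hT₂ s hle y hy))
  have hsT₁ : -s < T₁ := not_le.1 fun hle => hyA (Or.inl (hT₁ (-s) hle y (by rwa [neg_neg])))
  have habs : |s| ≤ max T₁ T₂ :=
    abs_le.2 ⟨by linarith [le_max_left T₁ T₂], by linarith [le_max_right T₁ T₂]⟩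
  have htri := dist_triangle4 y (γ s) (γ 0) x
  rw [h.isometry.dist_eq, Real.dist_eq, sub_zero] at htri
  linarith

end Joins

variable [ProperSpace X] {G : Subgroup (X ≃ᵢ X)} {x₀ : X} {r : ℝ≥0} {u v : X} {B : ℝ}
  {c : Boundary X × Boundary X}

theorem tsupport_cochain_subset (hX : IsCAT0 X) (hB : 0 < B) (huv : 3 ≤ dist u v) {γ : ℝ → X}
    (h : Joins γ c.1 c.2) (hγ : IsContracting B (range γ)) :
    tsupport (cochain G x₀ r u v hX c) ⊆
      {z : G × G | dist ((z.2 : X ≃ᵢ X) x₀) ((z.1 : X ≃ᵢ X) x₀) ≤ 1 ∧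
        Metric.infDist ((z.1 : X ≃ᵢ X) x₀) (range γ) ≤ r * max (16 * B) (2 * r)} := by
  have hfst : Continuous fun z : G × G => (z.1 : X ≃ᵢ X) x₀ :=
    (continuous_subgroup_apply_const x₀).comp continuous_fst
  have hsnd : Continuous fun z : G × G => (z.2 : X ≃ᵢ X) x₀ :=
    (continuous_subgroup_apply_const x₀).comp continuous_snd
  refine closure_minimal (fun z hz => ?_) ((isClosed_le (hsnd.dist hfst) continuous_const).inter
    (isClosed_le ((Metric.continuous_infDist_pt _).comp hfst) continuous_const))
  rw [Function.mem_support, cochain_apply] at hz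
  exact ⟨(dist_lt_of_bump_ne_zero (left_ne_zero_of_mul hz)).le,
    infDist_le_of_pairKernel_ne_zero hX hB huv h hγ (right_ne_zero_of_mul hz)⟩

theorem isCompact_tsupport_cochain (hX : IsCAT0 X) (hG : IsClosed (G : Set (X ≃ᵢ X)))
    (hB : 0 < B) (huv : 3 ≤ dist u v) (hc : c ∈ contractingPairs X B)
    {A₁ A₂ : Set (Bordification X)} (hA₁ : IsOpen A₁) (hc₁ : Bordification.ideal c.1 ∈ A₁)
    (hA₂ : IsOpen A₂) (hc₂ : Bordification.ideal c.2 ∈ A₂) :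
    IsCompact (tsupport (cochain G x₀ r u v hX c) ∩
      {z : G × G | Bordification.point ((z.1 : X ≃ᵢ X) x₀) ∉ A₁ ∪ A₂}) := by
  obtain ⟨-, γ, hγ, hγB⟩ := mem_contractingPairs.1 hc
  obtain ⟨ρ, hρ⟩ := hγ.exists_dist_le hX (r * max (16 * B) (2 * r)) x₀ hA₁ hc₁ hA₂ hc₂
  have hcont : Continuous fun z : G × G => Bordification.point ((z.1 : X ≃ᵢ X) x₀) :=
    continuous_point.comp ((continuous_subgroup_apply_const x₀).comp continuous_fst)
  refine ((isCompact_setOf_dist_le hG x₀ x₀ ρ).prod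
    (isCompact_setOf_dist_le hG x₀ x₀ (1 + ρ))).of_isClosed_subset
    ((isClosed_tsupport _).inter ((hA₁.union hA₂).isClosed_compl.preimage hcont)) ?_
  rintro z ⟨hz, hzA⟩
  obtain ⟨hdist, hinf⟩ := tsupport_cochain_subset hX hB huv hγ hγB hz
  have hzρ := hρ _ hinf hzA
  exact ⟨hzρ, (dist_triangle _ ((z.1 : X ≃ᵢ X) x₀) x₀).trans (add_le_add hdist hzρ)⟩

theorem isAdmissibleMap_cochain (hX : IsCAT0 X) (hG : IsClosed (G : Set (X ≃ᵢ X)))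
    [MeasurableSpace G] [BorelSpace G] (μ : Measure G) [μ.IsHaarMeasure] (hB : 0 < B)
    (huv : 3 ≤ dist u v) {a b ξ : Boundary X} (hT : ![a, b, ξ] ∈ contractingTriples G B)
    (hne : tripleKernel G x₀ r u v ![a, b, ξ] 1 ≠ 0) :
    IsAdmissibleMap G μ B x₀ a b ξ (cochain G x₀ r u v hX) where
  continuousOn := (continuous_cochain hX).continuousOn
  bounded c _ := ⟨1, abs_cochain_le_one hX c⟩
  equivariant c _ g z := cochain_smul hX c g z
  antisymmetric c _ := cochain_swap hX c
  support c hc _ _ hA₁ hc₁ hA₂ hc₂ := isCompact_tsupport_cochain hX hG hB huv hc hA₁ hc₁ hA₂ hc₂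
  coboundary p _ hp hp' := by
    have := sigmaFinite_of_isClosed μ hG x₀
    have hmem {t : Fin 3 → Boundary X} (ht : t ∈ contractingTriples G B) :
        MemLp (coboundaryFun G x₀ r u v t) p (μ.prod μ) :=
      memLp_coboundaryFun hX hG hB huv hp hp' ht.2.2
    refine ⟨lpCocycle G x₀ r u v μ p, fun t ht => ?_,
      isContinuousBoundedCocycle_lpCocycle hX hG hB huv hp hp',
      lpCocycle_ne_zero hX (hmem hT) hne⟩
    exact (coeFn_lpCocycle (hmem ht)).trans (.of_forall (coboundaryFun_eq hX t))

end Support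

/-! ### Contracting axes -/

section Axes

variable {X : Type*} [MetricSpace X] {γ : ℝ → X} {ξ η : Boundary X}

namespace Joins

theorem smul_eq_of_translate (h : Joins γ ξ η) {g : X ≃ᵢ X} {τ : ℝ}
    (hg : ∀ t, g (γ t) = γ (t + τ)) : g • η = η := by
  have hray : mapRay g (lineRay γ h.isometry 0) = lineRay γ h.isometry τ := by
    ext t
    change g (γ (0 + t)) = γ (τ + t)
    rw [hg, zero_add, add_comm]
  rw [← h.mk_lineRay 0, smul_mk, hray, h.mk_lineRay, h.mk_lineRay]

theorem ne (hX : IsCAT0 X) (h : Joins γ ξ η) : ξ ≠ η := by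
  rintro rfl
  have hpos := h.rayPoint hX 0 1
  have hneg := h.symm.rayPoint hX 0 1
  rw [neg_zero, hpos] at hneg
  have := h.isometry.injective hneg
  norm_num at this

end Joins

/-- The isometry `g` translates the contracting line `γ`, which goes from `c.1` to `c.2`, by `τ`.
Unlike in `IsAxis`, neither `τ` nor the contraction constant `B` is related to the minimal
displacement. -/
structure IsContractingAxis (g : X ≃ᵢ X) (γ : ℝ → X) (τ B : ℝ) (c : Boundary X × Boundary X) :
    Prop where
  translation_pos : 0 < τ
  constant_pos : 0 < B
  joins : Joins γ c.1 c.2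
  contracting : IsContracting B (range γ)
  apply_eq : ∀ t, g (γ t) = γ (t + τ)

variable {g : X ≃ᵢ X} {τ B : ℝ} {c : Boundary X × Boundary X}

namespace IsContractingAxis

theorem symm (h : IsContractingAxis g γ τ B c) :
    IsContractingAxis g⁻¹ (fun t => γ (-t)) τ B c.swap where
  translation_pos := h.translation_pos
  constant_pos := h.constant_pos
  joins := h.joins.symm
  contracting := by
    rw [range_comp_neg]
    exact h.contracting
  apply_eq t := by
    refine g.symm_apply_eq.2 ?_
    rw [h.apply_eq, neg_add, neg_add_cancel_right]

theorem smul (h : IsContractingAxis g γ τ B c) (f : X ≃ᵢ X) :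
    IsContractingAxis (f * g * f⁻¹) (fun t => f (γ t)) τ B (f • c) where
  translation_pos := h.translation_pos
  constant_pos := h.constant_pos
  joins := h.joins.smul f
  contracting := range_comp f γ ▸ h.contracting.smul f
  apply_eq t := by
    change f (g (f.symm (f (γ t)))) = f (γ (t + τ))
    rw [f.symm_apply_apply, h.apply_eq]

theorem zpow_apply (h : IsContractingAxis g γ τ B c) (k : ℤ) (t : ℝ) :
    (g ^ k) (γ t) = γ (t + k * τ) := by
  induction k using Int.induction_on with
  | zero => simp
  | succ k ih =>
    rw [add_comm, zpow_add, zpow_one]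
    change g ((g ^ (k : ℤ)) (γ t)) = _
    rw [ih, h.apply_eq]
    congr 1
    push_cast
    ring
  | pred k ih =>
    rw [sub_eq_add_neg, add_comm, zpow_add, zpow_neg_one]
    change g.symm ((g ^ (-(k : ℤ))) (γ t)) = _
    rw [ih, IsometryEquiv.symm_apply_eq, h.apply_eq]
    congr 1
    push_cast
    ring

theorem smul_eq (h : IsContractingAxis g γ τ B c) : g • c = c :=
  Prod.ext (inv_smul_eq_iff.1 (h.symm.joins.smul_eq_of_translate h.symm.apply_eq)).symm
    (h.joins.smul_eq_of_translate h.apply_eq)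

theorem zpow_smul_eq (h : IsContractingAxis g γ τ B c) (k : ℤ) : g ^ k • c = c :=
  (MulAction.stabilizer (X ≃ᵢ X) c).zpow_mem (MulAction.mem_stabilizer_iff.2 h.smul_eq) k

end IsContractingAxis

variable {G : Subgroup (X ≃ᵢ X)}

variable (G) in
/-- Some element of `G` translates a contracting line from `c.1` to `c.2` in the direction of
`c.2`. -/
def HasContractingAxis (c : Boundary X × Boundary X) : Prop :=
  ∃ g ∈ G, ∃ γ τ B, IsContractingAxis g γ τ B c

namespace HasContractingAxis

theorem symm (h : HasContractingAxis G c) : HasContractingAxis G c.swap := by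
  obtain ⟨g, hg, γ, τ, B, haxis⟩ := h
  exact ⟨g⁻¹, G.inv_mem hg, _, τ, B, haxis.symm⟩

theorem smul (h : HasContractingAxis G c) (f : G) : HasContractingAxis G (f • c) := by
  obtain ⟨g, hg, γ, τ, B, haxis⟩ := h
  exact ⟨f * g * f⁻¹, G.mul_mem (G.mul_mem f.2 hg) (G.inv_mem f.2), _, τ, B, haxis.smul f⟩

end HasContractingAxis

theorem IsRankOnePair.hasContractingAxis (hX : IsCAT0 X) {a b : Boundary X}
    (h : IsRankOnePair G a b) : HasContractingAxis G (a, b) := by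
  obtain ⟨-, g, hgG, ⟨⟨τ, hτ, hleast⟩, B, hB, γ, ⟨hγ, τ', hleast', hg⟩, hγB⟩, hfix⟩ := h
  obtain rfl := hleast.unique hleast'
  have haxis : IsContractingAxis g γ τ B (negEnd γ hγ, posEnd γ hγ) :=
    ⟨hτ, hB, ⟨hγ, rfl, rfl⟩, hγB, hg⟩
  have key : HasContractingAxis G (negEnd γ hγ, posEnd γ hγ) := ⟨g, hgG, γ, τ, B, haxis⟩
  have hneg : negEnd γ hγ ∈ ({a, b} : Set (Boundary X)) :=
    hfix ▸ congrArg Prod.fst haxis.smul_eq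
  have hpos : posEnd γ hγ ∈ ({a, b} : Set (Boundary X)) :=
    hfix ▸ congrArg Prod.snd haxis.smul_eq
  have hne : negEnd γ hγ ≠ posEnd γ hγ := haxis.joins.ne hX
  rcases hneg with hneg | hneg <;> rcases hpos with hpos | hpos
  · exact absurd (hneg.trans hpos.symm) hne
  · rwa [hneg, hpos] at key
  · rw [hneg, hpos] at key
    exact key.symm
  · exact absurd (hneg.trans hpos.symm) hne

end Axes

/-! ### Orbits of pairs of endpoints of axes -/

section Orbits

variable {X : Type*} [MetricSpace X]

/-- The pair `c` is close to the pair `e`, as seen from `x₀` at distance `n`. -/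
def IsNear (x₀ : X) (n : ℝ≥0) (c e : Boundary X × Boundary X) : Prop :=
  dist (rayPoint x₀ n c.1) (rayPoint x₀ n e.1) ≤ 1 ∧
    dist (rayPoint x₀ n c.2) (rayPoint x₀ n e.2) ≤ 1

theorem IsNear.one_le_dist {x₀ : X} {n : ℝ≥0} {c e : Boundary X × Boundary X}
    (h : IsNear x₀ n c e) (he : 3 ≤ dist (rayPoint x₀ n e.1) (rayPoint x₀ n e.2)) :
    1 ≤ dist (rayPoint x₀ n c.1) (rayPoint x₀ n c.2) := by
  linarith [h.1, h.2, dist_triangle4_left (rayPoint x₀ n c.1) (rayPoint x₀ n c.2)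
    (rayPoint x₀ n e.1) (rayPoint x₀ n e.2)]

variable [ProperSpace X]

theorem IsNear.mono (hX : IsCAT0 X) {x₀ : X} {m n : ℝ≥0} (hmn : m ≤ n)
    {c e : Boundary X × Boundary X} (h : IsNear x₀ n c e) : IsNear x₀ m c e :=
  ⟨(hX.monotone_dist_rayPoint x₀ _ _ hmn).trans h.1,
    (hX.monotone_dist_rayPoint x₀ _ _ hmn).trans h.2⟩

variable {G : Subgroup (X ≃ᵢ X)} {c e : Boundary X × Boundary X}

theorem isNear_inv_smul_iff (hX : IsCAT0 X) {x₀ : X} {n : ℝ≥0} {g : G} :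
    IsNear x₀ n (g⁻¹ • c) e ↔
      dist (rayPoint ((g : X ≃ᵢ X) x₀) n c.1) ((g : X ≃ᵢ X) (rayPoint x₀ n e.1)) ≤ 1 ∧
        dist (rayPoint ((g : X ≃ᵢ X) x₀) n c.2) ((g : X ≃ᵢ X) (rayPoint x₀ n e.2)) ≤ 1 := by
  have hdist (ξ : Boundary X) (y : X) : dist (rayPoint x₀ n ((g⁻¹ : X ≃ᵢ X) • ξ)) y =
      dist (rayPoint ((g : X ≃ᵢ X) x₀) n ξ) ((g : X ≃ᵢ X) y) := by
    rw [← (g : X ≃ᵢ X).isometry.dist_eq, ← hX.smul_rayPoint, smul_inv_smul]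
  rw [← hdist, ← hdist]
  rfl

namespace IsCAT0

theorem tendsto_rayPoint_smul (hX : IsCAT0 X) {ι : Type*} {l : Filter ι} {F : ι → X ≃ᵢ X}
    {g : X ≃ᵢ X} (hF : Tendsto F l (𝓝 g)) (x : X) (s : ℝ≥0) (ξ : Boundary X) :
    Tendsto (fun i => rayPoint x s (F i • ξ)) l (𝓝 (rayPoint x s (g • ξ))) := by
  rw [tendsto_isometryEquiv_iff] at hF
  have hray := hF (rayPoint (g.symm x) s ξ)
  have hbase := hF (g.symm x)
  rw [← hX.smul_rayPoint, g.apply_symm_apply] at hray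
  rw [g.apply_symm_apply] at hbase
  refine hray.congr_dist (squeeze_zero (fun _ => dist_nonneg) (fun i => ?_)
    (tendsto_iff_dist_tendsto_zero.1 hbase))
  rw [← hX.smul_rayPoint]
  exact hX.dist_rayPoint_le _ _ _ _

theorem tendsto_rayPoint_of_dist_le (hX : IsCAT0 X) {x : X} {ξ : ℕ → Boundary X}
    {η : Boundary X} {C : ℝ} (h : ∀ n : ℕ, dist (rayPoint x n (ξ n)) (rayPoint x n η) ≤ C)
    (s : ℝ≥0) : Tendsto (fun n => rayPoint x s (ξ n)) atTop (𝓝 (rayPoint x s η)) := by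
  rw [tendsto_iff_dist_tendsto_zero]
  refine squeeze_zero' (.of_forall fun _ => dist_nonneg) ?_
    (tendsto_const_div_atTop_nhds_zero_nat (s * C))
  filter_upwards [tendsto_natCast_atTop_atTop.eventually_ge_atTop s,
    eventually_gt_atTop 0] with n hsn hn
  rw [le_div_iff₀' (Nat.cast_pos.2 hn)]
  exact (hX.mul_dist_rayPoint_le x (ξ n) η hsn).trans (by gcongr; exact h n)

theorem smul_eq_of_dist_le (hX : IsCAT0 X) {l : Filter ℕ} [l.NeBot] (hl : l ≤ atTop)
    {F : ℕ → X ≃ᵢ X} {g : X ≃ᵢ X} (hF : Tendsto F l (𝓝 g)) {x : X} {ξ η : Boundary X} {C : ℝ}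
    (h : ∀ n : ℕ, dist (rayPoint x n (F n • ξ)) (rayPoint x n η) ≤ C) : g • ξ = η :=
  hX.eq_of_rayPoint_eq x fun s => tendsto_nhds_unique (hX.tendsto_rayPoint_smul hF x s ξ)
    ((hX.tendsto_rayPoint_of_dist_le h s).mono_left hl)

end IsCAT0

namespace IsContractingAxis

variable {g : X ≃ᵢ X} {γ : ℝ → X} {τ B : ℝ}

theorem exists_zpow_dist_le (h : IsContractingAxis g γ τ B c) (x : X) :
    ∃ k : ℤ, dist ((g ^ k) (γ 0)) x ≤ τ + Metric.infDist x (range γ) := by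
  obtain ⟨s, hs⟩ := h.joins.exists_dist_eq x
  have hτ := h.translation_pos
  have hfloor : ⌊s / τ⌋ * τ ≤ s := (le_div_iff₀ hτ).1 (Int.floor_le _)
  have hceil : s < (⌊s / τ⌋ + 1) * τ := (div_lt_iff₀ hτ).1 (Int.lt_floor_add_one _)
  refine ⟨⌊s / τ⌋, (dist_triangle _ (γ s) _).trans (add_le_add ?_ ?_)⟩
  · rw [h.zpow_apply, h.joins.isometry.dist_eq, zero_add, Real.dist_eq]
    exact abs_le.2 ⟨by linarith, by linarith⟩
  · rw [dist_comm, hs]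

theorem exists_zpow_dist_le_of_isNear (hX : IsCAT0 X) (h : IsContractingAxis g γ τ B c)
    {x₀ : X} {n : ℝ≥0} {f : X ≃ᵢ X} (hf : IsNear x₀ n (f • c) e)
    (he : 3 ≤ dist (rayPoint x₀ n e.1) (rayPoint x₀ n e.2)) :
    ∃ k : ℤ, dist ((f * g ^ k) (γ 0)) x₀ ≤ τ + n * max (16 * B) (2 * n) := by
  have hfg := h.smul f
  obtain ⟨k, hk⟩ := hfg.exists_zpow_dist_le x₀
  have happly : ((f * g * f⁻¹) ^ k) (f (γ 0)) = (f * g ^ k) (γ 0) := by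
    rw [conj_zpow]
    exact congrArg (f * g ^ k) (f.symm_apply_apply (γ 0))
  rw [happly] at hk
  exact ⟨k, hk.trans (add_le_add_right (hfg.joins.infDist_le_of_one_le_dist_rayPoint hX
    hfg.constant_pos hfg.contracting (hf.one_le_dist he)) τ)⟩

end IsContractingAxis

/-- The orbit of the pair of endpoints of a contracting axis is closed: if the translates of the
pair come close to `e`, powers of the axial element keep the translating elements bounded. -/
theorem HasContractingAxis.exists_smul_eq (hX : IsCAT0 X) (hG : IsClosed (G : Set (X ≃ᵢ X)))
    (x₀ : X) (hc : HasContractingAxis G c) (he : e.1 ≠ e.2)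
    (h : ∀ n : ℕ, ∃ g : G, IsNear x₀ n (g • c) e) : ∃ g : G, g • c = e := by
  obtain ⟨a, haG, γ, τ, B, ha⟩ := hc
  obtain ⟨N, hN⟩ : ∃ N : ℕ, 3 ≤ dist (rayPoint x₀ N e.1) (rayPoint x₀ N e.2) :=
    (((hX.tendsto_dist_rayPoint x₀ he).comp tendsto_natCast_atTop_atTop).eventually_ge_atTop
      3).exists
  have hbounded (n : ℕ) : ∃ w : G, IsNear x₀ n (w • c) e ∧
      dist ((w : X ≃ᵢ X) (γ 0)) x₀ ≤ τ + (N : ℝ≥0) * max (16 * B) (2 * (N : ℝ≥0)) := by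
    obtain ⟨g, hg⟩ := h (max n N)
    obtain ⟨k, hk⟩ := ha.exists_zpow_dist_le_of_isNear hX
      (hg.mono hX (Nat.cast_le.2 (le_max_right n N))) hN
    have hsmul : (g * ⟨a, haG⟩ ^ k) • c = g • c := by
      rw [mul_smul]
      exact congrArg (g • ·) (ha.zpow_smul_eq k)
    refine ⟨g * ⟨a, haG⟩ ^ k, ?_, hk⟩
    rw [hsmul]
    exact hg.mono hX (Nat.cast_le.2 (le_max_left n N))
  choose w hnear hdist using hbounded
  obtain ⟨g, hg⟩ := exists_tendsto_subgroup hG (hyperfilter ℕ) (.of_forall hdist)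
  have hlim (ξ η : Boundary X)
      (hξ : ∀ n : ℕ, dist (rayPoint x₀ n (w n • ξ)) (rayPoint x₀ n η) ≤ 1) : g • ξ = η :=
    hX.smul_eq_of_dist_le Nat.hyperfilter_le_atTop (tendsto_subtype_rng.1 hg) hξ
  exact ⟨g, Prod.ext (hlim c.1 e.1 fun n => (hnear n).1) (hlim c.2 e.2 fun n => (hnear n).2)⟩

theorem Joins.eventually_lt_infDist (hX : IsCAT0 X) {γ γ₁ γ₂ : ℝ → X} {x y z : Boundary X}
    (h : Joins γ y z) (h₁ : Joins γ₁ x z) (h₂ : Joins γ₂ x y) (m : ℝ) :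
    ∀ᶠ t in atTop, m < Metric.infDist (γ t) (range γ₂) := by
  set M := max (max m (Metric.infDist (γ 0) (range γ₂))) (dist (γ 0) (γ₁ 0))
  have hM : 0 ≤ M := dist_nonneg.trans (le_max_right _ _)
  have hγ (t : ℝ) : Metric.infDist (γ t) (range γ) ≤ M :=
    (Metric.infDist_zero_of_mem (mem_range_self t)).trans_le hM
  have hγ₁ {t : ℝ} (ht : 0 ≤ t) : Metric.infDist (γ t) (range fun s => γ₁ (-s)) ≤ M := by
    rw [range_comp_neg]
    refine ((Metric.infDist_le_dist_of_mem (mem_range_self t)).trans ?_).trans (le_max_right _ _)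
    lift t to ℝ≥0 using ht
    have := hX.dist_rayPoint_le (γ 0) (γ₁ 0) t z
    rwa [h.rayPoint hX, h₁.rayPoint hX, zero_add] at this
  filter_upwards [eventually_gt_atTop (8 * M), eventually_ge_atTop 0] with t hMt ht
  by_contra! hcon
  have := hX.dist_le_of_infDist_le h h₁.symm h₂ (hγ t) (hγ₁ ht)
    (hcon.trans ((le_max_left _ _).trans (le_max_left _ _))) (hγ 0) (hγ₁ le_rfl)
    ((le_max_right _ _).trans (le_max_left _ _))
  rw [h.isometry.dist_eq, Real.dist_eq, sub_zero, abs_of_nonneg ht] at this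
  linarith

theorem IsContractingAxis.exists_isNear (hX : IsCAT0 X) {B B' τ : ℝ} (hB : 0 < B)
    {x y z : Boundary X} {γ γ₁ : ℝ → X} {a : G} (ha : IsContractingAxis (a : X ≃ᵢ X) γ τ B' (y, z))
    (hγ₁ : Joins γ₁ x z) (hxy : (x, y) ∈ contractingPairs X B) (n : ℝ≥0) :
    ∃ g : G, IsNear (γ 0) n (g • (x, z)) (y, z) := by
  obtain ⟨-, γ₂, hγ₂, hγ₂B⟩ := mem_contractingPairs.1 hxy
  obtain ⟨k, hk⟩ := (((tendsto_natCast_atTop_atTop (R := ℝ)).atTop_mul_const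
    ha.translation_pos).eventually
      (ha.joins.eventually_lt_infDist hX hγ₁ hγ₂ (n * max (16 * B) (2 * n)))).exists
  have hbase : ((a ^ (k : ℤ) : G) : X ≃ᵢ X) (γ 0) = γ (k * τ) := by
    have := ha.zpow_apply k 0
    rwa [zero_add, Int.cast_natCast] at this
  obtain ⟨hy, hz⟩ : ((a ^ (k : ℤ) : G) : X ≃ᵢ X) • y = y ∧ ((a ^ (k : ℤ) : G) : X ≃ᵢ X) • z = z :=
    Prod.mk_inj.1 (ha.zpow_smul_eq k)
  have hxy' : dist (rayPoint (γ (k * τ)) n x) (rayPoint (γ (k * τ)) n y) ≤ 1 :=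
    le_of_not_ge fun hge =>
      hk.not_ge (hγ₂.infDist_le_of_one_le_dist_rayPoint hX hB hγ₂B hge)
  refine ⟨(a ^ (k : ℤ))⁻¹, (isNear_inv_smul_iff hX).2 ?_⟩
  rw [← hX.smul_rayPoint, ← hX.smul_rayPoint, hbase, hy, hz, dist_self]
  exact ⟨hxy', zero_le_one⟩

/-- Along the axis from `y` to `z`, the points `x` and `y` come together as seen from a point
moving towards `z`; moving this point back by powers of the axial element makes `(x, z)` converge
to `(y, z)`. -/
theorem HasContractingAxis.exists_smul_eq_of_common (hX : IsCAT0 X)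
    (hG : IsClosed (G : Set (X ≃ᵢ X))) {B : ℝ} (hB : 0 < B) {x y z : Boundary X}
    (hx : HasContractingAxis G (x, z)) (hy : HasContractingAxis G (y, z))
    (hxy : (x, y) ∈ contractingPairs X B) : ∃ g : G, g • x = y ∧ g • z = z := by
  obtain ⟨_, _, γ₁, _, _, hγ₁⟩ := id hx
  obtain ⟨a, haG, γ, τ, B', ha⟩ := hy
  obtain ⟨g, hg⟩ := hx.exists_smul_eq hX hG (γ 0) (ha.joins.ne hX) fun n =>
    ha.exists_isNear (a := ⟨a, haG⟩) hX hB hγ₁.joins hxy n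
  exact ⟨g, congrArg Prod.fst hg, congrArg Prod.snd hg⟩

end Orbits

/-! ### Existence of the cochain -/

section Existence

variable {X : Type*} [MetricSpace X] {G : Subgroup (X ≃ᵢ X)} {x₀ : X} {r : ℝ≥0}

theorem tripleKernel_one_eq_one {t : Fin 3 → Boundary X}
    (ht : ∀ i, 1 ≤ dist (rayPoint x₀ r (t i)) (rayPoint x₀ r (t (i + 1)))) (j : Fin 3) :
    tripleKernel G x₀ r (rayPoint x₀ r (t j)) (rayPoint x₀ r (t (j + 1))) t 1 = 1 := by
  have hcycle : ∀ i : Fin 3, i + 1 + 1 + 1 = i := by decide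
  have hnext : ∀ i j : Fin 3, i ≠ j → i = j + 1 ∨ i = j + 1 + 1 := by decide
  have hleft : 1 ≤ dist (rayPoint x₀ r (t (j + 1 + 1))) (rayPoint x₀ r (t j)) := by
    simpa only [hcycle] using ht (j + 1 + 1)
  have hright : 1 ≤ dist (rayPoint x₀ r (t (j + 1 + 1))) (rayPoint x₀ r (t (j + 1))) := by
    simpa only [dist_comm] using ht (j + 1)
  have hkernel (i : Fin 3) : pairKernel G x₀ r (rayPoint x₀ r (t j)) (rayPoint x₀ r (t (j + 1)))
      (t i, t (i + 1)) 1 = pairFun (rayPoint x₀ r (t j)) (rayPoint x₀ r (t (j + 1)))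
        (rayPoint x₀ r (t i)) (rayPoint x₀ r (t (i + 1))) := rfl
  simp only [tripleKernel, hkernel]
  refine (Finset.sum_eq_single j (fun i _ hij => ?_) (by simp)).trans (pairFun_self (ht j))
  rcases hnext i j hij with rfl | rfl
  · exact pairFun_eq_zero_right _ hleft hright
  · rw [hcycle]
    exact pairFun_eq_zero_left _ hleft hright

variable [ProperSpace X] {B : ℝ} {c e : Boundary X × Boundary X}

theorem isNear_of_cochain_ne_zero (hX : IsCAT0 X) {z : G × G}
    (h : cochain G x₀ r (rayPoint x₀ r e.1) (rayPoint x₀ r e.2) hX c z ≠ 0) :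
    IsNear x₀ r (z.1⁻¹ • c) e ∨ IsNear x₀ r (z.1⁻¹ • c) e.swap := by
  rw [isNear_inv_smul_iff hX, isNear_inv_smul_iff hX]
  rw [cochain_apply] at h
  exact (dist_lt_of_pairFun_ne_zero (right_ne_zero_of_mul h)).imp
    (fun ⟨h₁, h₂⟩ => ⟨h₁.le, h₂.le⟩) fun ⟨h₁, h₂⟩ => ⟨h₂.le, h₁.le⟩

theorem isClosed_setOf_isNear (hX : IsCAT0 X) (e : Boundary X × Boundary X) :
    IsClosed {w : (Boundary X × Boundary X) × (G × G) | IsNear x₀ r (w.2.1⁻¹ • w.1) e} := by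
  simp only [isNear_inv_smul_iff hX]
  have hfst : Continuous fun w : (Boundary X × Boundary X) × (G × G) => w.2.1 := by fun_prop
  have hdist {k : (Boundary X × Boundary X) × (G × G) → Boundary X} (hk : Continuous k) (y : X) :
      Continuous fun w => dist (rayPoint ((w.2.1 : X ≃ᵢ X) x₀) r (k w)) ((w.2.1 : X ≃ᵢ X) y) :=
    (hX.continuous_rayPoint_subgroup hfst hk).dist ((continuous_subgroup_apply_const y).comp hfst)
  exact (isClosed_le (hdist (by fun_prop) _) continuous_const).inter
    (isClosed_le (hdist (by fun_prop) _) continuous_const)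

theorem notMem_pairSupport_cochain (hX : IsCAT0 X) (h : ∀ g : G, ¬ IsNear x₀ r (g • c) e)
    (h' : ∀ g : G, ¬ IsNear x₀ r (g • c) e.swap) (z : G × G) :
    (c, z) ∉ pairSupport G B
      (cochain G x₀ r (rayPoint x₀ r e.1) (rayPoint x₀ r e.2) hX) := by
  have hsub := closure_minimal
    (s := {w : (Boundary X × Boundary X) × (G × G) | w.1 ∈ contractingPairs X B ∧
      cochain G x₀ r (rayPoint x₀ r e.1) (rayPoint x₀ r e.2) hX w.1 w.2 ≠ 0})
    (fun w hw => isNear_of_cochain_ne_zero hX hw.2)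
    ((isClosed_setOf_isNear hX e).union (isClosed_setOf_isNear hX e.swap))
  exact fun hz => (hsub hz).elim (h z.1⁻¹) (h' z.1⁻¹)

theorem HasContractingAxis.eventually_not_isNear (hX : IsCAT0 X)
    (hG : IsClosed (G : Set (X ≃ᵢ X))) (hc : HasContractingAxis G c) (he : e.1 ≠ e.2)
    (h : ∀ g : G, g • c ≠ e) : ∀ᶠ n : ℕ in atTop, ∀ g : G, ¬ IsNear x₀ n (g • c) e := by
  obtain ⟨n, hn⟩ : ∃ n : ℕ, ∀ g : G, ¬ IsNear x₀ n (g • c) e := by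
    by_contra! hnear
    obtain ⟨g, hg⟩ := hc.exists_smul_eq hX hG x₀ he hnear
    exact h g hg
  filter_upwards [eventually_ge_atTop n] with m hnm g hg
  exact hn g (hg.mono hX (Nat.cast_le.2 hnm))

variable {t : Fin 3 → Boundary X}

/-- Rotate about the three corners in turn. -/
theorem exists_smul_eq_swap (hX : IsCAT0 X) (hG : IsClosed (G : Set (X ≃ᵢ X))) (hB : 0 < B)
    (ht : t ∈ joinedTriples X B) (haxis : ∀ i, HasContractingAxis G (t i, t (i + 1))) :
    ∃ g : G, g • (t 0, t 1) = (t 1, t 0) := by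
  obtain ⟨f, hf₀ : f • t 0 = t 2, hf₁ : f • t 1 = t 1⟩ :=
    (haxis 0).exists_smul_eq_of_common hX hG hB (haxis 1).symm
      (mem_contractingPairs_of_mem_joinedTriples ht (by decide : (0 : Fin 3) ≠ 2))
  obtain ⟨g, hg₁ : g • t 1 = t 0, hg₂ : g • t 2 = t 2⟩ :=
    (haxis 1).exists_smul_eq_of_common hX hG hB (haxis 2).symm
      (mem_contractingPairs_of_mem_joinedTriples ht (by decide : (1 : Fin 3) ≠ 0))
  obtain ⟨h, hh₂ : h • t 2 = t 1, hh₀ : h • t 0 = t 0⟩ :=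
    (haxis 2).exists_smul_eq_of_common hX hG hB (haxis 0).symm
      (mem_contractingPairs_of_mem_joinedTriples ht (by decide : (2 : Fin 3) ≠ 1))
  refine ⟨h * g * f, Prod.ext ?_ ?_⟩
  · change (h * g * f) • t 0 = t 1
    rw [mul_smul, mul_smul, hf₀, hg₂, hh₂]
  · change (h * g * f) • t 1 = t 0
    rw [mul_smul, mul_smul, hf₁, hg₁, hh₀]

theorem exists_side_forall_smul_ne (hX : IsCAT0 X) (hG : IsClosed (G : Set (X ≃ᵢ X)))
    (hB : 0 < B) (ht : t ∈ joinedTriples X B) {ι : Type*} {c : ι → Boundary X × Boundary X}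
    (hc : ∀ i, HasContractingAxis G (c i))
    (hd : ∀ i, Disjoint (MulAction.orbit G (c i)) (MulAction.orbit G (t 0, t 1))) :
    ∃ j, ∀ i, ∀ g : G, g • c i ≠ (t j, t (j + 1)) ∧ g • c i ≠ (t (j + 1), t j) := by
  by_contra! hside
  have haxis (j : Fin 3) : HasContractingAxis G (t j, t (j + 1)) := by
    obtain ⟨i, g, hg⟩ := hside j
    have hgc := (hc i).smul g
    by_cases h : g • c i = (t j, t (j + 1))
    · rwa [h] at hgc
    · rw [hg h] at hgc
      exact hgc.symm
  have hne (i : ι) (g h : G) : g • c i ≠ h • (t 0, t 1) := fun heq =>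
    disjoint_left.1 (hd i) ⟨g, rfl⟩ ⟨h, heq.symm⟩
  obtain ⟨f, hf⟩ := exists_smul_eq_swap hX hG hB ht haxis
  obtain ⟨i, g, hg⟩ := hside 0
  have hflip : g • c i = (t 1, t 0) := hg fun h => hne i g 1 (h.trans (one_smul G _).symm)
  exact hne i g f (hflip.trans hf.symm)

theorem exists_notMem_pairSupport_cochain (hX : IsCAT0 X) (hG : IsClosed (G : Set (X ≃ᵢ X)))
    (x₀ : X) (hB : 0 < B) (ht : t ∈ joinedTriples X B) {ι : Type*} [Finite ι]
    {c : ι → Boundary X × Boundary X} (hc : ∀ i, HasContractingAxis G (c i))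
    (hd : ∀ i, Disjoint (MulAction.orbit G (c i)) (MulAction.orbit G (t 0, t 1))) :
    ∃ (r : ℝ≥0) (u v : X), 3 ≤ dist u v ∧ tripleKernel G x₀ r u v t 1 = 1 ∧
      ∀ i z, (c i, z) ∉ pairSupport G B (cochain G x₀ r u v hX) := by
  obtain ⟨j, hj⟩ := exists_side_forall_smul_ne hX hG hB ht hc hd
  have hne (i : Fin 3) : t i ≠ t (i + 1) := (ht i).1
  have hfar : ∀ᶠ n : ℕ in atTop, ∀ i,
      3 ≤ dist (rayPoint x₀ n (t i)) (rayPoint x₀ n (t (i + 1))) := eventually_all.2 fun i =>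
    ((hX.tendsto_dist_rayPoint x₀ (hne i)).comp tendsto_natCast_atTop_atTop).eventually_ge_atTop 3
  have hnear : ∀ᶠ n : ℕ in atTop, ∀ i, ∀ g : G, ¬ IsNear x₀ n (g • c i) (t j, t (j + 1)) :=
    eventually_all.2 fun i =>
      (hc i).eventually_not_isNear hX hG (hne j) fun g => (hj i g).1
  have hnear' : ∀ᶠ n : ℕ in atTop, ∀ i, ∀ g : G, ¬ IsNear x₀ n (g • c i) (t (j + 1), t j) :=
    eventually_all.2 fun i =>
      (hc i).eventually_not_isNear hX hG (hne j).symm fun g => (hj i g).2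
  obtain ⟨n, h₃, h, h'⟩ := (hfar.and (hnear.and hnear')).exists
  exact ⟨n, rayPoint x₀ n (t j), rayPoint x₀ n (t (j + 1)), h₃ j,
    tripleKernel_one_eq_one (fun i => (h₃ i).trans' (by norm_num)) j,
    fun i => notMem_pairSupport_cochain (e := (t j, t (j + 1))) hX (h i) (h' i)⟩

end Existence

end RankOne

theorem mainTheorem3_general {X : Type*} [MetricSpace X] [ProperSpace X] (hX : IsCAT0 X)
    (G : Subgroup (X ≃ᵢ X)) (hclosed : IsClosed (G : Set (X ≃ᵢ X)))
    [MeasurableSpace G] [BorelSpace G] (μ : Measure G) [μ.IsHaarMeasure]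
    (x₀ : X) (B : ℝ) (hB : 0 < B) (a b ξ : Boundary X) (hT : ![a, b, ξ] ∈ contractingTriples G B)
    {ι : Type*} [Finite ι] (c : ι → Boundary X × Boundary X)
    (hc : ∀ i, IsRankOnePair G (c i).1 (c i).2)
    (hd : ∀ i, Disjoint (MulAction.orbit G (c i)) (MulAction.orbit G (a, b))) :
    ∃ α : Boundary X × Boundary X → C(G × G, ℝ), IsAdmissibleMap G μ B x₀ a b ξ α ∧
      ∀ i, ∀ z : G × G, (c i, z) ∉ pairSupport G B α := by
  obtain ⟨r, u, v, huv, hne, hsupp⟩ := exists_notMem_pairSupport_cochain hX hclosed x₀ hB hT.2.2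
    (fun i => (hc i).hasContractingAxis hX) hd
  exact ⟨cochain G x₀ r u v hX,
    isAdmissibleMap_cochain hX hclosed μ hB huv hT (hne.trans_ne one_ne_zero), hsupp⟩

theorem mainTheorem3 {X : Type*} [MetricSpace X] [ProperSpace X] (hX : IsCAT0 X)
    (G : Subgroup (X ≃ᵢ X)) (hclosed : IsClosed (G : Set (X ≃ᵢ X))) (hG : IsNonElementary G)
    [MeasurableSpace G] [BorelSpace G] (μ : Measure G) [μ.IsHaarMeasure]
    (x₀ : X) (B : ℝ) (hB : 0 < B)
    (a b ξ : Boundary X) (hT : ![a, b, ξ] ∈ contractingTriples G B)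
    (hab : IsRankOnePair G a b) :
    (∃ α : Boundary X × Boundary X → C(G × G, ℝ), IsAdmissibleMap G μ B x₀ a b ξ α) ∧
    (¬ IsTransitiveOnPairs G →
      ∀ (k : ℕ) (c : Fin k → Boundary X × Boundary X),
        (∀ i, c i ∈ contractingPairs X B) →
        (∀ i, IsRankOnePair G (c i).1 (c i).2) →
        (∀ i, Disjoint (MulAction.orbit G (c i)) (MulAction.orbit G (a, b))) →
        ∃ α : Boundary X × Boundary X → C(G × G, ℝ), IsAdmissibleMap G μ B x₀ a b ξ α ∧
          ∀ i, ∀ z : G × G, (c i, z) ∉ pairSupport G B α) := by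
  refine ⟨?_, fun _ k c _ hc hd => mainTheorem3_general hX G hclosed μ x₀ B hB a b ξ hT c hc hd⟩
  obtain ⟨α, hα, -⟩ := mainTheorem3_general hX G hclosed μ x₀ B hB a b ξ hT (ι := Empty)
    Empty.elim (fun i => i.elim) fun i => i.elim
  exact ⟨α, hα⟩
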